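/- **Setting.** For $j\in\{1,2\}$ let $A_j\in\mathbb R^{2\times2}$ be invertible, $\mathcal R_j=A_j\mathbb Z^2$, $\mathcal R_j^*=2\pi A_j^{-T}\mathbb Z^2$, with unit cells $\Gamma_j=A_j[0,1)^2$, $\Gamma_j^*=2\pi A_j^{-T}[0,1)^2$ (also used as tori), and let $\mathcal A_j$ be a finite set of orbitals. The lattices are incommensurate: $\mathcal R_1\cap\mathcal R_2=\{0\}$ and $\mathcal R_1^*\cap\mathcal R_2^*=\{0\}$. In every formula $i\in\{1,2\}$ with $i\ne j$ is the opposite layer. The four Hilbert spaces are $$\mathcal X^{\rm rl}=\bigoplus_j\ell^2(\mathcal R_j\times\mathcal A_j),\quad \mathcal X^{\rm rp}=\bigoplus_j\ell^2(\mathcal R_i^*\times\mathcal A_j),\quad \mathcal X^{\rm cf}=\bigoplus_jL^2_{\rm per}(\Gamma_i;\mathbb C^{\mathcal A_j}),\quad \mathcal X^{\rm ms}=\bigoplus_jL^2_{\rm per}(\Gamma_j^*;\mathbb C^{\mathcal A_j}),$$ and $\Omega=\bigsqcup_j\mathcal R_j\times\mathcal A_j$, $\Omega^*=\bigsqcup_j\mathcal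 R_i^*\times\mathcal A_j$ are the index sets of the first two. **Hopping functions.** A hermitian hopping function $\mathfrak h=(\mathfrak h_{jk})_{j,k\in\{1,2\}}$ consists of real analytic matrix-valued functions $\mathfrak h_{jj}(q,b)$ on the product of tori $\Gamma_j^*\times\Gamma_i$, and continuous matrix-valued functions $\mathfrak h_{ji}$ on $\mathbb R^2$ such that $\mathfrak h_{ji}$ and $\hat{\mathfrak h}_{ji}(\xi)=(2\pi)^{-2}\int\mathfrak h_{ji}(x)e^{-ix\cdot\xi}dx$ decay exponentially, with $\mathfrak h_{12}(x)=\mathfrak h_{21}(-x)^*$ and, for the Fourier modes in both variables, $[\mathfrak h_{jj}]_{RG}=[\mathfrak h_{jj}]_{-R,-G}^*e^{-iG\cdot R}$ for $R\in\mathcal R_j$, $G\in\mathcal R_i^*$; here $*$ is the conjugate transpose. Its momentum-space counterpart is $$\tilde{\mathfrak h}_{jj}(b,q)=\mathfrak h_{jj}(-q,b)^*,\qquad \tilde{\mathfrak h}_{ji}(\xi)=|\Gamma_1^*|^{1/2}|\Gamma_2^*|^{1/2}\,\hat{\mathfrak h}_{ji}(\xi).$$ Write $[f]_L(y)$ for the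 Fourier mode of $f(\cdot,y)$ in the first variable, normalized so that $f(\xi,y)=\sum_L[f]_L(y)e^{iL\cdot\xi}$. The Hamiltonians are the bounded operators $$\begin{aligned} (\pi^{\rm cf}(\mathfrak h)\psi)_j(b)&=\sum_{R\in\mathcal R_j}[\mathfrak h_{jj}]_R(b)\psi_j(b-R)+\sum_{R\in\mathcal R_i}\mathfrak h_{ji}(b-R)\psi_i(-b+R),\\ (\pi^{\rm ms}(\tilde{\mathfrak h})\psi)_j(q)&=\sum_{G\in\mathcal R_i^*}[\tilde{\mathfrak h}_{jj}]_G(q)\psi_j(q-G)+\sum_{G\in\mathcal R_j^*}\tilde{\mathfrak h}_{ji}(q+G)\psi_i(q+G), \end{aligned}$$ and the infinite matrices $\pi^{\rm rl}(\mathfrak h)$, with entries $[\mathfrak h_{jj}]_{R-R',\alpha\alpha'}(R)$ inside layer $j$ and $[\mathfrak h_{ji}]_{\alpha\alpha'}(R-R')$ from layer $i$ to layer $j$, and $\pi^{\rm rp}(\tilde{\mathfrak h})$, with entries $[\tilde{\mathfrak h}_{jj}]_{G-G',\alpha\alpha'}(G)$ and $[\tilde{\mathfrak h}_{ji}]_{\alpha\alpha'}(G+G')$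 respectively. **Observables.** Let $n\ge1$, let $\mathfrak h_1,\dots,\mathfrak h_n$ be hermitian hopping functions with counterparts $\tilde{\mathfrak h}_1,\dots,\tilde{\mathfrak h}_n$, and put $H_k^{\rm arb}=\pi^{\rm arb}(\mathfrak h_k)$ for ${\rm arb}\in\{{\rm rl},{\rm cf}\}$ and $H_k^{\rm arb}=\pi^{\rm arb}(\tilde{\mathfrak h}_k)$ for ${\rm arb}\in\{{\rm rp},{\rm ms}\}$. Let $\varepsilon>0$, and for each $k$ let $C_k\subset\mathbb C$ be a rectifiable simple closed contour which, for each of the four spaces, goes once counterclockwise around $\sigma(H_k^{\rm arb})$ at distance at least $\varepsilon$ from it. Let $g$ be analytic on the product of the interiors of the $C_k$ and continuous up to the contours. With $\mathcal S=C_1\times\dots\times C_n$ put, in each of the four spaces, $$O^{\rm arb}=\int_{\mathcal S}g(z)\,(z_1-H_1^{\rm arb})^{-1}\cdots(z_n-H_n^{\rm arb})^{-1}\,dz_1\cdots dz_n .$$ **Traces.** With $\Omega_r=\{R\alpha\in\Omega:|R|<r\}$ and $\Omega_r^*=\{G\alpha\in\Omega^*:|G|<r\}$, $$\underline{\rm Tr}\,O^{\rm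 rl}=\lim_{r\to\infty}\frac1{\#\Omega_r}\sum_{R\alpha\in\Omega_r}O^{\rm rl}_{R\alpha,R\alpha},\qquad \underline{\rm Tr}\,O^{\rm rp}=\lim_{r\to\infty}\frac1{\#\Omega^*_r}\sum_{G\alpha\in\Omega^*_r}O^{\rm rp}_{G\alpha,G\alpha}.$$ If the diagonal blocks of $O^{\rm cf}$ and $O^{\rm ms}$ are written as $$[O^{\rm cf}]_{jj}\phi=\sum_{R\in\mathcal R_j}a_{j,R}(\cdot)\,\phi(\cdot-R),\qquad [O^{\rm ms}]_{jj}\phi=\sum_{G\in\mathcal R_i^*}\tilde a_{j,G}(\cdot)\,\phi(\cdot-G)$$ with continuous periodic matrix-valued coefficients whose maximum norms are summable (the hopping functions of the observable), then $$\operatorname{Tr}O^{\rm cf}=\frac{\sum_j\int_{\Gamma_i}\operatorname{tr}a_{j,0}(b)\,db}{|\mathcal A_1||\Gamma_2|+|\mathcal A_2||\Gamma_1|},\qquad \operatorname{Tr}O^{\rm ms}=\frac{\sum_j\int_{\Gamma_j^*}\operatorname{tr}\tilde a_{j,0}(q)\,dq}{|\mathcal A_1||\Gamma_1^*|+|\mathcal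 A_2||\Gamma_2^*|}.$$ (If $\mathcal A_1=\mathcal A_2=\varnothing$, all the quotients are read as $0$.) **Theorem.** The two thermodynamic limits exist, the coefficients $a$ and $\tilde a$ exist, the traces do not depend on their choice, and $$\underline{\rm Tr}\,O^{\rm rp}=\operatorname{Tr}O^{\rm ms}=\underline{\rm Tr}\,O^{\rm rl}=\operatorname{Tr}O^{\rm cf}.$$ -/

import Mathlib

open MeasureTheory Filter Topology
open scoped Matrix

namespace Bilayer

universe u

/-- The Euclidean plane. -/
abbrev Plane : Type := EuclideanSpace ℝ (Fin 2)

/-- The layers are labelled by `0, 1 : Fin 2`; `other j` is the opposite layer. -/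
def other (j : Fin 2) : Fin 2 := 1 - j

theorem ne_other (j : Fin 2) : j ≠ other j := by
  revert j; decide

noncomputable section

/-! ### Lattices and unit cells -/

/-- The vector `B t` of the plane. -/
def mulV (B : Matrix (Fin 2) (Fin 2) ℝ) (t : Fin 2 → ℝ) : Plane := WithLp.toLp 2 (B *ᵥ t)

/-- The lattice `B ℤ²`. -/
def lattice (B : Matrix (Fin 2) (Fin 2) ℝ) : AddSubgroup Plane where
  carrier := {x | ∃ m : Fin 2 → ℤ, x = mulV B (fun i => (m i : ℝ))}
  zero_mem' := ⟨0, by ext i; fin_cases i <;> simp [mulV]⟩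
  add_mem' := by
    rintro x y ⟨m, rfl⟩ ⟨k, rfl⟩
    refine ⟨m + k, ?_⟩
    ext i
    fin_cases i <;> simp [mulV] <;> ring
  neg_mem' := by
    rintro x ⟨m, rfl⟩
    refine ⟨-m, ?_⟩
    ext i
    fin_cases i <;> simp [mulV] <;> ring

/-- The half-open unit cell `B [0,1)²`. -/
def cell (B : Matrix (Fin 2) (Fin 2) ℝ) : Set Plane :=
  {x | ∃ t : Fin 2 → ℝ, (∀ i, t i ∈ Set.Ico (0 : ℝ) 1) ∧ x = mulV B t}

/-- The area of the unit cell. -/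
def cellArea (B : Matrix (Fin 2) (Fin 2) ℝ) : ℝ := (volume (cell B)).toReal

/-- The matrix `2π B⁻ᵀ`, which generates the reciprocal lattice of `B ℤ²`. -/
def recip (B : Matrix (Fin 2) (Fin 2) ℝ) : Matrix (Fin 2) (Fin 2) ℝ :=
  (2 * Real.pi) • (B⁻¹)ᵀ

/-- The representative in the unit cell of a point of the plane, modulo the lattice `B ℤ²`. -/
def reduce (B : Matrix (Fin 2) (Fin 2) ℝ) (x : Plane) : Plane :=
  mulV B (fun i => Int.fract ((B⁻¹ *ᵥ x.ofLp) i))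

/-- Incommensurability: the two lattices meet only in `0`, and so do the two reciprocal lattices. -/
def Incommensurate (A : Fin 2 → Matrix (Fin 2) (Fin 2) ℝ) : Prop :=
  lattice (A 0) ⊓ lattice (A 1) = ⊥ ∧ lattice (recip (A 0)) ⊓ lattice (recip (A 1)) = ⊥

/-- The tori of configuration space: layer `j` lives on the unit cell of the opposite lattice. -/
def cfTori (A : Fin 2 → Matrix (Fin 2) (Fin 2) ℝ) : Fin 2 → Matrix (Fin 2) (Fin 2) ℝ :=
  fun j => A (other j)

/-- The tori of momentum space: layer `j` lives on the unit cell of its own reciprocal lattice. -/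
def msTori (A : Fin 2 → Matrix (Fin 2) (Fin 2) ℝ) : Fin 2 → Matrix (Fin 2) (Fin 2) ℝ :=
  fun j => recip (A j)

/-- The lattices of real space: layer `j` is indexed by its own lattice. -/
def rlLat (A : Fin 2 → Matrix (Fin 2) (Fin 2) ℝ) : Fin 2 → Matrix (Fin 2) (Fin 2) ℝ :=
  fun j => A j

/-- The lattices of reciprocal space: layer `j` is indexed by the opposite reciprocal lattice. -/
def rpLat (A : Fin 2 → Matrix (Fin 2) (Fin 2) ℝ) : Fin 2 → Matrix (Fin 2) (Fin 2) ℝ :=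
  fun j => recip (A (other j))

/-! ### Hopping functions -/

/-- The character `x ↦ exp (i k · x)`. -/
def expI (k x : Plane) : ℂ := Complex.exp (Complex.I * ((inner ℝ k x : ℝ) : ℂ))

/-- The data of a matrix of hopping functions: intralayer functions of two plane variables and
interlayer functions of one plane variable. -/
structure Hopping (𝒜 : Fin 2 → Type u) where
  intra : ∀ j, Plane → Plane → Matrix (𝒜 j) (𝒜 j) ℂ
  inter : ∀ i j, i ≠ j → Plane → Matrix (𝒜 i) (𝒜 j) ℂ

/-- Fourier mode in the first variable:
`f_L(y) = |B[0,1)²|⁻¹ ∫_{B[0,1)²} f(ξ,y) exp(-i L·ξ) dξ`. -/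
def mode₁ {𝓂 𝓃 : Type u} (B : Matrix (Fin 2) (Fin 2) ℝ) (f : Plane → Plane → Matrix 𝓂 𝓃 ℂ)
    (L y : Plane) : Matrix 𝓂 𝓃 ℂ :=
  Matrix.of fun α β => ((cellArea B)⁻¹ : ℂ) * ∫ ξ in cell B, f ξ y α β * expI (-L) ξ

/-- Fourier mode in both variables:
`f_{L₁L₂} = (|𝕋₁||𝕋₂|)⁻¹ ∫_{𝕋₁} ∫_{𝕋₂} f(ξ₁,ξ₂) exp(-i (L₁·ξ₁ + L₂·ξ₂)) dξ₂ dξ₁`. -/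
def mode₂ {𝓂 𝓃 : Type u} (B₁ B₂ : Matrix (Fin 2) (Fin 2) ℝ)
    (f : Plane → Plane → Matrix 𝓂 𝓃 ℂ) (L₁ L₂ : Plane) : Matrix 𝓂 𝓃 ℂ :=
  Matrix.of fun α β => ((cellArea B₁ * cellArea B₂)⁻¹ : ℂ) *
    ∫ ξ₁ in cell B₁, ∫ ξ₂ in cell B₂, f ξ₁ ξ₂ α β * (expI (-L₁) ξ₁ * expI (-L₂) ξ₂)

/-- Fourier transform on the plane, `f^(ξ) = (2π)⁻² ∫ f(x) exp(-i x·ξ) dx`. -/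
def fourierPlane {𝓂 𝓃 : Type u} (f : Plane → Matrix 𝓂 𝓃 ℂ) (ξ : Plane) : Matrix 𝓂 𝓃 ℂ :=
  Matrix.of fun α β => (((2 * Real.pi) ^ 2)⁻¹ : ℂ) * ∫ x, f x α β * expI (-x) ξ

/-- Matrix-valued real analytic functions on the product of the tori `ℝ²/B₁ℤ²` and `ℝ²/B₂ℤ²`. -/
structure IsTorusAnalytic {𝓂 𝓃 : Type u} (B₁ B₂ : Matrix (Fin 2) (Fin 2) ℝ)
    (f : Plane → Plane → Matrix 𝓂 𝓃 ℂ) : Prop where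
  periodic₁ : ∀ L ∈ lattice B₁, ∀ x y, f (x + L) y = f x y
  periodic₂ : ∀ L ∈ lattice B₂, ∀ x y, f x (y + L) = f x y
  analytic : ∀ α β, AnalyticOnNhd ℝ (fun p : Plane × Plane => f p.1 p.2 α β) Set.univ

/-- Exponential decay of every matrix entry. -/
def ExpDecay {𝓂 𝓃 : Type u} (f : Plane → Matrix 𝓂 𝓃 ℂ) : Prop :=
  ∃ γ > (0 : ℝ), ∃ C : ℝ, ∀ x α β, ‖f x α β‖ ≤ C * Real.exp (-γ * ‖x‖)

/-- Interlayer hopping functions: exponential decay of the function and of its Fourier transform.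
The function is identified with its continuous representative; square integrability
follows from continuity and decay. -/
structure IsInterlayer {𝓂 𝓃 : Type u} (f : Plane → Matrix 𝓂 𝓃 ℂ) : Prop where
  continuous : ∀ α β, Continuous fun x => f x α β
  decay : ExpDecay f
  fourier_decay : ExpDecay (fourierPlane f)

/-- The hermitian configuration space hopping functions. -/
structure Hopping.IsCfHerm {𝒜 : Fin 2 → Type u} (A : Fin 2 → Matrix (Fin 2) (Fin 2) ℝ)
    (h : Hopping 𝒜) : Prop where
  analytic : ∀ j, IsTorusAnalytic (recip (A j)) (A (other j)) (h.intra j)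
  interlayer : ∀ i j hij, IsInterlayer (h.inter i j hij)
  herm_intra : ∀ j, ∀ R ∈ lattice (A j), ∀ G ∈ lattice (recip (A (other j))),
    mode₂ (recip (A j)) (A (other j)) (h.intra j) R G
      = expI (-G) R • (mode₂ (recip (A j)) (A (other j)) (h.intra j) (-R) (-G))ᴴ
  herm_inter : ∀ i j (hij : i ≠ j) x, h.inter i j hij x = (h.inter j i hij.symm (-x))ᴴ

/-- The momentum space hopping functions `h~` which correspond to `h`:
`h~_jj(b,q) = h_jj(-q,b)ᴴ` and `h~_ij(ξ) = |Γ₁*|^{1/2} |Γ₂*|^{1/2} h_ij^(ξ)`. -/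
def Hopping.dual {𝒜 : Fin 2 → Type u} (A : Fin 2 → Matrix (Fin 2) (Fin 2) ℝ)
    (h : Hopping 𝒜) : Hopping 𝒜 where
  intra j b q := (h.intra j (-q) b)ᴴ
  inter i j hij ξ := ((√(cellArea (recip (A 0))) * √(cellArea (recip (A 1))) : ℝ) : ℂ) •
    fourierPlane (h.inter i j hij) ξ

/-! ### The four Hilbert spaces -/

/-- `⨁_j L²_per(ℝ²/B_jℤ²; ℂ^{𝒜_j})`, realized on the unit cells. -/
abbrev TorusSpace (B : Fin 2 → Matrix (Fin 2) (Fin 2) ℝ) (𝒜 : Fin 2 → Type u)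
    [∀ j, Fintype (𝒜 j)] : Type u :=
  PiLp 2 fun j => Lp (EuclideanSpace ℂ (𝒜 j)) 2 (volume.restrict (cell (B j)))

/-- The value at a point of the plane of the periodic extension of an element of `L²` of the cell. -/
def perVal {𝓃 : Type u} [Fintype 𝓃] (B : Matrix (Fin 2) (Fin 2) ℝ)
    (φ : Lp (EuclideanSpace ℂ 𝓃) 2 (volume.restrict (cell B))) (x : Plane) (α : 𝓃) : ℂ :=
  (φ (reduce B x)) α

/-- The disjoint union over the layers `j` of the index sets `(L_j ℤ²) × 𝒜_j`. -/
abbrev Sites (L : Fin 2 → Matrix (Fin 2) (Fin 2) ℝ) (𝒜 : Fin 2 → Type u) : Type u :=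
  Σ j, lattice (L j) × 𝒜 j

/-- `ℓ²` of the sites. -/
abbrev SiteSpace (L : Fin 2 → Matrix (Fin 2) (Fin 2) ℝ) (𝒜 : Fin 2 → Type u) : Type u :=
  lp (fun _ : Sites L 𝒜 => ℂ) 2

open Classical in
/-- The bounded operator on `TorusSpace B 𝒜` that is given almost everywhere by the formula `F`
(it is unique if it exists; the value is `0` if there is none). -/
def torusOp {B : Fin 2 → Matrix (Fin 2) (Fin 2) ℝ} {𝒜 : Fin 2 → Type u} [∀ j, Fintype (𝒜 j)]
    (F : TorusSpace B 𝒜 → ∀ j, Plane → 𝒜 j → ℂ) : TorusSpace B 𝒜 →L[ℂ] TorusSpace B 𝒜 :=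
  if h : ∃ T : TorusSpace B 𝒜 →L[ℂ] TorusSpace B 𝒜,
      ∀ ψ j, ∀ᵐ x : Plane, ∀ α, perVal (B j) ((T ψ) j) x α = F ψ j x α
  then h.choose else 0

open Classical in
/-- The bounded operator on `SiteSpace L 𝒜` that is given entrywise by the formula `F`
(it is unique if it exists; the value is `0` if there is none). -/
def siteOp {L : Fin 2 → Matrix (Fin 2) (Fin 2) ℝ} {𝒜 : Fin 2 → Type u}
    (F : SiteSpace L 𝒜 → Sites L 𝒜 → ℂ) : SiteSpace L 𝒜 →L[ℂ] SiteSpace L 𝒜 :=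
  if h : ∃ T : SiteSpace L 𝒜 →L[ℂ] SiteSpace L 𝒜, ∀ ψ p, (T ψ) p = F ψ p
  then h.choose else 0

/-! ### The operators generated by hopping functions in the four spaces -/

variable {𝒜 : Fin 2 → Type u} [∀ j, Fintype (𝒜 j)]

/-- Configuration space:
`(H ψ)_j(b) = ∑_{R ∈ R_j} [h_jj]_R(b) ψ_j(b-R) + ∑_{R ∈ R_i} h_ji(b-R) ψ_i(-b+R)`, `i ≠ j`. -/
def piCf (A : Fin 2 → Matrix (Fin 2) (Fin 2) ℝ) (h : Hopping 𝒜) :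
    TorusSpace (cfTori A) 𝒜 →L[ℂ] TorusSpace (cfTori A) 𝒜 :=
  torusOp fun ψ j b α =>
    (∑' R : lattice (A j), ∑ β, mode₁ (recip (A j)) (h.intra j) R b α β *
      perVal (cfTori A j) (ψ j) (b - R) β) +
    ∑' R : lattice (A (other j)), ∑ β, h.inter j (other j) (ne_other j) (b - R) α β *
      perVal (cfTori A (other j)) (ψ (other j)) (-b + R) β

/-- Momentum space:
`(H ψ)_j(q) = ∑_{G ∈ R_i*} [h_jj]_G(q) ψ_j(q-G) + ∑_{G ∈ R_j*} h_ji(q+G) ψ_i(q+G)`, `i ≠ j`. -/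
def piMs (A : Fin 2 → Matrix (Fin 2) (Fin 2) ℝ) (h : Hopping 𝒜) :
    TorusSpace (msTori A) 𝒜 →L[ℂ] TorusSpace (msTori A) 𝒜 :=
  torusOp fun ψ j q α =>
    (∑' G : lattice (recip (A (other j))), ∑ β, mode₁ (A (other j)) (h.intra j) G q α β *
      perVal (msTori A j) (ψ j) (q - G) β) +
    ∑' G : lattice (recip (A j)), ∑ β, h.inter j (other j) (ne_other j) (q + G) α β *
      perVal (msTori A (other j)) (ψ (other j)) (q + G) β

/-- Real space: the matrix entries are `[h_jj]_{R-R',αβ}(R)` between sites of the same layer `j`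
and `h_{ji,αβ}(R-R')` from layer `i ≠ j` to layer `j`. -/
def piRl (A : Fin 2 → Matrix (Fin 2) (Fin 2) ℝ) (h : Hopping 𝒜) :
    SiteSpace (rlLat A) 𝒜 →L[ℂ] SiteSpace (rlLat A) 𝒜 :=
  siteOp fun ψ p =>
    (∑' R' : lattice (rlLat A p.1), ∑ β,
      mode₁ (recip (A p.1)) (h.intra p.1) (p.2.1 - R') p.2.1 p.2.2 β * ψ ⟨p.1, (R', β)⟩) +
    ∑' R' : lattice (rlLat A (other p.1)), ∑ β,
      h.inter p.1 (other p.1) (ne_other p.1) (p.2.1 - R') p.2.2 β * ψ ⟨other p.1, (R', β)⟩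

/-- Reciprocal space: the matrix entries are `[h_jj]_{G-G',αβ}(G)` between sites of the same
layer `j` and `h_{ji,αβ}(G+G')` from layer `i ≠ j` to layer `j`. -/
def piRp (A : Fin 2 → Matrix (Fin 2) (Fin 2) ℝ) (h : Hopping 𝒜) :
    SiteSpace (rpLat A) 𝒜 →L[ℂ] SiteSpace (rpLat A) 𝒜 :=
  siteOp fun ψ p =>
    (∑' G' : lattice (rpLat A p.1), ∑ β,
      mode₁ (A (other p.1)) (h.intra p.1) (p.2.1 - G') p.2.1 p.2.2 β * ψ ⟨p.1, (G', β)⟩) +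
    ∑' G' : lattice (rpLat A (other p.1)), ∑ β,
      h.inter p.1 (other p.1) (ne_other p.1) (p.2.1 + G') p.2.2 β * ψ ⟨other p.1, (G', β)⟩

/-! ### Contours and observables -/

/-- The winding number about `w` of a closed curve parametrized by `[0,1]`. -/
def winding (γ : ℝ → ℂ) (w : ℂ) : ℂ :=
  (2 * Real.pi * Complex.I)⁻¹ * ∫ t in (0 : ℝ)..1, deriv γ t / (γ t - w)

/-- `γ` is a rectifiable (Lipschitz parametrized) simple closed contour that goes
once counterclockwise around the set `σ` and stays at distance at least `ε` from it. -/
structure IsContourAround (γ : ℝ → ℂ) (ε : ℝ) (σ : Set ℂ) : Prop where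
  lipschitz : ∃ K, LipschitzOnWith K γ (Set.Icc 0 1)
  closed : γ 0 = γ 1
  simple : Set.InjOn γ (Set.Ico 0 1)
  encloses : ∀ w ∈ σ, winding γ w = 1
  dist_le : ∀ t ∈ Set.Icc (0 : ℝ) 1, ∀ w ∈ σ, ε ≤ dist (γ t) w

/-- The interior of a simple closed contour. -/
def contourInterior (γ : ℝ → ℂ) : Set ℂ :=
  {w | w ∉ γ '' Set.Icc 0 1 ∧ winding γ w ≠ 0}

/-- `g` is analytic on the product of the interiors of the contours, and continuous
up to the contours. -/
structure IsAnalyticInside {n : ℕ} (γ : Fin n → ℝ → ℂ) (g : (Fin n → ℂ) → ℂ) : Prop where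
  analytic : AnalyticOnNhd ℂ g (Set.univ.pi fun k => contourInterior (γ k))
  continuousOn : ContinuousOn g
    (Set.univ.pi fun k => contourInterior (γ k) ∪ γ k '' Set.Icc 0 1)

/-- The observable `∫_{C₁ × ⋯ × C_n} g(z) (z₁ - H₁)⁻¹ ⋯ (z_n - H_n)⁻¹ dz₁ ⋯ dz_n`,
where the contour `C_k` is parametrized by `γ k`. -/
def observable {X : Type u} [NormedAddCommGroup X] [NormedSpace ℂ X] {n : ℕ}
    (γ : Fin n → ℝ → ℂ) (g : (Fin n → ℂ) → ℂ) (H : Fin n → X →L[ℂ] X) : X →L[ℂ] X :=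
  ∫ t in Set.Icc (0 : Fin n → ℝ) 1,
    (g (fun k => γ k (t k)) * ∏ k, deriv (γ k) (t k)) •
      (List.ofFn fun k => resolvent (H k) (γ k (t k))).prod

/-! ### Traces -/

open Classical in
/-- The matrix entry `O_{pp}`. -/
def diagEntry {L : Fin 2 → Matrix (Fin 2) (Fin 2) ℝ}
    (O : SiteSpace L 𝒜 →L[ℂ] SiteSpace L 𝒜) (p : Sites L 𝒜) : ℂ :=
  (O (lp.single 2 p 1)) p

/-- The sites in the open disc of radius `r`. -/
def sitesBall (L : Fin 2 → Matrix (Fin 2) (Fin 2) ℝ) (𝒜 : Fin 2 → Type u) (r : ℝ) :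
    Set (Sites L 𝒜) :=
  {p | ‖(p.2.1 : Plane)‖ < r}

/-- The thermodynamic limit trace of `O` exists and equals `τ`. -/
def HasThermoTrace {L : Fin 2 → Matrix (Fin 2) (Fin 2) ℝ}
    (O : SiteSpace L 𝒜 →L[ℂ] SiteSpace L 𝒜) (τ : ℂ) : Prop :=
  Tendsto (fun r : ℝ => ((sitesBall L 𝒜 r).ncard : ℂ)⁻¹ *
    ∑ᶠ p ∈ sitesBall L 𝒜 r, diagEntry O p) atTop (𝓝 τ)

/-- `a` is a hopping function of the diagonal block `O_jj` of the operator `O`: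
`O_jj φ = ∑_R a_R(·) φ(· - R)`, the sum over the lattice that acts on the torus `j` by
translations, with continuous periodic `a_R` whose maximum norms are summable. -/
structure IsBlockHopping {B : Fin 2 → Matrix (Fin 2) (Fin 2) ℝ}
    (O : TorusSpace B 𝒜 →L[ℂ] TorusSpace B 𝒜) (L : Fin 2 → Matrix (Fin 2) (Fin 2) ℝ)
    (j : Fin 2) (a : lattice (L j) → Plane → Matrix (𝒜 j) (𝒜 j) ℂ) : Prop where
  continuous : ∀ R α β, Continuous fun x => a R x α β
  periodic : ∀ R, ∀ K ∈ lattice (B j), ∀ x, a R (x + K) = a R x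
  summable : ∃ M : lattice (L j) → ℝ, Summable M ∧ ∀ R x α β, ‖a R x α β‖ ≤ M R
  repr : ∀ φ, ∀ᵐ x : Plane, ∀ α, perVal (B j) ((O (PiLp.single 2 j φ)) j) x α =
    ∑' R : lattice (L j), ∑ β, a R x α β * perVal (B j) φ (x - R) β

/-- The normalized trace
`(∑_j |𝒜_j| |Γ(B_j)|)⁻¹ ∑_j ∫_{Γ(B_j)} tr [a_j]_0(x) dx` of a family of hopping functions. -/
def hoppingTrace {L : Fin 2 → Matrix (Fin 2) (Fin 2) ℝ} (B : Fin 2 → Matrix (Fin 2) (Fin 2) ℝ)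
    (a : ∀ j, lattice (L j) → Plane → Matrix (𝒜 j) (𝒜 j) ℂ) : ℂ :=
  ((∑ j, (Fintype.card (𝒜 j) : ℝ) * cellArea (B j) : ℝ) : ℂ)⁻¹ *
    ∑ j, ∫ x in cell (B j), (a j 0 x).trace

/-- The trace of `O` is well defined and equals `τ`: the diagonal blocks of `O` have hopping
functions, and every choice of them has the normalized trace `τ`. -/
def HasTorusTrace {B : Fin 2 → Matrix (Fin 2) (Fin 2) ℝ}
    (O : TorusSpace B 𝒜 →L[ℂ] TorusSpace B 𝒜) (L : Fin 2 → Matrix (Fin 2) (Fin 2) ℝ)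
    (τ : ℂ) : Prop :=
  (∃ a : ∀ j, lattice (L j) → Plane → Matrix (𝒜 j) (𝒜 j) ℂ, ∀ j, IsBlockHopping O L j (a j)) ∧
  ∀ a : ∀ j, lattice (L j) → Plane → Matrix (𝒜 j) (𝒜 j) ℂ,
    (∀ j, IsBlockHopping O L j (a j)) → hoppingTrace B a = τ

end

end Bilayer

open MeasureTheory Filter Topology
open scoped Matrix Pointwise ContDiff BoundedContinuousFunction

namespace Bilayer

noncomputable section

/-! ### Geometry of lattices in the plane -/

section Lattice

variable {B : Matrix (Fin 2) (Fin 2) ℝ}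

/-! The real space and configuration space Hamiltonians are two faces of one family of infinite
matrices, the fibre operators `fiberOp L s D y`, indexed by a relative displacement `y` of the
layers. Real space is the fibre `y = 0`. The configuration space operator acts, for almost every
`y`, by the fibre matrix on the values of a periodic function along the lattice points (`IsFibred`).
Reciprocal and momentum space are related in the same way through the dual hopping functions. The
sign `s` is `-1` for the first pair and `1` for the second, because interlayer amplitudes depend on
`R - R'` in one and on `G + G'` in the other.

Translating the two layers by lattice vectors conjugates the fibre at `y` into the fibre at `y` plus
a lattice sum (`fiberKer_shift`). Incommensurability of the lattices dual to the site lattices makes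
these sums dense, so the resolvents at `y = 0` control all resolvents uniformly (`isUnit_fiberOp`).
The entries of the fibre observable are therefore continuous periodic functions of `y`. They decay
because conjugation by the weights `(1 + ε |R|) ^ 3` moves the fibre operators by `O(ε)` in norm and
preserves invertibility (`exists_wtFamily`). The same weights make sense of fibres of `L²`
functions, which need not be square summable. This gives hopping functions of the torus observables
(`isBlockHopping_obsHop`).

By covariance the diagonal entry of the site observable at `R` is the zeroth hopping function
sampled at `R`. Equidistribution of one lattice modulo the other turns the thermodynamic limit into
the integral mean (`hasThermoTrace_fiberObs`). Hence real space agrees with configuration space, and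
reciprocal space with momentum space.

The two pairs are linked by Fourier series. Normalized plane waves define an isometry from
reciprocal to configuration space that intertwines the Hamiltonians (`waveIso_comp_piRp`): the
intralayer part is Fourier inversion together with hermiticity, the interlayer part is Poisson
summation. Reciprocal diagonal entries are thus plane wave matrix elements of the configuration
space observable. On a plane wave `G` the translation by `R` is the phase `exp (-i R·G)`, and
averaging over `G` leaves only `R = 0` (`tendsto_latAvg_waveEntry`). This average sees the operator
alone, so the torus traces do not depend on the hopping functions chosen (`hoppingTrace_eq`). -/

/-- The coordinates of a point with respect to the columns of `B`. -/
def coord (B : Matrix (Fin 2) (Fin 2) ℝ) (x : Plane) : Fin 2 → ℝ := B⁻¹ *ᵥ x.ofLp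

theorem mulV_add (B : Matrix (Fin 2) (Fin 2) ℝ) (s t : Fin 2 → ℝ) :
    mulV B (s + t) = mulV B s + mulV B t := by
  rw [mulV, Matrix.mulVec_add, WithLp.toLp_add]; rfl

theorem coord_add (x y : Plane) : coord B (x + y) = coord B x + coord B y := by
  simp [coord, Matrix.mulVec_add]

theorem coord_mulV (hB : B.det ≠ 0) (t : Fin 2 → ℝ) : coord B (mulV B t) = t := by
  rw [coord, mulV, Matrix.mulVec_mulVec, Matrix.nonsing_inv_mul B (Ne.isUnit hB),
    Matrix.one_mulVec]

theorem mulV_coord (hB : B.det ≠ 0) (x : Plane) : mulV B (coord B x) = x := by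
  rw [coord, mulV, Matrix.mulVec_mulVec, Matrix.mul_nonsing_inv B (Ne.isUnit hB),
    Matrix.one_mulVec]

theorem continuous_mulV (B : Matrix (Fin 2) (Fin 2) ℝ) : Continuous (mulV B) := by
  unfold mulV
  fun_prop

theorem continuous_coord (B : Matrix (Fin 2) (Fin 2) ℝ) : Continuous (coord B) := by
  unfold coord
  fun_prop

theorem mem_cell_iff (hB : B.det ≠ 0) (x : Plane) :
    x ∈ cell B ↔ ∀ i, coord B x i ∈ Set.Ico (0 : ℝ) 1 := by
  constructor
  · rintro ⟨t, ht, rfl⟩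
    rwa [coord_mulV hB]
  · intro h
    exact ⟨coord B x, h, (mulV_coord hB x).symm⟩

instance countable_lattice (B : Matrix (Fin 2) (Fin 2) ℝ) : Countable (lattice B) := by
  have : Function.Surjective
      (fun m : Fin 2 → ℤ => (⟨mulV B (fun i => (m i : ℝ)), m, rfl⟩ : lattice B)) := by
    rintro ⟨x, m, rfl⟩
    exact ⟨m, rfl⟩
  exact this.countable

theorem reduce_mem_cell (B : Matrix (Fin 2) (Fin 2) ℝ) (x : Plane) : reduce B x ∈ cell B :=
  ⟨_, fun _ => ⟨Int.fract_nonneg _, Int.fract_lt_one _⟩, rfl⟩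

theorem sub_reduce_mem_lattice (hB : B.det ≠ 0) (x : Plane) : x - reduce B x ∈ lattice B := by
  refine ⟨fun i => ⌊coord B x i⌋, ?_⟩
  nth_rewrite 1 [← mulV_coord hB x]
  rw [sub_eq_iff_eq_add, reduce, ← mulV_add]
  congr 1
  ext i
  exact (Int.floor_add_fract _).symm

theorem reduce_add_lattice (hB : B.det ≠ 0) {K : Plane} (hK : K ∈ lattice B) (x : Plane) :
    reduce B (x + K) = reduce B x := by
  obtain ⟨m, rfl⟩ := hK
  have h : coord B (x + mulV B fun i => (m i : ℝ)) = coord B x + fun i => (m i : ℝ) := by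
    rw [coord_add, coord_mulV hB]
  unfold reduce
  congr 1
  ext i
  have := congrFun h i
  simp only [coord, Pi.add_apply] at this
  rw [this, Int.fract_add_intCast]

theorem reduce_of_mem_cell (hB : B.det ≠ 0) {x : Plane} (hx : x ∈ cell B) : reduce B x = x := by
  rw [mem_cell_iff hB] at hx
  nth_rewrite 2 [← mulV_coord hB x]
  unfold reduce
  congr 1
  ext i
  exact Int.fract_eq_self.2 (hx i)

theorem exists_lattice_add_mem_cell (hB : B.det ≠ 0) (x : Plane) :
    ∃ K ∈ lattice B, x + K ∈ cell B := by
  refine ⟨-(x - reduce B x), neg_mem (sub_reduce_mem_lattice hB x), ?_⟩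
  simpa using reduce_mem_cell B x

theorem measurableSet_cell (hB : B.det ≠ 0) : MeasurableSet (cell B) := by
  have : cell B = coord B ⁻¹' (Set.univ.pi fun _ => Set.Ico (0 : ℝ) 1) := by
    ext x
    simp [mem_cell_iff hB]
  rw [this]
  exact (continuous_coord B).measurable
    (MeasurableSet.univ_pi fun _ => measurableSet_Ico)

theorem measurable_reduce (B : Matrix (Fin 2) (Fin 2) ℝ) : Measurable (reduce B) := by
  unfold reduce
  refine (continuous_mulV B).measurable.comp ?_
  refine measurable_pi_lambda _ fun i => ?_
  exact measurable_fract.comp ((measurable_pi_apply i).comp (continuous_coord B).measurable)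

theorem isAddFundamentalDomain_cell (hB : B.det ≠ 0) (μ : Measure Plane) :
    IsAddFundamentalDomain (lattice B) (cell B) μ := by
  refine IsAddFundamentalDomain.mk' (measurableSet_cell hB).nullMeasurableSet fun x => ?_
  obtain ⟨K, hK, hx⟩ := exists_lattice_add_mem_cell hB x
  refine ⟨⟨K, hK⟩, by simpa [AddSubgroup.vadd_def, add_comm] using hx, ?_⟩
  rintro ⟨K', hK'⟩ hx'
  have hx' : x + K' ∈ cell B := by simpa [AddSubgroup.vadd_def, add_comm] using hx'
  have h1 := reduce_of_mem_cell hB hx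
  have h2 := reduce_of_mem_cell hB hx'
  rw [reduce_add_lattice hB hK] at h1
  rw [reduce_add_lattice hB hK'] at h2
  ext1
  exact add_left_cancel (h2.symm.trans h1)

theorem exists_norm_le_of_mem_cell (B : Matrix (Fin 2) (Fin 2) ℝ) :
    ∃ d : ℝ, 0 < d ∧ ∀ x ∈ cell B, ‖x‖ ≤ d := by
  have hc : IsCompact (mulV B '' (Set.univ.pi fun _ => Set.Icc (0 : ℝ) 1)) :=
    (isCompact_univ_pi fun _ => isCompact_Icc).image (continuous_mulV B)
  obtain ⟨d, hd⟩ := hc.isBounded.exists_norm_le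
  refine ⟨max d 1, by positivity, ?_⟩
  rintro x ⟨t, ht, rfl⟩
  exact (hd _ ⟨t, fun i _ => ⟨(ht i).1, (ht i).2.le⟩, rfl⟩).trans (le_max_left _ _)

theorem volume_cell_lt_top (B : Matrix (Fin 2) (Fin 2) ℝ) : volume (cell B) < ⊤ := by
  obtain ⟨d, -, hd⟩ := exists_norm_le_of_mem_cell B
  refine (measure_mono (t := Metric.closedBall 0 d) fun x hx => ?_).trans_lt
    measure_closedBall_lt_top
  simpa using hd x hx

instance isFiniteMeasure_restrict_cell (B : Matrix (Fin 2) (Fin 2) ℝ) :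
    IsFiniteMeasure (volume.restrict (cell B)) :=
  ⟨by simpa using volume_cell_lt_top B⟩

theorem cellArea_pos (hB : B.det ≠ 0) : 0 < cellArea B := by
  refine ENNReal.toReal_pos ?_ (volume_cell_lt_top B).ne
  exact (isAddFundamentalDomain_cell hB volume).measure_ne_zero (NeZero.ne _)

theorem det_recip (B : Matrix (Fin 2) (Fin 2) ℝ) : (recip B).det = (2 * Real.pi) ^ 2 * B.det⁻¹ := by
  simp [recip, Matrix.det_nonsing_inv]

theorem det_recip_ne_zero (hB : B.det ≠ 0) : (recip B).det ≠ 0 := by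
  rw [det_recip]
  have := Real.pi_ne_zero
  positivity

theorem recip_recip (hB : B.det ≠ 0) : recip (recip B) = B := by
  have h2 : (2 * Real.pi) ≠ 0 := by have := Real.pi_ne_zero; positivity
  have : (recip B)⁻¹ = (2 * Real.pi)⁻¹ • Bᵀ := by
    refine Matrix.inv_eq_left_inv ?_
    rw [recip, Matrix.smul_mul, Matrix.mul_smul, smul_smul, inv_mul_cancel₀ h2, one_smul,
      ← Matrix.transpose_mul, Matrix.nonsing_inv_mul B (Ne.isUnit hB), Matrix.transpose_one]
  rw [recip, this, Matrix.transpose_smul, Matrix.transpose_transpose, smul_smul,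
    mul_inv_cancel₀ h2, one_smul]

theorem cellArea_eq_abs_det (B : Matrix (Fin 2) (Fin 2) ℝ) : cellArea B = |B.det| := by
  have e := EuclideanSpace.volume_preserving_symm_measurableEquiv_toLp (Fin 2)
  have h1 : cell B = (MeasurableEquiv.toLp 2 (Fin 2 → ℝ)).symm ⁻¹'
      ((Matrix.toLin' B) '' (Set.univ.pi fun _ => Set.Ico (0 : ℝ) 1)) := by
    ext x
    constructor
    · rintro ⟨t, ht, rfl⟩
      exact ⟨t, fun i _ => ht i, by simp [mulV]⟩
    · rintro ⟨t, ht, h⟩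
      refine ⟨t, fun i => ht i trivial, ?_⟩
      ext i
      exact (congrFun h i).symm
  rw [cellArea, h1, e.measure_preimage_equiv, Measure.addHaar_image_linearMap,
    LinearMap.det_toLin']
  simp [Real.volume_pi_Ico]

theorem cellArea_recip (hB : B.det ≠ 0) :
    cellArea (recip B) * cellArea B = (2 * Real.pi) ^ 2 := by
  rw [cellArea_eq_abs_det, cellArea_eq_abs_det, ← abs_mul, det_recip, mul_assoc,
    inv_mul_cancel₀ hB, mul_one, abs_of_nonneg (by positivity)]

/-! ### Characters -/

theorem expI_add_left (k l x : Plane) : expI (k + l) x = expI k x * expI l x := by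
  simp [expI, inner_add_left, mul_add, Complex.exp_add]

theorem expI_add_right (k x y : Plane) : expI k (x + y) = expI k x * expI k y := by
  simp [expI, inner_add_right, mul_add, Complex.exp_add]

theorem expI_comm (k x : Plane) : expI k x = expI x k := by
  simp [expI, real_inner_comm]

@[simp] theorem expI_zero_left (x : Plane) : expI 0 x = 1 := by simp [expI]

@[simp] theorem norm_expI (k x : Plane) : ‖expI k x‖ = 1 := by
  rw [expI, mul_comm, Complex.norm_exp_ofReal_mul_I]

theorem expI_neg_left (k x : Plane) : expI (-k) x = (expI k x)⁻¹ := by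
  simp [expI, Complex.exp_neg]

theorem expI_neg_right (k x : Plane) : expI k (-x) = (expI k x)⁻¹ := by
  simp [expI, Complex.exp_neg]

theorem star_expI (k x : Plane) : star (expI k x) = expI (-k) x := by
  simp only [expI, Complex.star_def, ← Complex.exp_conj, map_mul, Complex.conj_I,
    Complex.conj_ofReal, inner_neg_left, Complex.ofReal_neg]
  congr 1
  ring

theorem expI_sub_left (k l x : Plane) : expI (k - l) x = expI k x * expI (-l) x := by
  rw [sub_eq_add_neg, expI_add_left]

theorem expI_mul_neg (k x : Plane) : expI k x * expI (-k) x = 1 := by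
  rw [← expI_add_left]; simp

@[fun_prop] theorem continuous_expI (k : Plane) : Continuous (expI k) := by
  unfold expI
  fun_prop

theorem inner_mulV_recip (hB : B.det ≠ 0) (m t : Fin 2 → ℝ) :
    inner ℝ (mulV (recip B) m) (mulV B t) = 2 * Real.pi * (m ⬝ᵥ t) := by
  have h : (B⁻¹ᵀ *ᵥ m) ⬝ᵥ (B *ᵥ t) = m ⬝ᵥ t := by
    rw [← Matrix.vecMul_transpose, Matrix.transpose_transpose, Matrix.dotProduct_mulVec,
      Matrix.vecMul_vecMul, Matrix.nonsing_inv_mul B (Ne.isUnit hB), Matrix.vecMul_one]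
  rw [real_inner_comm, EuclideanSpace.inner_eq_star_dotProduct]
  simp only [mulV, recip, star_trivial, Matrix.smul_mulVec, smul_dotProduct, smul_eq_mul]
  rw [h]

theorem expI_eq_one (hB : B.det ≠ 0) {K R : Plane} (hK : K ∈ lattice (recip B))
    (hR : R ∈ lattice B) : expI K R = 1 := by
  obtain ⟨m, rfl⟩ := hK
  obtain ⟨t, rfl⟩ := hR
  rw [expI, inner_mulV_recip hB, Complex.exp_eq_one_iff]
  refine ⟨m ⬝ᵥ t, ?_⟩
  simp [dotProduct]
  ring

/-- Testing the character on the columns of `B` forces each dual coordinate of `k` to be an integer.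
-/
theorem mem_lattice_recip (hB : B.det ≠ 0) {k : Plane} (h : ∀ R ∈ lattice B, expI k R = 1) :
    k ∈ lattice (recip B) := by
  have hB' := det_recip_ne_zero hB
  set t := coord (recip B) k with ht
  have hk : mulV (recip B) t = k := mulV_coord hB' k
  have key : ∀ i, ∃ n : ℤ, t i = n := by
    intro i
    have h1 := h (mulV B fun j => ((Pi.single i 1 : Fin 2 → ℤ) j : ℝ)) ⟨_, rfl⟩
    rw [expI, ← hk, inner_mulV_recip hB, Complex.exp_eq_one_iff] at h1
    obtain ⟨n, hn⟩ := h1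
    refine ⟨n, ?_⟩
    have h2 : (t ⬝ᵥ fun j => ((Pi.single i 1 : Fin 2 → ℤ) j : ℝ)) = t i := by
      fin_cases i <;> simp [dotProduct, Fin.sum_univ_two]
    rw [h2] at hn
    have h3 : Complex.I * (2 * Real.pi) * ((t i : ℝ) : ℂ) = Complex.I * (2 * Real.pi) * (n : ℂ) := by
      push_cast at hn
      linear_combination hn
    have h4 : Complex.I * (2 * (Real.pi : ℂ)) ≠ 0 := by
      simp [Real.pi_ne_zero]
    have := mul_left_cancel₀ h4 h3
    exact_mod_cast this
  choose n hn using key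
  refine ⟨n, ?_⟩
  rw [← hk]
  congr 1
  ext i
  exact hn i

theorem expI_add_lattice (hB : B.det ≠ 0) {K R : Plane} (hK : K ∈ lattice (recip B))
    (hR : R ∈ lattice B) (x : Plane) : expI K (x + R) = expI K x := by
  rw [expI_add_right, expI_eq_one hB hK hR, mul_one]

/-! ### Integrals of periodic functions -/

theorem setIntegral_cell_add {E : Type*} [NormedAddCommGroup E] [NormedSpace ℝ E] (hB : B.det ≠ 0)
    {f : Plane → E} (hf : ∀ K ∈ lattice B, ∀ x, f (x + K) = f x) (v : Plane) :
    ∫ x in cell B, f (x + v) = ∫ x in cell B, f x := by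
  have h1 := isAddFundamentalDomain_cell hB volume
  have h2 : IsAddFundamentalDomain (lattice B) (v +ᵥ cell B) volume := h1.vadd_of_comm v
  have h3 : ∀ (g : lattice B) (x : Plane), f (g +ᵥ x) = f x := fun g x => by
    rw [AddSubgroup.vadd_def, vadd_eq_add, add_comm]
    exact hf g g.2 x
  rw [h1.setIntegral_eq h2 h3]
  have h4 : cell B = (fun x => x + v) ⁻¹' (v +ᵥ cell B) := by
    ext x
    simp [Set.mem_vadd_set, add_comm v]
  have := (measurePreserving_add_right (volume : Measure Plane) v).setIntegral_preimage_emb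
    (measurableEmbedding_addRight v) f (v +ᵥ cell B)
  rw [← h4] at this
  exact this

/-- Translating the integrand by `v` multiplies the integral by the phase `expI K v`, so a nonzero
integral would make the character trivial. -/
theorem setIntegral_expI (hB : B.det ≠ 0) {K : Plane} (hK : K ∈ lattice (recip B)) (hK0 : K ≠ 0) :
    ∫ x in cell B, expI K x = 0 := by
  have hper : ∀ R ∈ lattice B, ∀ x, expI K (x + R) = expI K x :=
    fun R hR x => expI_add_lattice hB hK hR x
  have h : ∀ v, expI K v * ∫ x in cell B, expI K x = ∫ x in cell B, expI K x := by
    intro v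
    nth_rewrite 2 [← setIntegral_cell_add hB hper v]
    rw [← integral_const_mul]
    simp_rw [expI_add_right, mul_comm]
  by_contra hne
  have h1 : ∀ v, expI K v = 1 := fun v => mul_right_cancel₀ hne (by rw [h v, one_mul])
  -- At this vector the character takes the value `exp (iπ) = -1`.
  have h2 := h1 ((Real.pi / ‖K‖ ^ 2) • K)
  have hn : ‖K‖ ≠ 0 := norm_ne_zero_iff.2 hK0
  rw [expI, inner_smul_right, real_inner_self_eq_norm_sq, div_mul_cancel₀ _ (by positivity),
    mul_comm, Complex.exp_pi_mul_I] at h2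
  norm_num at h2

/-- The plane is covered by countably many translates of the cell, so a null set in the cell lifts
to a null set of the plane. -/
theorem ae_reduce (hB : B.det ≠ 0) {P : Plane → Prop}
    (h : ∀ᵐ x ∂(volume.restrict (cell B)), P x) : ∀ᵐ x : Plane, P (reduce B x) := by
  rw [ae_restrict_iff' (measurableSet_cell hB)] at h
  have h2 : ∀ᵐ x : Plane, ∀ K : lattice B, x + K ∈ cell B → P (x + K) := by
    rw [ae_all_iff]
    intro K
    exact (measurePreserving_add_right (volume : Measure Plane)
      (K : Plane)).quasiMeasurePreserving.ae h
  filter_upwards [h2] with x hx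
  have := hx ⟨-(x - reduce B x), neg_mem (sub_reduce_mem_lattice hB x)⟩
  simp only [neg_sub, add_sub_cancel] at this
  exact this (reduce_mem_cell B x)

theorem ae_of_ae_cell (hB : B.det ≠ 0) {P : Plane → Prop}
    (h : ∀ᵐ x ∂(volume.restrict (cell B)), P x)
    (hP : ∀ K ∈ lattice B, ∀ x, P x → P (x + K)) : ∀ᵐ x : Plane, P x := by
  filter_upwards [ae_reduce hB h] with x hx
  have := hP _ (sub_reduce_mem_lattice hB x) _ hx
  simpa using this

end Lattice

end

noncomputable section

/-! ### Decaying weights -/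

/-- The weight `(1 + ‖x‖)⁻ᴺ`. -/
def dec (N : ℕ) (x : Plane) : ℝ := ((1 + ‖x‖) ^ N)⁻¹

theorem dec_pos (N : ℕ) (x : Plane) : 0 < dec N x := by unfold dec; positivity

theorem dec_nonneg (N : ℕ) (x : Plane) : 0 ≤ dec N x := (dec_pos N x).le

@[simp] theorem dec_zero (N : ℕ) : dec N 0 = 1 := by simp [dec]

theorem dec_mul (N M : ℕ) (x : Plane) : dec N x * dec M x = dec (N + M) x := by
  rw [dec, dec, dec, pow_add, mul_inv]

theorem dec_mul_pow (N : ℕ) (x : Plane) : dec N x * (1 + ‖x‖) ^ N = 1 :=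
  inv_mul_cancel₀ (by positivity)

theorem dec_anti {N M : ℕ} (h : M ≤ N) (x : Plane) : dec N x ≤ dec M x :=
  inv_anti₀ (by positivity) (pow_le_pow_right₀ (by linarith [norm_nonneg x]) h)

theorem dec_le_dec_add (N : ℕ) (x y : Plane) : dec N x ≤ dec N (x + y) * (1 + ‖y‖) ^ N := by
  rw [dec, dec, inv_le_iff_one_le_mul₀ (by positivity), mul_assoc, ← mul_pow, inv_mul_eq_div,
    one_le_div (by positivity)]
  refine pow_le_pow_left₀ (by positivity) ?_ _
  nlinarith [norm_add_le x y, norm_nonneg x, norm_nonneg y]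

theorem dec_neg (N : ℕ) (x : Plane) : dec N (-x) = dec N x := by simp [dec]

theorem continuous_dec (N : ℕ) : Continuous (dec N) := by
  unfold dec
  exact (by fun_prop : Continuous fun x : Plane => (1 + ‖x‖) ^ N).inv₀ fun x => by positivity

section Lattice

variable {B : Matrix (Fin 2) (Fin 2) ℝ}

/-- Sums of the weight over translates of a lattice are bounded uniformly in the translation. -/
theorem exists_tsum_dec_le (hB : B.det ≠ 0) :
    ∃ C : ℝ, 0 < C ∧ ∀ x : Plane, Summable (fun R : lattice B => dec 3 (x + R)) ∧
      ∑' R : lattice B, dec 3 (x + R) ≤ C := by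
  obtain ⟨d, hd0, hd⟩ := exists_norm_le_of_mem_cell B
  set I : ENNReal := ∫⁻ u : Plane, ENNReal.ofReal (dec 3 u) with hI
  have hIfin : I < ⊤ := by
    -- The exponent 3 exceeds the dimension 2 of the plane.
    have := finite_integral_one_add_norm (E := Plane) (μ := volume) (r := 3) (by simp; norm_num)
    refine lt_of_eq_of_lt ?_ this
    refine lintegral_congr fun u => ?_
    rw [dec, Real.rpow_neg (by positivity)]
    norm_cast
  set K : ENNReal := ENNReal.ofReal ((1 + d) ^ 3) * I / volume (cell B) with hK
  have harea : volume (cell B) ≠ 0 := fun h => (cellArea_pos hB).ne' (by simp [cellArea, h])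
  have hKfin : K ≠ ⊤ := by
    refine ENNReal.div_ne_top ?_ harea
    exact ENNReal.mul_ne_top ENNReal.ofReal_ne_top hIfin.ne
  have key : ∀ x : Plane, ∑' R : lattice B, ENNReal.ofReal (dec 3 (x + R)) ≤ K := by
    intro x
    rw [hK, ENNReal.le_div_iff_mul_le (Or.inl harea) (Or.inl (volume_cell_lt_top B).ne),
      ← ENNReal.tsum_mul_right]
    -- The integral unfolds over translated cells. Within one cell the weight changes at most by the
    -- factor `(1 + d) ^ 3`, so the lattice sum is dominated by the integral divided by the area.
    have h1 : I = ∑' R : lattice B, ∫⁻ u in cell B, ENNReal.ofReal (dec 3 (x + (R + u))) := by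
      have := (isAddFundamentalDomain_cell hB volume).lintegral_eq_tsum''
        (fun u => ENNReal.ofReal (dec 3 (x + u)))
      rw [hI, ← lintegral_add_left_eq_self _ x, this]
      rfl
    rw [h1, ← ENNReal.tsum_mul_left]
    refine ENNReal.tsum_le_tsum fun R => ?_
    rw [← lintegral_const_mul' _ _ ENNReal.ofReal_ne_top, ← setLIntegral_const]
    refine setLIntegral_mono' (measurableSet_cell hB) fun u hu => ?_
    rw [← ENNReal.ofReal_mul (by positivity)]
    refine ENNReal.ofReal_le_ofReal ?_
    refine (dec_le_dec_add 3 _ u).trans ?_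
    rw [mul_comm, add_assoc]
    gcongr
    · exact dec_nonneg _ _
    · exact hd u hu
  refine ⟨K.toReal + 1, by positivity, fun x => ?_⟩
  have h2 := ENNReal.summable_toReal ((key x).trans_lt hKfin.lt_top).ne
  have h3 : ∀ R : lattice B, (ENNReal.ofReal (dec 3 (x + R))).toReal = dec 3 (x + R) :=
    fun R => ENNReal.toReal_ofReal (dec_nonneg _ _)
  simp only [h3] at h2
  refine ⟨h2, ?_⟩
  have h4 := ENNReal.toReal_mono hKfin (key x)
  rw [ENNReal.tsum_toReal_eq (fun R => ENNReal.ofReal_ne_top)] at h4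
  simp only [h3] at h4
  linarith

theorem summable_dec (hB : B.det ≠ 0) {N : ℕ} (hN : 3 ≤ N) (x : Plane) :
    Summable (fun R : lattice B => dec N (x + R)) := by
  obtain ⟨C, -, hC⟩ := exists_tsum_dec_le hB
  exact (hC x).1.of_nonneg_of_le (fun R => dec_nonneg _ _) fun R => dec_anti hN _

/-! ### Counting lattice points -/

/-- The lattice points in the open disc of radius `r`. -/
def latBall (B : Matrix (Fin 2) (Fin 2) ℝ) (r : ℝ) : Set (lattice B) := {R | ‖(R : Plane)‖ < r}

/-- The terms of the convergent sum of `dec 3` tend to zero along the cofinite filter, while on a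
disc they are bounded below. -/
theorem latBall_finite (hB : B.det ≠ 0) (r : ℝ) : (latBall B r).Finite := by
  have h := (summable_dec hB le_rfl 0).tendsto_cofinite_zero
  have h2 : ∀ᶠ R : lattice B in cofinite, dec 3 (0 + R) < ((1 + |r|) ^ 3)⁻¹ :=
    h.eventually_lt_const (by positivity)
  refine (Filter.eventually_cofinite.1 h2).subset fun R hR => ?_
  simp only [Set.mem_ofPred_eq, not_lt, zero_add, dec]
  refine inv_anti₀ (by positivity) (pow_le_pow_left₀ (by positivity) ?_ _)
  have : ‖(R : Plane)‖ < r := hR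
  linarith [le_abs_self r]

/-- The number of lattice points in the open disc of radius `r`. -/
def latCount (B : Matrix (Fin 2) (Fin 2) ℝ) (r : ℝ) : ℝ := (latBall B r).ncard

/-- The disjoint cells attached to the lattice points of the disc fit into the disc enlarged by the
cell size `d`. -/
theorem latCount_mul_le (hB : B.det ≠ 0) {d : ℝ} (hd : ∀ x ∈ cell B, ‖x‖ ≤ d) {r : ℝ}
    (hr : 0 ≤ r + d) : latCount B r * cellArea B ≤ (r + d) ^ 2 * Real.pi := by
  have hfin := latBall_finite hB r
  have h1 := (isAddFundamentalDomain_cell hB volume).measure_eq_tsum (Metric.ball 0 (r + d))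
  have h2 : ∑ _R ∈ hfin.toFinset, volume (cell B) ≤ volume (Metric.ball (0 : Plane) (r + d)) := by
    rw [h1]
    refine le_trans (Finset.sum_le_sum fun R hR => measure_mono ?_)
      (ENNReal.sum_le_tsum hfin.toFinset)
    intro x hx
    refine ⟨?_, hx⟩
    rw [Set.mem_vadd_set_iff_neg_vadd_mem, AddSubgroup.vadd_def, vadd_eq_add, mem_ball_zero_iff]
    have hR' : ‖(R : Plane)‖ < r := by simpa [latBall] using hR
    refine (norm_add_le _ _).trans_lt ?_
    simp only [AddSubgroup.coe_neg, norm_neg]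
    linarith [hd x hx]
  rw [Finset.sum_const, nsmul_eq_mul, EuclideanSpace.volume_ball_fin_two] at h2
  have h3 := ENNReal.toReal_mono (by finiteness) h2
  rw [ENNReal.toReal_mul, ENNReal.toReal_mul, ENNReal.toReal_pow, ENNReal.toReal_ofReal hr] at h3
  rw [latCount, Set.ncard_eq_toFinset_card _ hfin, cellArea]
  simpa [Real.pi_nonneg] using h3

/-- The cells attached to the lattice points of the disc cover the disc shrunk by `d`. -/
theorem le_latCount_mul (hB : B.det ≠ 0) {d : ℝ} (hd : ∀ x ∈ cell B, ‖x‖ ≤ d) {r : ℝ}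
    (hr : 0 ≤ r - d) : (r - d) ^ 2 * Real.pi ≤ latCount B r * cellArea B := by
  have hfin := latBall_finite hB r
  have h1 := (isAddFundamentalDomain_cell hB volume).measure_eq_tsum (Metric.ball 0 (r - d))
  have h2 : volume (Metric.ball (0 : Plane) (r - d)) ≤ ∑ _R ∈ hfin.toFinset, volume (cell B) := by
    rw [h1, tsum_eq_sum (s := hfin.toFinset)]
    · exact Finset.sum_le_sum fun R hR => measure_mono Set.inter_subset_right
    · intro R hR
      convert measure_empty (μ := (volume : Measure Plane))
      refine Set.eq_empty_of_forall_notMem fun x hx => hR ?_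
      obtain ⟨hx1, hx2⟩ := hx
      rw [Set.mem_vadd_set_iff_neg_vadd_mem, AddSubgroup.vadd_def, vadd_eq_add,
        mem_ball_zero_iff] at hx1
      simp only [Set.Finite.mem_toFinset, latBall, Set.mem_ofPred_eq]
      have : ‖(R : Plane)‖ ≤ ‖((-R : lattice B) : Plane) + x‖ + ‖x‖ := by
        have := norm_sub_le (x) (((-R : lattice B) : Plane) + x)
        simp only [AddSubgroup.coe_neg] at this ⊢
        rw [show x - (-(R : Plane) + x) = R by abel] at this
        linarith
      linarith [hd x hx2]
  rw [Finset.sum_const, nsmul_eq_mul, EuclideanSpace.volume_ball_fin_two] at h2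
  have h3 := ENNReal.toReal_mono
    (by simpa using ENNReal.mul_ne_top (by simp) (volume_cell_lt_top B).ne) h2
  rw [ENNReal.toReal_mul, ENNReal.toReal_mul, ENNReal.toReal_pow, ENNReal.toReal_ofReal hr] at h3
  rw [latCount, Set.ncard_eq_toFinset_card _ hfin, cellArea]
  simpa [Real.pi_nonneg] using h3

theorem tendsto_sq_div_sq (d : ℝ) : Tendsto (fun r : ℝ => (r + d) ^ 2 / r ^ 2) atTop (𝓝 1) := by
  have h : Tendsto (fun r : ℝ => (1 + d * r⁻¹) ^ 2) atTop (𝓝 ((1 + d * 0) ^ 2)) :=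
    ((tendsto_inv_atTop_zero.const_mul d).const_add 1).pow 2
  rw [show ((1 : ℝ) + d * 0) ^ 2 = 1 by ring] at h
  refine h.congr' ?_
  filter_upwards [eventually_gt_atTop 0] with r hr
  field_simp

theorem tendsto_latCount (hB : B.det ≠ 0) :
    Tendsto (fun r => latCount B r / r ^ 2) atTop (𝓝 (Real.pi / cellArea B)) := by
  obtain ⟨d, hd0, hd⟩ := exists_norm_le_of_mem_cell B
  have ha := cellArea_pos hB
  have h1 := (tendsto_sq_div_sq (-d)).mul_const (Real.pi / cellArea B)
  have h2 := (tendsto_sq_div_sq d).mul_const (Real.pi / cellArea B)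
  rw [one_mul] at h1 h2
  refine tendsto_of_tendsto_of_tendsto_of_le_of_le' h1 h2 ?_ ?_
  · filter_upwards [eventually_gt_atTop d] with r hr
    have := le_latCount_mul hB hd (r := r) (by linarith)
    have hr0 : 0 < r := by linarith
    rw [div_mul_div_comm, div_le_div_iff₀ (by positivity) (by positivity)]
    nlinarith [sq_nonneg r, mul_le_mul_of_nonneg_right this (sq_nonneg r)]
  · filter_upwards [eventually_gt_atTop d] with r hr
    have := latCount_mul_le hB hd (r := r) (by linarith)
    have hr0 : 0 < r := by linarith
    rw [div_mul_div_comm, div_le_div_iff₀ (by positivity) (by positivity)]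
    nlinarith [sq_nonneg r, mul_le_mul_of_nonneg_right this (sq_nonneg r)]

theorem eventually_latCount_pos (hB : B.det ≠ 0) : ∀ᶠ r in atTop, 0 < latCount B r := by
  have h := (tendsto_latCount hB).eventually_const_lt
    (show 0 < Real.pi / cellArea B from div_pos Real.pi_pos (cellArea_pos hB))
  filter_upwards [h, eventually_gt_atTop 0] with r hr hr0
  by_contra hne
  exact absurd hr (not_lt.2 (div_nonpos_of_nonpos_of_nonneg (not_lt.1 hne) (by positivity)))

theorem tendsto_latCount_ratio (hB : B.det ≠ 0) (c : ℝ) :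
    Tendsto (fun r => latCount B (r - c) / latCount B r) atTop (𝓝 1) := by
  have hp : Real.pi / cellArea B ≠ 0 := (div_pos Real.pi_pos (cellArea_pos hB)).ne'
  have h1 := (tendsto_latCount hB).comp (tendsto_atTop_add_const_right atTop (-c) tendsto_id)
  have h2 := (h1.mul (tendsto_sq_div_sq (-c))).div (tendsto_latCount hB) hp
  rw [mul_one, div_self hp] at h2
  refine h2.congr' ?_
  filter_upwards [eventually_gt_atTop 0, eventually_gt_atTop c] with r hr hr2
  have : r - c ≠ 0 := by linarith
  simp only [Function.comp, id, Pi.div_apply, ← sub_eq_add_neg]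
  field_simp

/-! ### Averages over lattice points -/

/-- The average over the lattice points in the open disc of radius `r`. -/
def latAvg (B : Matrix (Fin 2) (Fin 2) ℝ) (u : lattice B → ℂ) (r : ℝ) : ℂ :=
  (latCount B r : ℂ)⁻¹ * ∑ᶠ R ∈ latBall B r, u R

theorem latAvg_eq (hB : B.det ≠ 0) (u : lattice B → ℂ) (r : ℝ) :
    latAvg B u r = (latCount B r : ℂ)⁻¹ * ∑ R ∈ (latBall_finite hB r).toFinset, u R := by
  rw [latAvg, finsum_mem_eq_finite_toFinset_sum]

theorem latCount_eq_card (hB : B.det ≠ 0) (r : ℝ) :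
    latCount B r = (latBall_finite hB r).toFinset.card := by
  rw [latCount, Set.ncard_eq_toFinset_card _ (latBall_finite hB r)]

theorem latAvg_add (hB : B.det ≠ 0) (u v : lattice B → ℂ) (r : ℝ) :
    latAvg B (fun R => u R + v R) r = latAvg B u r + latAvg B v r := by
  simp only [latAvg_eq hB, Finset.sum_add_distrib, mul_add]

theorem latAvg_const_mul (hB : B.det ≠ 0) (c : ℂ) (u : lattice B → ℂ) (r : ℝ) :
    latAvg B (fun R => c * u R) r = c * latAvg B u r := by
  simp only [latAvg_eq hB, ← Finset.mul_sum]
  ring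

theorem latAvg_sum (hB : B.det ≠ 0) {ι : Type*} (s : Finset ι) (u : ι → lattice B → ℂ) (r : ℝ) :
    latAvg B (fun R => ∑ i ∈ s, u i R) r = ∑ i ∈ s, latAvg B (u i) r := by
  simp only [latAvg_eq hB]
  rw [Finset.sum_comm, Finset.mul_sum]

theorem norm_latAvg_le (hB : B.det ≠ 0) {u : lattice B → ℂ} {C : ℝ} (hC : 0 ≤ C)
    (hu : ∀ R, ‖u R‖ ≤ C) (r : ℝ) : ‖latAvg B u r‖ ≤ C := by
  rw [latAvg_eq hB, norm_mul, norm_inv, Complex.norm_real, latCount_eq_card hB]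
  have h := norm_sum_le_of_le (latBall_finite hB r).toFinset fun R _ => hu R
  rw [Finset.sum_const, nsmul_eq_mul] at h
  rw [Real.norm_natCast]
  rcases (latBall_finite hB r).toFinset.card.eq_zero_or_pos with h0 | h0
  · simp [h0, hC]
  · rw [inv_mul_le_iff₀ (by exact_mod_cast h0)]
    exact h

theorem tendsto_latAvg_one (hB : B.det ≠ 0) :
    Tendsto (latAvg B fun _ => 1) atTop (𝓝 1) := by
  refine tendsto_const_nhds.congr' ?_
  filter_upwards [eventually_latCount_pos hB] with r hr
  rw [latAvg_eq hB, Finset.sum_const, nsmul_eq_mul, mul_one]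
  rw [latCount_eq_card hB] at hr ⊢
  rw [Complex.ofReal_natCast, inv_mul_cancel₀]
  exact_mod_cast hr.ne'

/-- Some lattice vector `R₀` has phase different from 1. Translation by it multiplies the sum by
that phase but changes only points near the boundary circle, which are negligible among all points.
-/
theorem tendsto_latAvg_expI (hB : B.det ≠ 0) {k : Plane} (hk : k ∉ lattice (recip B)) :
    Tendsto (latAvg B fun R => expI k R) atTop (𝓝 0) := by
  obtain ⟨R₀, hR₀, hne⟩ : ∃ R ∈ lattice B, expI k R ≠ 1 := by
    by_contra! h
    exact hk (mem_lattice_recip hB h)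
  set c := ‖R₀‖
  have hb : ∀ r, ‖(expI k R₀ - 1) * latAvg B (fun R => expI k R) r‖ ≤
      2 * ((latCount B r - latCount B (r - c)) / latCount B r) := by
    intro r
    have hN : 0 ≤ latCount B r := Nat.cast_nonneg _
    -- The smaller disc `I` lies both in `S` and in its translate `S'`. These have equal
    -- cardinality, so each differs from `I` by `latCount B r - latCount B (r - c)` points.
    set S := (latBall_finite hB r).toFinset with hS
    set I := (latBall_finite hB (r - c)).toFinset with hI
    classical
    set S' := S.map (Equiv.addRight (⟨R₀, hR₀⟩ : lattice B)).toEmbedding with hS'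
    have hIS : I ⊆ S := by
      intro R hR
      simp only [hS, hI, Set.Finite.mem_toFinset, latBall, Set.mem_ofPred_eq] at hR ⊢
      linarith [norm_nonneg R₀]
    have hIS' : I ⊆ S' := by
      intro R hR
      simp only [hS', Finset.mem_map_equiv, Equiv.addRight_symm, Equiv.coe_addRight]
      simp only [hS, hI, Set.Finite.mem_toFinset, latBall, Set.mem_ofPred_eq,
        AddSubgroup.coe_add, AddSubgroup.coe_neg] at hR ⊢
      refine (norm_add_le _ _).trans_lt ?_
      rw [norm_neg]
      linarith
    have hcard : ∀ T : Finset (lattice B), I ⊆ T → T.card = S.card →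
        ‖(∑ R ∈ T, expI k R) - ∑ R ∈ I, expI k R‖ ≤ latCount B r - latCount B (r - c) := by
      intro T hT hc
      rw [← Finset.sum_sdiff hT, add_sub_cancel_right]
      refine (norm_sum_le_of_le (n := fun _ => 1) _ fun R _ => (norm_expI _ _).le).trans ?_
      rw [Finset.sum_const, nsmul_eq_mul, mul_one, Finset.card_sdiff_of_subset hT,
        Nat.cast_sub (Finset.card_le_card hT), hc, latCount_eq_card hB, latCount_eq_card hB]
    have e1 : expI k R₀ * ∑ R ∈ S, expI k R = ∑ R ∈ S', expI k R := by
      rw [hS', Finset.sum_map, Finset.mul_sum]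
      refine Finset.sum_congr rfl fun R _ => ?_
      simp [expI_add_right, mul_comm]
    have e2 : ‖(∑ R ∈ S', expI k R) - ∑ R ∈ S, expI k R‖ ≤
        2 * (latCount B r - latCount B (r - c)) := by
      have h1 := hcard S hIS rfl
      have h2 := hcard S' hIS' (by simp [hS'])
      rw [show (∑ R ∈ S', expI k (R : Plane)) - ∑ R ∈ S, expI k (R : Plane) =
        ((∑ R ∈ S', expI k (R : Plane)) - ∑ R ∈ I, expI k (R : Plane)) -
        ((∑ R ∈ S, expI k (R : Plane)) - ∑ R ∈ I, expI k (R : Plane)) by ring]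
      refine (norm_sub_le _ _).trans ?_
      linarith
    rw [latAvg_eq hB, mul_left_comm, sub_mul, one_mul, e1, norm_mul, norm_inv,
      Complex.norm_real, Real.norm_of_nonneg hN, mul_div_assoc', inv_mul_eq_div]
    gcongr
  have hz : Tendsto (fun r => 2 * ((latCount B r - latCount B (r - c)) / latCount B r)) atTop
      (𝓝 0) := by
    have := ((tendsto_latCount_ratio hB c).const_sub 1).const_mul 2
    rw [sub_self, mul_zero] at this
    refine this.congr' ?_
    filter_upwards [eventually_latCount_pos hB] with r hr
    rw [sub_div, div_self hr.ne']
  have hz2 := (squeeze_zero_norm hb hz).const_mul (expI k R₀ - 1)⁻¹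
  rw [mul_zero] at hz2
  refine hz2.congr fun r => ?_
  rw [inv_mul_cancel_left₀ (sub_ne_zero.2 hne)]

/-- Averages of functions bounded by 1 are bounded by 1, so dominated convergence for series applies
with majorant `‖a i‖`. -/
theorem tendsto_latAvg_tsum (hB : B.det ≠ 0) {ι : Type*} {a l : ι → ℂ} {u : ι → lattice B → ℂ}
    (ha : Summable fun i => ‖a i‖) (hu : ∀ i R, ‖u i R‖ ≤ 1)
    (h : ∀ i, Tendsto (latAvg B (u i)) atTop (𝓝 (l i))) :
    Tendsto (latAvg B fun R => ∑' i, a i * u i R) atTop (𝓝 (∑' i, a i * l i)) := by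
  have e : ∀ r, latAvg B (fun R => ∑' i, a i * u i R) r = ∑' i, a i * latAvg B (u i) r := by
    intro r
    have hs : ∀ R : lattice B, Summable fun i => a i * u i R := fun R => by
      refine Summable.of_norm_bounded ha fun i => ?_
      rw [norm_mul]
      exact mul_le_of_le_one_right (norm_nonneg _) (hu i R)
    simp only [latAvg_eq hB]
    rw [← Summable.tsum_finsetSum fun R _ => hs R, ← tsum_mul_left]
    refine tsum_congr fun i => ?_
    rw [← Finset.mul_sum]
    ring
  refine Tendsto.congr (fun r => (e r).symm) ?_
  refine tendsto_tsum_of_dominated_convergence ha (fun i => (h i).const_mul _)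
    (Eventually.of_forall fun r i => ?_)
  rw [norm_mul]
  exact mul_le_of_le_one_right (norm_nonneg _) (norm_latAvg_le hB zero_le_one (hu i) r)

end Lattice

/-! ### Thermodynamic limits -/

universe u

/-- Layer `j` contributes asymptotically `|𝒜 j| π r² / |cell|` sites to the disc. After cancelling
`π r²`, the layer averages are weighted by inverse cell areas. -/
theorem hasThermoTrace_of_latAvg {𝒜 : Fin 2 → Type u} [∀ j, Fintype (𝒜 j)]
    {L : Fin 2 → Matrix (Fin 2) (Fin 2) ℝ} (hL : ∀ j, (L j).det ≠ 0)
    (O : SiteSpace L 𝒜 →L[ℂ] SiteSpace L 𝒜) (m : ∀ j, 𝒜 j → ℂ)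
    (h : ∀ j α, Tendsto (latAvg (L j) fun R => diagEntry O ⟨j, (R, α)⟩) atTop (𝓝 (m j α))) :
    HasThermoTrace O (((∑ j, (Fintype.card (𝒜 j) : ℝ) / cellArea (L j) : ℝ) : ℂ)⁻¹ *
      ∑ j, (∑ α, m j α) / cellArea (L j)) := by
  classical
  set S : ℝ → Finset (Sites L 𝒜) := fun r =>
    Finset.univ.sigma fun j => (latBall_finite (hL j) r).toFinset ×ˢ Finset.univ with hS
  have hmem : ∀ r p, p ∈ sitesBall L 𝒜 r ↔ p ∈ S r := by
    rintro r ⟨j, R, α⟩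
    simp [hS, sitesBall, latBall]
  have hset : ∀ r, sitesBall L 𝒜 r = ↑(S r) := fun r => Set.ext fun p => hmem r p
  have hcard : ∀ r, ((sitesBall L 𝒜 r).ncard : ℂ) =
      ((∑ j, (Fintype.card (𝒜 j) : ℝ) * latCount (L j) r : ℝ) : ℂ) := by
    intro r
    rw [hset, Set.ncard_coe_finset, hS, Finset.card_sigma]
    simp only [Finset.card_product, Finset.card_univ, latCount_eq_card (hL _)]
    push_cast
    exact Finset.sum_congr rfl fun j _ => mul_comm _ _
  have hsum : ∀ r, 0 < r → (∀ j, 0 < latCount (L j) r) →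
      ∑ᶠ p ∈ sitesBall L 𝒜 r, diagEntry O p = ∑ j, (latCount (L j) r : ℂ) *
        ∑ α, latAvg (L j) (fun R => diagEntry O ⟨j, (R, α)⟩) r := by
    intro r _ hp
    rw [finsum_mem_congr (hset r) fun _ _ => rfl, finsum_mem_coe_finset, hS, Finset.sum_sigma]
    refine Finset.sum_congr rfl fun j _ => ?_
    rw [Finset.sum_product_right, Finset.mul_sum]
    refine Finset.sum_congr rfl fun α _ => ?_
    rw [latAvg_eq (hL j), mul_inv_cancel_left₀]
    exact_mod_cast (hp j).ne'
  have hev : ∀ᶠ r : ℝ in atTop, 0 < r ∧ ∀ j, 0 < latCount (L j) r :=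
    (eventually_gt_atTop 0).and (eventually_all.2 fun j => eventually_latCount_pos (hL j))
  unfold HasThermoTrace
  -- Without any orbitals the sums over sites and over orbitals are empty, and both sides are 0
  -- whatever the inverted denominator is.
  by_cases hempty : ∀ j, IsEmpty (𝒜 j)
  · have : IsEmpty (Sites L 𝒜) := ⟨fun p => (hempty p.1).false p.2.2⟩
    have h1 : ∀ r, sitesBall L 𝒜 r = ∅ := fun r => Set.eq_empty_of_isEmpty _
    have hz : ∑ j, (∑ α, m j α) / (cellArea (L j) : ℂ) = 0 :=
      Finset.sum_eq_zero fun j _ => by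
        have := hempty j
        simp
    rw [hz, mul_zero]
    refine tendsto_const_nhds.congr fun r => ?_
    rw [finsum_mem_congr (h1 r) fun _ _ => rfl, finsum_mem_empty, mul_zero]
  have hc : ∀ j, Tendsto (fun r : ℝ => ((latCount (L j) r / r ^ 2 : ℝ) : ℂ)) atTop
      (𝓝 ((Real.pi / cellArea (L j) : ℝ) : ℂ)) := fun j =>
    (Complex.continuous_ofReal.tendsto _).comp (tendsto_latCount (hL j))
  have hden : Tendsto (fun r : ℝ => ∑ j, (Fintype.card (𝒜 j) : ℂ) *
      ((latCount (L j) r / r ^ 2 : ℝ) : ℂ)) atTop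
      (𝓝 (∑ j, (Fintype.card (𝒜 j) : ℂ) * ((Real.pi / cellArea (L j) : ℝ) : ℂ))) :=
    tendsto_finsetSum _ fun j _ => (hc j).const_mul _
  have hnum : Tendsto (fun r : ℝ => ∑ j, ((latCount (L j) r / r ^ 2 : ℝ) : ℂ) *
        ∑ α, latAvg (L j) (fun R => diagEntry O ⟨j, (R, α)⟩) r) atTop
      (𝓝 (∑ j, ((Real.pi / cellArea (L j) : ℝ) : ℂ) * ∑ α, m j α)) :=
    tendsto_finsetSum _ fun j _ => (hc j).mul (tendsto_finsetSum _ fun α _ => h j α)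
  have hpos : (0 : ℝ) < ∑ j, (Fintype.card (𝒜 j) : ℝ) / cellArea (L j) := by
    push Not at hempty
    obtain ⟨j, hj⟩ := hempty
    refine Finset.sum_pos' (fun j _ => div_nonneg (Nat.cast_nonneg _) (cellArea_pos (hL j)).le)
      ⟨j, Finset.mem_univ _, div_pos ?_ (cellArea_pos (hL j))⟩
    exact_mod_cast Fintype.card_pos
  have hpi : (Real.pi : ℂ) ≠ 0 := by exact_mod_cast Real.pi_ne_zero
  have e1 : ∑ j, (Fintype.card (𝒜 j) : ℂ) * ((Real.pi / cellArea (L j) : ℝ) : ℂ) =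
      Real.pi * ((∑ j, (Fintype.card (𝒜 j) : ℝ) / cellArea (L j) : ℝ) : ℂ) := by
    push_cast
    rw [Finset.mul_sum]
    exact Finset.sum_congr rfl fun j _ => by ring
  have e2 : ∑ j, ((Real.pi / cellArea (L j) : ℝ) : ℂ) * ∑ α, m j α =
      Real.pi * ∑ j, (∑ α, m j α) / cellArea (L j) := by
    push_cast
    rw [Finset.mul_sum]
    exact Finset.sum_congr rfl fun j _ => by ring
  have hne : ((∑ j, (Fintype.card (𝒜 j) : ℝ) / cellArea (L j) : ℝ) : ℂ) ≠ 0 := by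
    exact_mod_cast hpos.ne'
  rw [e1] at hden
  rw [e2] at hnum
  have hfin := (hden.inv₀ (mul_ne_zero hpi hne)).mul hnum
  rw [mul_inv, mul_mul_mul_comm, inv_mul_cancel₀ hpi, one_mul] at hfin
  refine hfin.congr' ?_
  filter_upwards [hev] with r hr
  rw [hsum r hr.1 hr.2, hcard]
  have hr2 : ((r : ℂ) ^ 2) ≠ 0 := by exact_mod_cast (pow_pos hr.1 2).ne'
  have f1 : ∑ j, (Fintype.card (𝒜 j) : ℂ) * ((latCount (L j) r / r ^ 2 : ℝ) : ℂ) =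
      ((r : ℂ) ^ 2)⁻¹ * ((∑ j, (Fintype.card (𝒜 j) : ℝ) * latCount (L j) r : ℝ) : ℂ) := by
    push_cast
    rw [Finset.mul_sum]
    exact Finset.sum_congr rfl fun j _ => by ring
  have f2 : ∑ j, ((latCount (L j) r / r ^ 2 : ℝ) : ℂ) *
        ∑ α, latAvg (L j) (fun R => diagEntry O ⟨j, (R, α)⟩) r = ((r : ℂ) ^ 2)⁻¹ *
      ∑ j, (latCount (L j) r : ℂ) * ∑ α, latAvg (L j) (fun R => diagEntry O ⟨j, (R, α)⟩) r := by
    push_cast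
    rw [Finset.mul_sum]
    exact Finset.sum_congr rfl fun j _ => by ring
  rw [f1, f2, mul_inv, mul_mul_mul_comm, inv_inv, mul_inv_cancel₀ hr2, one_mul]

end

noncomputable section

/-! ### Fourier series on the unit cell of a lattice -/

/-- A function which is periodic with respect to the lattice `B ℤ²`. -/
def LatPeriodic {E : Type*} (B : Matrix (Fin 2) (Fin 2) ℝ) (F : Plane → E) : Prop :=
  ∀ K ∈ lattice B, ∀ x, F (x + K) = F x

/-- The Fourier coefficient of a function on the unit cell. -/
def fcoef (B : Matrix (Fin 2) (Fin 2) ℝ) (F : Plane → ℂ) (K : Plane) : ℂ :=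
  ((cellArea B)⁻¹ : ℂ) * ∫ x in cell B, F x * expI (-K) x

section Series

variable {B : Matrix (Fin 2) (Fin 2) ℝ}

theorem latPeriodic_expI (hB : B.det ≠ 0) {K : Plane} (hK : K ∈ lattice (recip B)) :
    LatPeriodic B (expI K) := fun _ hR x => expI_add_lattice hB hK hR x

theorem LatPeriodic.reduce_eq {E : Type*} {F : Plane → E} (hB : B.det ≠ 0) (hF : LatPeriodic B F)
    (x : Plane) : F (reduce B x) = F x := by
  have := hF _ (sub_reduce_mem_lattice hB x) (reduce B x)
  rwa [add_sub_cancel, eq_comm] at this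

theorem integrableOn_cell {E : Type*} [NormedAddCommGroup E] {F : Plane → E}
    (hc : Continuous F) : IntegrableOn F (cell B) := by
  obtain ⟨d, hd0, hd⟩ := exists_norm_le_of_mem_cell B
  refine (hc.continuousOn.integrableOn_compact (isCompact_closedBall (0 : Plane) d)).mono_set ?_
  intro x hx
  simpa using hd x hx

theorem expI_mulV_eq (hB : B.det ≠ 0) (n : Fin 2 → ℤ) (t : Fin 2 → ℝ) :
    expI (mulV (recip B) fun i => (n i : ℝ)) (mulV B t) =
      UnitAddTorus.mFourier n (fun i => (t i : AddCircle (1 : ℝ))) := by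
  rw [expI, inner_mulV_recip hB]
  simp only [UnitAddTorus.mFourier, ContinuousMap.coe_mk, fourier_coe_apply, ← Complex.exp_sum]
  congr 1
  simp [dotProduct, Fin.sum_univ_two]
  ring

/-- Trigonometric polynomials are dense in the continuous periodic functions. -/
theorem exists_trigPoly_approx (hB : B.det ≠ 0) {F : Plane → ℂ} (hF : LatPeriodic B F)
    (hc : Continuous F) {ε : ℝ} (hε : 0 < ε) :
    ∃ (s : Finset (lattice (recip B))) (c : lattice (recip B) → ℂ),
      ∀ x, ‖F x - ∑ k ∈ s, c k * expI k x‖ ≤ ε := by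
  -- In lattice coordinates `F` is invariant under integer translations, so it descends along the
  -- quotient map to the standard torus, where the span of the monomials is dense.
  set π : (Fin 2 → ℝ) → UnitAddTorus (Fin 2) := fun t i => (t i : AddCircle (1 : ℝ)) with hπ
  have hq : IsQuotientMap π := (IsOpenQuotientMap.piMap fun _ : Fin 2 =>
    (QuotientAddGroup.isOpenQuotientMap_mk :
      IsOpenQuotientMap (QuotientAddGroup.mk : ℝ → AddCircle (1 : ℝ)))).isQuotientMap
  have hfac : ∀ t t', π t = π t' → F (mulV B t) = F (mulV B t') := by
    intro t t' h
    have h1 : ∀ i, ∃ n : ℤ, t i = t' i + n := fun i => by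
      have h0 : ((t i - t' i : ℝ) : AddCircle (1 : ℝ)) = 0 := by
        rw [AddCircle.coe_sub, sub_eq_zero]
        exact congrFun h i
      obtain ⟨n, hn⟩ := (AddCircle.coe_eq_zero_iff (1 : ℝ)).1 h0
      refine ⟨n, ?_⟩
      rw [zsmul_eq_mul, mul_one] at hn
      linarith
    choose n hn using h1
    have h2 : t = t' + fun i => (n i : ℝ) := funext hn
    rw [h2, mulV_add]
    exact hF _ ⟨n, rfl⟩ _
  let πc : C(Fin 2 → ℝ, UnitAddTorus (Fin 2)) := ⟨π, hq.continuous⟩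
  let G : C(UnitAddTorus (Fin 2), ℂ) := IsQuotientMap.lift (f := πc) hq
    ⟨fun t => F (mulV B t), hc.comp (continuous_mulV B)⟩ (fun t t' h => hfac t t' h)
  have hG : ∀ t, G (π t) = F (mulV B t) := fun t =>
    congrFun (congrArg DFunLike.coe (IsQuotientMap.lift_comp (f := πc) hq
      (⟨fun t => F (mulV B t), hc.comp (continuous_mulV B)⟩ : C(Fin 2 → ℝ, ℂ)) hfac)) t
  have hmem : G ∈ (Submodule.span ℂ (Set.range (UnitAddTorus.mFourier (d := Fin 2)))).topologicalClosure := by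
    rw [UnitAddTorus.span_mFourier_closure_eq_top]
    trivial
  obtain ⟨P, hP, hdist⟩ := Metric.mem_closure_iff.1 hmem ε hε
  obtain ⟨c, rfl⟩ := (Finsupp.mem_span_range_iff_exists_finsupp).1 hP
  set e : (Fin 2 → ℤ) → lattice (recip B) := fun n => ⟨mulV (recip B) fun i => (n i : ℝ), n, rfl⟩
    with he
  have hinj : Function.Injective e := by
    intro n m h
    have h1 := congrArg (fun k : lattice (recip B) => coord (recip B) k) h
    simp only [he, coord_mulV (det_recip_ne_zero hB)] at h1
    funext i
    exact_mod_cast congrFun h1 i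
  classical
  refine ⟨c.support.map ⟨e, hinj⟩, fun k => c (Function.invFun e k), fun x => ?_⟩
  have hx := (ContinuousMap.dist_lt_iff hε).1 hdist (π (coord B x))
  rw [hG, mulV_coord hB, dist_eq_norm] at hx
  refine le_trans (le_of_eq ?_) hx.le
  congr 2
  rw [Finset.sum_map, Finsupp.sum, ContinuousMap.coe_sum, Finset.sum_apply]
  refine Finset.sum_congr rfl fun n _ => ?_
  simp only [Function.Embedding.coeFn_mk, Function.leftInverse_invFun hinj n,
    ContinuousMap.coe_smul, Pi.smul_apply, smul_eq_mul]
  congr 1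
  rw [← expI_mulV_eq hB, mulV_coord hB]

theorem fcoef_expI (hB : B.det ≠ 0) (k l : lattice (recip B)) :
    fcoef B (expI k) l = if k = l then 1 else 0 := by
  have ha : (cellArea B : ℂ) ≠ 0 := by exact_mod_cast (cellArea_pos hB).ne'
  simp only [fcoef, ← expI_add_left]
  split_ifs with h
  · subst h
    have hv : (volume.restrict (cell B)).real Set.univ = cellArea B := by
      rw [measureReal_restrict_apply_univ]
      rfl
    simp only [add_neg_cancel, expI_zero_left, integral_const, hv]
    simp [ha]
  · rw [setIntegral_expI hB (add_mem k.2 (neg_mem l.2)) (by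
      rw [← sub_eq_add_neg, sub_ne_zero]
      exact fun h' => h (Subtype.ext h')), mul_zero]

/-- `F` is orthogonal to all trigonometric polynomials. Pairing it with `F - P` for a uniform
`ε`-approximation `P` bounds `∫ ‖F‖²` by `ε ∫ ‖F‖`; continuity upgrades the conclusion from almost
everywhere to everywhere. -/
theorem eq_zero_of_fcoef_eq_zero (hB : B.det ≠ 0) {F : Plane → ℂ} (hF : LatPeriodic B F)
    (hc : Continuous F) (h : ∀ K ∈ lattice (recip B), fcoef B F K = 0) (x : Plane) : F x = 0 := by
  have ha : (cellArea B : ℂ) ≠ 0 := by exact_mod_cast (cellArea_pos hB).ne'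
  have h0 : ∀ K ∈ lattice (recip B), ∫ x in cell B, F x * star (expI K x) = 0 := by
    intro K hK
    have := h K hK
    simp only [fcoef, mul_eq_zero, inv_eq_zero, ha, false_or] at this
    simpa only [star_expI] using this
  set I : ℝ := ∫ x in cell B, ‖F x‖ ^ 2 with hI
  set N : ℝ := ∫ x in cell B, ‖F x‖ with hN
  have hcomplex : (∫ x in cell B, F x * star (F x)) = (I : ℂ) := by
    rw [hI, ← integral_complex_ofReal]
    refine integral_congr_ae (Eventually.of_forall fun x => ?_)
    simp only [Complex.star_def, Complex.mul_conj, Complex.normSq_eq_norm_sq]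
  have hbound : ∀ ε > 0, I ≤ ε * N := by
    intro ε hε
    obtain ⟨s, c, hs⟩ := exists_trigPoly_approx hB hF hc hε
    have h1 : ∫ x in cell B, F x * star (∑ k ∈ s, c k * expI k x) = 0 := by
      simp only [star_sum, star_mul', Finset.mul_sum]
      rw [integral_finsetSum _ fun k _ => integrableOn_cell (by
        simp only [star_expI]; fun_prop)]
      refine Finset.sum_eq_zero fun k _ => ?_
      have : ∀ x, F x * (star (c k) * star (expI k x)) = star (c k) * (F x * star (expI k x)) :=
        fun x => by ring
      simp only [this, integral_const_mul, h0 k k.2, mul_zero]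
    have h2 : (I : ℂ) = ∫ x in cell B, F x * star (F x - ∑ k ∈ s, c k * expI k x) := by
      rw [← hcomplex, ← sub_zero (∫ x in cell B, F x * star (F x)), ← h1, ← integral_sub]
      · simp only [star_sub, mul_sub]
      · exact integrableOn_cell (by fun_prop)
      · exact integrableOn_cell (by fun_prop)
    have h3 : ‖(I : ℂ)‖ ≤ ∫ x in cell B, ε * ‖F x‖ := by
      rw [h2]
      refine norm_integral_le_of_norm_le (integrableOn_cell (by fun_prop))
        (Eventually.of_forall fun x => ?_)
      rw [norm_mul, norm_star, mul_comm]
      exact mul_le_mul_of_nonneg_right (hs x) (norm_nonneg _)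
    rw [integral_const_mul, Complex.norm_real] at h3
    exact (le_abs_self I).trans h3
  have hI0 : I ≤ 0 := by
    refine ge_of_tendsto (x := 𝓝[>] (0 : ℝ)) (f := fun ε : ℝ => ε * N) ?_
      (eventually_nhdsWithin_of_forall hbound)
    have : Tendsto (fun ε : ℝ => ε * N) (𝓝 0) (𝓝 (0 * N)) := tendsto_id.mul_const N
    rw [zero_mul] at this
    exact this.mono_left nhdsWithin_le_nhds
  have hI1 : I = 0 := le_antisymm hI0 (integral_nonneg fun x => by positivity)
  have hae : ∀ᵐ x ∂(volume.restrict (cell B)), F x = 0 := by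
    have := (integral_eq_zero_iff_of_nonneg (μ := volume.restrict (cell B))
      (f := fun x => ‖F x‖ ^ 2) (fun x => by positivity)
      (integrableOn_cell (by fun_prop))).1 hI1
    filter_upwards [this] with x hx
    simpa using hx
  have hae2 : F =ᵐ[volume] fun _ => 0 :=
    ae_of_ae_cell hB hae fun K hK x hx => by rw [hF K hK x, hx]
  exact congrFun ((hc.ae_eq_iff_eq volume continuous_const).1 hae2) x

theorem fcoef_sub (F G : Plane → ℂ) (hF : Continuous F) (hG : Continuous G) (K : Plane) :
    fcoef B (fun x => F x - G x) K = fcoef B F K - fcoef B G K := by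
  simp only [fcoef, sub_mul]
  rw [integral_sub (integrableOn_cell (by fun_prop)) (integrableOn_cell (by fun_prop)), mul_sub]

theorem eq_of_fcoef_eq (hB : B.det ≠ 0) {F G : Plane → ℂ} (hF : LatPeriodic B F)
    (hG : LatPeriodic B G) (hFc : Continuous F) (hGc : Continuous G)
    (h : ∀ K ∈ lattice (recip B), fcoef B F K = fcoef B G K) (x : Plane) : F x = G x := by
  refine sub_eq_zero.1 (eq_zero_of_fcoef_eq_zero hB (F := fun x => F x - G x) ?_ (by fun_prop) ?_ x)
  · intro K hK x
    simp only [hF K hK x, hG K hK x]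
  · intro K hK
    rw [fcoef_sub F G hFc hGc, h K hK, sub_self]

theorem continuous_fourierSeries {ι : Type*} {a : ι → ℂ} {k : ι → Plane} (ha : Summable fun i => ‖a i‖) :
    Continuous fun x => ∑' i, a i * expI (k i) x :=
  continuous_tsum (fun i => by fun_prop) ha fun i x => by simp

theorem fcoef_fourierSeries (hB : B.det ≠ 0) {a : lattice (recip B) → ℂ}
    (ha : Summable fun i => ‖a i‖) (K : lattice (recip B)) :
    fcoef B (fun x => ∑' k : lattice (recip B), a k * expI k x) K = a K := by
  have h1 : ∀ k : lattice (recip B), Integrable (fun x => a k * expI k x * expI (-(K : Plane)) x)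
      (volume.restrict (cell B)) := fun k => integrableOn_cell (by fun_prop)
  have h2 : Summable fun k : lattice (recip B) =>
      ∫ x in cell B, ‖a k * expI k x * expI (-(K : Plane)) x‖ := by
    simp only [norm_mul, norm_expI, mul_one, integral_const]
    exact ha.const_smul _
  have h3 := hasSum_integral_of_summable_integral_norm h1 h2
  have h4 := h3.mul_left ((cellArea B)⁻¹ : ℂ)
  have h5 : ∀ k : lattice (recip B), ((cellArea B)⁻¹ : ℂ) *
      ∫ x in cell B, a k * expI k x * expI (-(K : Plane)) x = if k = K then a K else 0 := by
    intro k
    have := fcoef_expI hB k K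
    simp only [fcoef] at this
    simp only [mul_assoc, integral_const_mul]
    rw [mul_left_comm, this]
    split_ifs with h
    · rw [h, mul_one]
    · rw [mul_zero]
  simp only [h5] at h4
  have h6 := h4.unique (hasSum_ite_eq K (a K))
  rw [← h6, fcoef]
  simp only [tsum_mul_right]

/-- Fourier inversion for continuous functions with summable Fourier coefficients. -/
theorem hasSum_fourierSeries (hB : B.det ≠ 0) {F : Plane → ℂ} (hF : LatPeriodic B F)
    (hc : Continuous F) (hs : Summable fun K : lattice (recip B) => ‖fcoef B F K‖) (x : Plane) :
    HasSum (fun K : lattice (recip B) => fcoef B F K * expI K x) (F x) := by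
  have h : F x = ∑' K : lattice (recip B), fcoef B F K * expI K x := by
    refine eq_of_fcoef_eq hB (G := fun x => ∑' K : lattice (recip B), fcoef B F K * expI K x) hF ?_ hc
      (continuous_fourierSeries hs) ?_ x
    · intro R hR x
      exact tsum_congr fun K => by rw [expI_add_lattice hB K.2 hR]
    · intro K hK
      exact (fcoef_fourierSeries hB hs ⟨K, hK⟩).symm
  rw [h]
  exact (Summable.of_norm (by simpa using hs)).hasSum

/-- Equidistribution of a lattice modulo an incommensurate one. -/
theorem tendsto_latAvg_periodic {L : Matrix (Fin 2) (Fin 2) ℝ} (hL : L.det ≠ 0) (hB : B.det ≠ 0)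
    (hinc : lattice (recip L) ⊓ lattice (recip B) = ⊥) {F : Plane → ℂ} (hF : LatPeriodic B F)
    (hc : Continuous F) :
    Tendsto (latAvg L fun R => F R) atTop (𝓝 (((cellArea B)⁻¹ : ℂ) * ∫ x in cell B, F x)) := by
  have ha : (cellArea B : ℂ) ≠ 0 := by exact_mod_cast (cellArea_pos hB).ne'
  -- On a single character the average is 1 for `k = 0`. For `k ≠ 0` it tends to 0, because `k` lies
  -- in `recip B` and incommensurability keeps it out of `recip L`.
  have hE : ∀ k : lattice (recip B), Tendsto (latAvg L fun R => expI k R) atTop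
      (𝓝 (((cellArea B)⁻¹ : ℂ) * ∫ x in cell B, expI k x)) := by
    intro k
    have h0 := fcoef_expI hB k 0
    simp only [fcoef, ZeroMemClass.coe_zero, neg_zero, expI_zero_left, mul_one] at h0
    rw [h0]
    split_ifs with h
    · subst h
      simpa using tendsto_latAvg_one hL
    · refine tendsto_latAvg_expI hL fun hk => h ?_
      have : (k : Plane) ∈ lattice (recip L) ⊓ lattice (recip B) := ⟨hk, k.2⟩
      rw [hinc] at this
      exact Subtype.ext (by simpa using this)
  rw [Metric.tendsto_atTop]
  intro ε hε
  obtain ⟨s, c, hs⟩ := exists_trigPoly_approx hB hF hc (ε := ε / 4) (by positivity)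
  set P : Plane → ℂ := fun x => ∑ k ∈ s, c k * expI k x with hP
  have hPc : Continuous P := by fun_prop
  have hPt : Tendsto (latAvg L fun R => P R) atTop
      (𝓝 (((cellArea B)⁻¹ : ℂ) * ∫ x in cell B, P x)) := by
    simp only [hP]
    rw [integral_finsetSum _ fun k _ => integrableOn_cell (by fun_prop), Finset.mul_sum]
    refine Tendsto.congr (fun r => (latAvg_sum hL s (fun k R => c k * expI k R) r).symm) ?_
    refine tendsto_finsetSum _ fun k _ => ?_
    rw [integral_const_mul, mul_left_comm]
    exact ((hE k).const_mul (c k)).congr fun r => (latAvg_const_mul hL _ _ r).symm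
  obtain ⟨r₀, hr₀⟩ := Metric.tendsto_atTop.1 hPt (ε / 4) (by positivity)
  refine ⟨r₀, fun r hr => ?_⟩
  have h1 := hr₀ r hr
  have h2 : ‖latAvg L (fun R => F R) r - latAvg L (fun R => P R) r‖ ≤ ε / 4 := by
    have := latAvg_add hL (fun R => F R - P R) (fun R => P R) r
    simp only [sub_add_cancel] at this
    rw [this, add_sub_cancel_right]
    exact norm_latAvg_le hL (by positivity) (fun R => hs R) r
  have h3 : ‖((cellArea B)⁻¹ : ℂ) * (∫ x in cell B, F x) -
      ((cellArea B)⁻¹ : ℂ) * ∫ x in cell B, P x‖ ≤ ε / 4 := by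
    rw [← mul_sub, ← integral_sub (integrableOn_cell hc) (integrableOn_cell hPc), norm_mul, norm_inv,
      Complex.norm_real, Real.norm_of_nonneg (cellArea_pos hB).le,
      inv_mul_le_iff₀ (cellArea_pos hB)]
    refine (norm_setIntegral_le_of_norm_le_const (volume_cell_lt_top B) fun x _ => hs x).trans ?_
    rw [mul_comm, measureReal_def, cellArea]
  rw [dist_eq_norm] at h1 ⊢
  set a := latAvg L (fun R => F R) r
  set b := latAvg L (fun R => P R) r
  set u := ((cellArea B)⁻¹ : ℂ) * ∫ x in cell B, F x
  set v := ((cellArea B)⁻¹ : ℂ) * ∫ x in cell B, P x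
  calc ‖a - u‖ = ‖(a - b) + (b - v) - (u - v)‖ := by congr 1; ring
    _ ≤ ‖a - b‖ + ‖b - v‖ + ‖u - v‖ := (norm_sub_le _ _).trans (by gcongr; exact norm_add_le _ _)
    _ < ε := by linarith

/-- The sum of two lattices whose reciprocal lattices meet only in `0` is dense. -/
theorem exists_lattice_near {L : Matrix (Fin 2) (Fin 2) ℝ} (hL : L.det ≠ 0) (hB : B.det ≠ 0)
    (hinc : lattice (recip L) ⊓ lattice (recip B) = ⊥) (x : Plane) {δ : ℝ} (hδ : 0 < δ) :
    ∃ R ∈ lattice L, ∃ K ∈ lattice B, ‖R + K - x‖ < δ := by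
  by_contra! hcon
  set S : Set Plane := {z | ∃ K ∈ lattice B, z = x + K} with hS
  have hSne : S.Nonempty := ⟨x, 0, zero_mem _, by simp⟩
  -- A periodic bump around `x + lattice B`. If no sum of lattice vectors came near `x`, it would
  -- vanish on all of `lattice L`, so equidistribution would give it mean zero; yet it is
  -- continuous, nonnegative and equal to `δ` at `x`.
  set f : Plane → ℝ := fun z => max 0 (δ - Metric.infDist z S) with hf
  have hfc : Continuous f := by
    have := Metric.continuous_infDist_pt S
    fun_prop
  have hper : LatPeriodic B f := by
    intro K hK z
    simp only [hf]
    congr 2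
    have e : S = (IsometryEquiv.addRight K) '' S := by
      ext w
      simp only [hS, Set.mem_image]
      constructor
      · rintro ⟨K', hK', rfl⟩
        exact ⟨x + (K' - K), ⟨K' - K, sub_mem hK' hK, rfl⟩, by simp; abel⟩
      · rintro ⟨_, ⟨K', hK', rfl⟩, rfl⟩
        exact ⟨K' + K, add_mem hK' hK, by simp; abel⟩
    nth_rewrite 1 [e]
    exact Metric.infDist_image (IsometryEquiv.addRight K).isometry
  have hzero : ∀ R ∈ lattice L, f R = 0 := by
    intro R hR
    refine max_eq_left (sub_nonpos.2 ?_)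
    refine (Metric.le_infDist hSne).2 ?_
    rintro _ ⟨K, hK, rfl⟩
    have := hcon R hR (-K) (neg_mem hK)
    rwa [dist_eq_norm, ← sub_sub, sub_right_comm, ← sub_eq_add_neg] at *
  have h1 := tendsto_latAvg_periodic hL hB hinc (F := fun z => (f z : ℂ))
    (fun K hK z => by simp only [hper K hK z]) (by fun_prop)
  have h2 : Tendsto (latAvg L fun R => ((f R : ℝ) : ℂ)) atTop (𝓝 0) := by
    refine tendsto_const_nhds.congr fun r => ?_
    rw [latAvg_eq hL]
    simp [hzero]
  have h3 := tendsto_nhds_unique h1 h2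
  have ha : (cellArea B : ℂ) ≠ 0 := by exact_mod_cast (cellArea_pos hB).ne'
  rw [integral_complex_ofReal] at h3
  simp only [mul_eq_zero, inv_eq_zero, ha, false_or, Complex.ofReal_eq_zero] at h3
  have hae : ∀ᵐ z ∂(volume.restrict (cell B)), f z = 0 :=
    (integral_eq_zero_iff_of_nonneg (fun z => le_max_left _ _) (integrableOn_cell hfc)).1 h3
  have hae2 : f =ᵐ[volume] fun _ => 0 :=
    ae_of_ae_cell hB hae fun K hK z hz => by rw [hper K hK z, hz]
  have h4 := congrFun ((hfc.ae_eq_iff_eq volume continuous_const).1 hae2) x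
  have h5 : Metric.infDist x S = 0 :=
    Metric.infDist_zero_of_mem ⟨0, zero_mem _, by simp⟩
  simp only [hf, h5, sub_zero] at h4
  linarith [le_max_right 0 δ]

end Series

end

noncomputable section

/-! ### Smooth functions on the product of two tori -/

/-- Smooth functions on the product of the tori `ℝ²/B₁ℤ²` and `ℝ²/B₂ℤ²`. -/
structure SmoothPer (B₁ B₂ : Matrix (Fin 2) (Fin 2) ℝ) (f : Plane → Plane → ℂ) : Prop where
  contDiff : ContDiff ℝ ∞ (fun p : Plane × Plane => f p.1 p.2)
  per₁ : ∀ L ∈ lattice B₁, ∀ x y, f (x + L) y = f x y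
  per₂ : ∀ L ∈ lattice B₂, ∀ x y, f x (y + L) = f x y

section Smooth

variable {B₁ B₂ : Matrix (Fin 2) (Fin 2) ℝ}

theorem IsTorusAnalytic.smoothPer {𝓂 𝓃 : Type u} {f : Plane → Plane → Matrix 𝓂 𝓃 ℂ}
    (hf : IsTorusAnalytic B₁ B₂ f) (α : 𝓂) (β : 𝓃) : SmoothPer B₁ B₂ fun x y => f x y α β where
  contDiff := (hf.analytic α β).contDiff
  per₁ L hL x y := by rw [hf.periodic₁ L hL]
  per₂ L hL x y := by rw [hf.periodic₂ L hL]

theorem exists_bound_of_periodic {E : Type*} [NormedAddCommGroup E] (h₁ : B₁.det ≠ 0)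
    (h₂ : B₂.det ≠ 0) {F : Plane × Plane → E} (hc : Continuous F)
    (hp₁ : ∀ L ∈ lattice B₁, ∀ x y, F (x + L, y) = F (x, y))
    (hp₂ : ∀ L ∈ lattice B₂, ∀ x y, F (x, y + L) = F (x, y)) :
    ∃ C : ℝ, 0 ≤ C ∧ ∀ p, ‖F p‖ ≤ C := by
  obtain ⟨d₁, -, hd₁⟩ := exists_norm_le_of_mem_cell B₁
  obtain ⟨d₂, -, hd₂⟩ := exists_norm_le_of_mem_cell B₂
  obtain ⟨C, hC⟩ := ((isCompact_closedBall (0 : Plane) d₁).prod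
    (isCompact_closedBall (0 : Plane) d₂)).exists_bound_of_continuousOn hc.continuousOn
  have key : ∀ p, ‖F p‖ ≤ C := by
    rintro ⟨x, y⟩
    have e1 := LatPeriodic.reduce_eq h₁ (F := fun x => F (x, y)) (fun L hL x => hp₁ L hL x y) x
    have e2 := LatPeriodic.reduce_eq h₂ (F := fun y => F (reduce B₁ x, y))
      (fun L hL y => hp₂ L hL _ y) y
    rw [← e1, ← e2]
    exact hC _ ⟨by simpa using hd₁ _ (reduce_mem_cell B₁ x),
      by simpa using hd₂ _ (reduce_mem_cell B₂ y)⟩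
  exact ⟨C, (norm_nonneg _).trans (key 0), key⟩

variable {f : Plane → Plane → ℂ}

theorem SmoothPer.exists_norm_le (h₁ : B₁.det ≠ 0) (h₂ : B₂.det ≠ 0) (hf : SmoothPer B₁ B₂ f) :
    ∃ C : ℝ, 0 ≤ C ∧ ∀ x y, ‖f x y‖ ≤ C := by
  obtain ⟨C, hC0, hC⟩ := exists_bound_of_periodic h₁ h₂ hf.contDiff.continuous hf.per₁ hf.per₂
  exact ⟨C, hC0, fun x y => hC (x, y)⟩

theorem SmoothPer.fderiv_add (hf : SmoothPer B₁ B₂ f) {L : Plane × Plane}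
    (h1 : L.1 ∈ lattice B₁) (h2 : L.2 ∈ lattice B₂) (p : Plane × Plane) :
    fderiv ℝ (fun p : Plane × Plane => f p.1 p.2) (p + L) =
      fderiv ℝ (fun p : Plane × Plane => f p.1 p.2) p := by
  rw [← fderiv_comp_add_right]
  congr 1
  ext q
  simp only [Prod.fst_add, Prod.snd_add, hf.per₁ _ h1, hf.per₂ _ h2]

theorem SmoothPer.exists_lipschitz (h₁ : B₁.det ≠ 0) (h₂ : B₂.det ≠ 0) (hf : SmoothPer B₁ B₂ f) :
    ∃ C : ℝ, 0 ≤ C ∧ ∀ x y y', ‖f x y - f x y'‖ ≤ C * ‖y - y'‖ := by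
  obtain ⟨C, hC0, hC⟩ := exists_bound_of_periodic h₁ h₂
    (F := fderiv ℝ (fun p : Plane × Plane => f p.1 p.2))
    (hf.contDiff.continuous_fderiv (by simp))
    (fun L hL x y => by
      have := hf.fderiv_add (L := (L, 0)) hL (zero_mem _) (x, y)
      simpa using this)
    (fun L hL x y => by
      have := hf.fderiv_add (L := (0, L)) (zero_mem _) hL (x, y)
      simpa using this)
  refine ⟨C, hC0, fun x y y' => ?_⟩
  have := Convex.norm_image_sub_le_of_norm_fderiv_le (𝕜 := ℝ) (s := Set.univ)
    (f := fun p : Plane × Plane => f p.1 p.2)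
    (fun p _ => (hf.contDiff.differentiable (by simp)).differentiableAt)
    (fun p _ => hC p) convex_univ (Set.mem_univ (x, y')) (Set.mem_univ (x, y))
  refine this.trans (le_of_eq ?_)
  simp [Prod.norm_def]

/-- The derivative in direction `v` with respect to the first variable. -/
def dirDeriv (v : Plane) (f : Plane → Plane → ℂ) (x y : Plane) : ℂ :=
  fderiv ℝ (fun p : Plane × Plane => f p.1 p.2) (x, y) (v, 0)

theorem SmoothPer.dirDeriv (hf : SmoothPer B₁ B₂ f) (v : Plane) :
    SmoothPer B₁ B₂ (dirDeriv v f) where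
  contDiff := by
    have h1 : ContDiff ℝ ∞ (fderiv ℝ (fun p : Plane × Plane => f p.1 p.2)) :=
      hf.contDiff.fderiv_right (by simp)
    exact h1.clm_apply contDiff_const
  per₁ L hL x y := by
    have := hf.fderiv_add (L := (L, 0)) hL (zero_mem _) (x, y)
    simp only [Prod.mk_add_mk, add_zero] at this
    simp only [Bilayer.dirDeriv, this]
  per₂ L hL x y := by
    have := hf.fderiv_add (L := (0, L)) (zero_mem _) hL (x, y)
    simp only [Prod.mk_add_mk, add_zero] at this
    simp only [Bilayer.dirDeriv, this]

theorem SmoothPer.continuous_left (hf : SmoothPer B₁ B₂ f) (y : Plane) :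
    Continuous fun x => f x y :=
  hf.contDiff.continuous.comp (by fun_prop : Continuous fun x : Plane => (x, y))

theorem SmoothPer.continuous_right (hf : SmoothPer B₁ B₂ f) (x : Plane) :
    Continuous fun y => f x y :=
  hf.contDiff.continuous.comp (by fun_prop : Continuous fun y : Plane => (x, y))

/-- Translating `f` by `t • v` multiplies its coefficient by `exp (i t K·v)`. Differentiating this
at `t = 0` under the integral sign replaces integration by parts over the cell. -/
theorem SmoothPer.fcoef_dirDeriv (h₁ : B₁.det ≠ 0) (h₂ : B₂.det ≠ 0) (hf : SmoothPer B₁ B₂ f)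
    (v y : Plane) {K : Plane} (hK : K ∈ lattice (recip B₁)) :
    fcoef B₁ (fun x => Bilayer.dirDeriv v f x y) K =
      Complex.I * ((inner ℝ K v : ℝ) : ℂ) * fcoef B₁ (fun x => f x y) K := by
  have hd := hf.dirDeriv v
  obtain ⟨C, hC0, hC⟩ := hd.exists_norm_le h₁ h₂
  have hder : ∀ x : Plane, ∀ t : ℝ, HasDerivAt (fun t : ℝ => f (x + t • v) y * expI (-K) x)
      (Bilayer.dirDeriv v f (x + t • v) y * expI (-K) x) t := by
    intro x t
    have h1 : HasFDerivAt (fun p : Plane × Plane => f p.1 p.2)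
        (fderiv ℝ (fun p : Plane × Plane => f p.1 p.2) (x + t • v, y)) (x + t • v, y) :=
      (hf.contDiff.differentiable (by simp)).differentiableAt.hasFDerivAt
    have h2 : HasDerivAt (fun t : ℝ => ((x + t • v, y) : Plane × Plane)) (v, 0) t := by
      refine HasDerivAt.prodMk ?_ (hasDerivAt_const _ _)
      simpa using ((hasDerivAt_id t).smul_const v).const_add x
    exact (h1.comp_hasDerivAt t h2).mul_const _
  have hint := (hasDerivAt_integral_of_dominated_loc_of_deriv_le (𝕜 := ℝ)
    (μ := volume.restrict (cell B₁)) (x₀ := (0 : ℝ)) (bound := fun _ => C)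
    (F := fun t x => f (x + t • v) y * expI (-K) x)
    (F' := fun t x => Bilayer.dirDeriv v f (x + t • v) y * expI (-K) x) univ_mem
    (Eventually.of_forall fun t => (((hf.continuous_left y).comp
      (continuous_add_const (t • v))).mul (continuous_expI _)).aestronglyMeasurable)
    (integrableOn_cell (((hf.continuous_left y).comp
      (continuous_add_const ((0 : ℝ) • v))).mul (continuous_expI _)))
    (((hd.continuous_left y).comp
      (continuous_add_const ((0 : ℝ) • v))).mul (continuous_expI _)).aestronglyMeasurable
    (Eventually.of_forall fun x t _ => by
      rw [norm_mul, norm_expI, mul_one]; exact hC _ _)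
    (integrable_const _)
    (Eventually.of_forall fun x t _ => hder x t)).2
  have hshift : ∀ t : ℝ, ∫ x in cell B₁, f (x + t • v) y * expI (-K) x =
      Complex.exp (t * (Complex.I * ((inner ℝ K v : ℝ) : ℂ))) *
        ∫ x in cell B₁, f x y * expI (-K) x := by
    intro t
    have hper : ∀ L ∈ lattice B₁, ∀ x, f (x + L) y * expI (-K) (x + L) = f x y * expI (-K) x :=
      fun L hL x => by rw [hf.per₁ L hL, expI_add_lattice h₁ (neg_mem hK) hL]
    rw [← setIntegral_cell_add h₁ (f := fun x => f x y * expI (-K) x) hper (t • v), ← integral_const_mul]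
    refine integral_congr_ae (Eventually.of_forall fun x => ?_)
    have e : Complex.exp (t * (Complex.I * ((inner ℝ K v : ℝ) : ℂ))) = expI K (t • v) := by
      simp only [expI, inner_smul_right, Complex.ofReal_mul]
      congr 1
      ring
    simp only [e, expI_add_right]
    linear_combination (-f (x + t • v) y * expI (-K) x) * expI_mul_neg K (t • v)
  have hexp : HasDerivAt (fun t : ℝ => Complex.exp (t * (Complex.I * ((inner ℝ K v : ℝ) : ℂ))) *
        ∫ x in cell B₁, f x y * expI (-K) x)
      (Complex.I * ((inner ℝ K v : ℝ) : ℂ) * ∫ x in cell B₁, f x y * expI (-K) x) 0 := by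
    have h1 : HasDerivAt (fun t : ℝ => (t : ℂ) * (Complex.I * ((inner ℝ K v : ℝ) : ℂ)))
        (1 * (Complex.I * ((inner ℝ K v : ℝ) : ℂ))) 0 :=
      (Complex.ofRealCLM.hasDerivAt (x := 0)).mul_const _
    have h2 := (h1.cexp).mul_const (∫ x in cell B₁, f x y * expI (-K) x)
    simpa using h2
  have := hint.unique (hexp.congr_of_eventuallyEq (Eventually.of_forall hshift))
  simp only [zero_smul, add_zero] at this
  rw [fcoef, fcoef, this]
  ring

/-- Fourier coefficients in the first variable decay faster than any power. -/
theorem SmoothPer.fcoef_decay (h₁ : B₁.det ≠ 0) (h₂ : B₂.det ≠ 0) (hf : SmoothPer B₁ B₂ f) (N : ℕ) :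
    ∃ C : ℝ, 0 ≤ C ∧ ∀ K ∈ lattice (recip B₁), ∀ y,
      ‖fcoef B₁ (fun x => f x y) K‖ ≤ C * dec N K := by
  have ha := cellArea_pos h₁
  have hbase : ∀ {f : Plane → Plane → ℂ} {C : ℝ}, (∀ x y, ‖f x y‖ ≤ C) → ∀ K y,
      ‖fcoef B₁ (fun x => f x y) K‖ ≤ C := by
    intro f C hC K y
    rw [fcoef, norm_mul, norm_inv, Complex.norm_real, Real.norm_of_nonneg ha.le,
      inv_mul_le_iff₀ ha]
    refine (norm_setIntegral_le_of_norm_le_const (volume_cell_lt_top B₁) fun x _ => ?_).trans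
      (le_of_eq (mul_comm _ _))
    rw [norm_mul, norm_expI, mul_one]
    exact hC x y
  -- Each directional derivative produces a factor `i K·v`, and every iterated derivative is again
  -- smooth and periodic, hence bounded.
  have hdir : ∀ v : Plane, ∀ m : ℕ, ∀ {f : Plane → Plane → ℂ}, SmoothPer B₁ B₂ f →
      ∃ C : ℝ, 0 ≤ C ∧ ∀ K ∈ lattice (recip B₁), ∀ y,
        |inner ℝ K v| ^ m * ‖fcoef B₁ (fun x => f x y) K‖ ≤ C := by
    intro v m
    induction m with
    | zero =>
      intro f hf
      obtain ⟨C, hC0, hC⟩ := hf.exists_norm_le h₁ h₂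
      exact ⟨C, hC0, fun K _ y => by simpa using hbase hC K y⟩
    | succ m ih =>
      intro f hf
      obtain ⟨C, hC0, hC⟩ := ih (hf.dirDeriv v)
      refine ⟨C, hC0, fun K hK y => ?_⟩
      have := hC K hK y
      rw [hf.fcoef_dirDeriv h₁ h₂ v y hK, norm_mul, norm_mul, Complex.norm_I, one_mul,
        Complex.norm_real, Real.norm_eq_abs] at this
      rwa [pow_succ, mul_assoc]
  obtain ⟨C, hC0, hC⟩ := hf.exists_norm_le h₁ h₂
  obtain ⟨D₀, hD₀, hD₀'⟩ := hdir (EuclideanSpace.single 0 1) N hf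
  obtain ⟨D₁, hD₁, hD₁'⟩ := hdir (EuclideanSpace.single 1 1) N hf
  refine ⟨3 ^ N * (C + D₀ + D₁), by positivity, fun K hK y => ?_⟩
  set z := ‖fcoef B₁ (fun x => f x y) K‖
  have e0 := hD₀' K hK y
  have e1 := hD₁' K hK y
  simp only [EuclideanSpace.inner_single_right, one_mul, conj_trivial] at e0 e1
  have hz : z ≤ C := hbase hC K y
  have hz0 : 0 ≤ z := norm_nonneg _
  have hK : ‖K‖ ≤ |K.ofLp 0| + |K.ofLp 1| := by
    rw [EuclideanSpace.norm_eq, Fin.sum_univ_two]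
    refine Real.sqrt_le_iff.2 ⟨by positivity, ?_⟩
    simp only [Real.norm_eq_abs]
    nlinarith [abs_nonneg (K.ofLp 0), abs_nonneg (K.ofLp 1)]
  rw [dec, ← div_eq_mul_inv, le_div_iff₀ (by positivity)]
  -- The weight is at most three times the largest of 1 and the two coordinates in absolute value;
  -- the power of a maximum is bounded by the sum of the powers.
  have hpow : (1 + ‖K‖) ^ N ≤ 3 ^ N * (1 + |K.ofLp 0| ^ N + |K.ofLp 1| ^ N) := by
    set a := |K.ofLp 0|
    set b := |K.ofLp 1|
    have ha0 : 0 ≤ a := abs_nonneg _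
    have hb0 : 0 ≤ b := abs_nonneg _
    have hmax : 1 + ‖K‖ ≤ 3 * max 1 (max a b) := by
      have h1 := le_max_left 1 (max a b)
      have h2 := (le_max_left a b).trans (le_max_right 1 (max a b))
      have h3 := (le_max_right a b).trans (le_max_right 1 (max a b))
      linarith
    refine (pow_le_pow_left₀ (by positivity) hmax N).trans ?_
    rw [mul_pow]
    gcongr
    have ha' : 0 ≤ a ^ N := by positivity
    have hb' : 0 ≤ b ^ N := by positivity
    rcases max_choice 1 (max a b) with h | h
    · rw [h, one_pow]; linarith
    · rw [h]
      rcases max_choice a b with h | h <;> rw [h] <;> linarith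
  calc z * (1 + ‖K‖) ^ N ≤ z * (3 ^ N * (1 + |K.ofLp 0| ^ N + |K.ofLp 1| ^ N)) := by gcongr
    _ = 3 ^ N * (z + |K.ofLp 0| ^ N * z + |K.ofLp 1| ^ N * z) := by ring
    _ ≤ 3 ^ N * (C + D₀ + D₁) := by gcongr

/-- The constant does not depend on `K`: this supplies uniform continuity of all intralayer
amplitudes at once. -/
theorem SmoothPer.fcoef_lipschitz (h₁ : B₁.det ≠ 0) (h₂ : B₂.det ≠ 0) (hf : SmoothPer B₁ B₂ f) :
    ∃ C : ℝ, 0 ≤ C ∧ ∀ K y y', ‖fcoef B₁ (fun x => f x y) K - fcoef B₁ (fun x => f x y') K‖ ≤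
      C * ‖y - y'‖ := by
  have ha := cellArea_pos h₁
  obtain ⟨C, hC0, hC⟩ := hf.exists_lipschitz h₁ h₂
  refine ⟨C, hC0, fun K y y' => ?_⟩
  rw [← fcoef_sub _ _ (hf.continuous_left y) (hf.continuous_left y'), fcoef, norm_mul, norm_inv,
    Complex.norm_real, Real.norm_of_nonneg ha.le, inv_mul_le_iff₀ ha]
  refine (norm_setIntegral_le_of_norm_le_const (volume_cell_lt_top B₁) fun x _ => ?_).trans
    (le_of_eq (mul_comm _ _))
  rw [norm_mul, norm_expI, mul_one]
  exact hC x y y'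

theorem summable_fcoef (h₁ : B₁.det ≠ 0) (h₂ : B₂.det ≠ 0) (hf : SmoothPer B₁ B₂ f) (y : Plane) :
    Summable fun K : lattice (recip B₁) => ‖fcoef B₁ (fun x => f x y) K‖ := by
  obtain ⟨C, -, hC⟩ := hf.fcoef_decay h₁ h₂ 3
  refine ((summable_dec (det_recip_ne_zero h₁) le_rfl 0).mul_left C).of_nonneg_of_le
    (fun _ => norm_nonneg _) fun K => ?_
  simpa using hC K K.2 y

end Smooth

/-! ### Exponentially decaying functions on the plane -/

/-- This is `t ^ N / N! ≤ exp t` at `t = c (1 + ‖x‖)`. -/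
theorem exp_neg_le_dec {c : ℝ} (hc : 0 < c) (N : ℕ) :
    ∃ C : ℝ, 0 ≤ C ∧ ∀ x : Plane, Real.exp (-c * ‖x‖) ≤ C * dec N x := by
  refine ⟨Real.exp c * (N.factorial / c ^ N), by positivity, fun x => ?_⟩
  have h := Real.pow_div_factorial_le_exp (x := c * (1 + ‖x‖)) (by positivity) N
  rw [mul_pow, div_le_iff₀ (by positivity)] at h
  rw [dec, ← div_eq_mul_inv, le_div_iff₀ (by positivity)]
  have e1 : Real.exp (c * (1 + ‖x‖)) * Real.exp (-c * ‖x‖) = Real.exp c := by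
    rw [← Real.exp_add]; ring_nf
  have h2 := mul_le_mul_of_nonneg_right h (Real.exp_pos (-c * ‖x‖)).le
  rw [mul_right_comm _ (N.factorial : ℝ), e1] at h2
  rw [mul_div_assoc', le_div_iff₀ (by positivity)]
  calc _ = c ^ N * (1 + ‖x‖) ^ N * Real.exp (-c * ‖x‖) := by ring
    _ ≤ _ := h2

theorem ExpDecay.exists_le_dec {𝓂 𝓃 : Type u} {f : Plane → Matrix 𝓂 𝓃 ℂ} (hf : ExpDecay f) (N : ℕ) :
    ∃ C : ℝ, 0 ≤ C ∧ ∀ x α β, ‖f x α β‖ ≤ C * dec N x := by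
  obtain ⟨c, hc, C, hC⟩ := hf
  obtain ⟨D, hD0, hD⟩ := exp_neg_le_dec hc N
  refine ⟨max C 0 * D, by positivity, fun x α β => (hC x α β).trans ?_⟩
  rw [mul_assoc]
  exact mul_le_mul (le_max_left _ _) (hD x) (Real.exp_pos _).le (le_max_right _ _)

theorem integrable_dec : Integrable (dec 3) := by
  have := integrable_one_add_norm (E := Plane) (μ := volume) (r := 3) (by simp; norm_num)
  refine this.congr (Eventually.of_forall fun u => ?_)
  simp only [dec]
  rw [Real.rpow_neg (by positivity)]
  norm_cast

theorem tendsto_dec_cocompact : Tendsto (dec 1) (cocompact Plane) (𝓝 0) := by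
  have : Tendsto (fun x : Plane => 1 + ‖x‖) (cocompact Plane) atTop :=
    tendsto_atTop_add_const_left _ _ (tendsto_norm_cocompact_atTop)
  refine this.inv_tendsto_atTop.congr fun x => ?_
  simp [dec]

theorem uniformContinuous_of_le_dec {f : Plane → ℂ} (hc : Continuous f) {C : ℝ}
    (h : ∀ x, ‖f x‖ ≤ C * dec 1 x) : UniformContinuous f := by
  refine hc.uniformContinuous_of_tendsto_cocompact (x := 0) ?_
  refine squeeze_zero_norm h ?_
  simpa using tendsto_dec_cocompact.const_mul C

theorem integrable_of_le_dec {f : Plane → ℂ} (hc : Continuous f) {C : ℝ}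
    (h : ∀ x, ‖f x‖ ≤ C * dec 3 x) : Integrable f :=
  (integrable_dec.const_mul C).mono' hc.aestronglyMeasurable (Eventually.of_forall h)

theorem continuous_integral_expI {f : Plane → ℂ} (hc : Continuous f) {C : ℝ}
    (h : ∀ x, ‖f x‖ ≤ C * dec 3 x) : Continuous fun ξ => ∫ x, f x * expI (-x) ξ := by
  refine continuous_of_dominated (bound := fun x => C * dec 3 x) (fun ξ => ?_) (fun ξ => ?_)
    (integrable_dec.const_mul C) ?_
  · simp only [expI_comm _ ξ]
    exact (hc.mul ((continuous_expI ξ).comp continuous_neg)).aestronglyMeasurable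
  · exact Eventually.of_forall fun x => by rw [norm_mul, norm_expI, mul_one]; exact h x
  · exact Eventually.of_forall fun x => by fun_prop

section Periodize

variable {B : Matrix (Fin 2) (Fin 2) ℝ} {f : Plane → ℂ} {C : ℝ}

theorem continuous_periodization (hB : B.det ≠ 0) (hc : Continuous f)
    (h : ∀ x, ‖f x‖ ≤ C * dec 3 x) : Continuous fun x => ∑' R : lattice B, f (x - R) := by
  have hC : 0 ≤ C := by
    have := (norm_nonneg _).trans (h 0)
    simpa using this
  rw [continuous_iff_continuousAt]
  intro x₀
  have hs : Metric.ball x₀ 1 ∈ 𝓝 x₀ := Metric.ball_mem_nhds _ one_pos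
  refine ContinuousOn.continuousAt ?_ hs
  refine continuousOn_tsum (u := fun R : lattice B => C * (dec 3 (0 + R) * (1 + (1 + ‖x₀‖)) ^ 3))
    (fun R => (hc.comp (continuous_sub_right _)).continuousOn)
    (((summable_dec hB le_rfl 0).mul_right _).mul_left C) fun R x hx => (h _).trans ?_
  refine mul_le_mul_of_nonneg_left ?_ hC
  have h1 := dec_le_dec_add 3 (x - R) (-x)
  rw [show x - (R : Plane) + -x = -(0 + R) by abel, dec_neg, norm_neg] at h1
  refine h1.trans ?_
  have : ‖x‖ ≤ 1 + ‖x₀‖ := by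
    have h2 : ‖x - x₀‖ < 1 := by simpa [dist_eq_norm] using hx
    have := norm_add_le (x - x₀) x₀
    rw [sub_add_cancel] at this
    linarith
  have hd := dec_nonneg 3 (0 + (R : Plane))
  gcongr

theorem periodic_periodization : LatPeriodic B fun x => ∑' R : lattice B, f (x - R) := by
  intro K hK x
  simp only
  rw [← (Equiv.addRight (⟨K, hK⟩ : lattice B)).tsum_eq]
  refine tsum_congr fun R => ?_
  simp

/-- Unfolding the plane into translated cells gives the zero mode of Poisson summation. The other
modes follow by multiplying `f` with a character of the lattice. -/
theorem setIntegral_periodization (hB : B.det ≠ 0) (hc : Continuous f)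
    (h : ∀ x, ‖f x‖ ≤ C * dec 3 x) :
    ∫ x in cell B, ∑' R : lattice B, f (x - R) = ∫ x, f x := by
  have hi := integrable_of_le_dec hc h
  have hfd := isAddFundamentalDomain_cell hB volume
  rw [hfd.integral_eq_tsum' f hi]
  have e : ∀ R : lattice B, ∀ x, f (-R +ᵥ x) = f (x - R) := fun R x => by
    rw [AddSubgroup.vadd_def, vadd_eq_add, AddSubgroup.coe_neg, neg_add_eq_sub]
  simp only [e]
  refine ((hasSum_integral_of_summable_integral_norm (fun R => ?_) ?_).tsum_eq).symm
  · exact integrableOn_cell (hc.comp (continuous_sub_right _))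
  · have h2 := hfd.integral_eq_tsum' (fun x => ‖f x‖) hi.norm
    have h3 : Summable fun R : lattice B => ∫ x in cell B, ‖f (-R +ᵥ x)‖ := by
      have hsum := hfd.lintegral_eq_tsum' (fun x => ENNReal.ofReal (‖f x‖))
      have hfin : ∫⁻ x, ENNReal.ofReal ‖f x‖ ≠ ⊤ := hi.norm.lintegral_lt_top.ne
      rw [hsum] at hfin
      refine (ENNReal.summable_toReal hfin).congr fun R => ?_
      rw [integral_eq_lintegral_of_nonneg_ae (Eventually.of_forall fun x => norm_nonneg _)]
      simp only [e]
      exact (hc.comp (continuous_sub_right (R : Plane))).norm.aestronglyMeasurable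
    simpa only [e] using h3

end Periodize

end

noncomputable section

/-! ### The Schur test -/

section Schur

variable {ι : Type*}

/-- The rows and the columns of the kernel `k` are absolutely summable, with sums at most `C`. -/
structure SchurBound (k : ι → ι → ℂ) (C : ℝ) : Prop where
  nonneg : 0 ≤ C
  row_summable : ∀ p, Summable fun q => ‖k p q‖
  row_le : ∀ p, ∑' q, ‖k p q‖ ≤ C
  col_summable : ∀ q, Summable fun p => ‖k p q‖
  col_le : ∀ q, ∑' p, ‖k p q‖ ≤ C

/-- Square summable families. -/
abbrev Ell (ι : Type*) : Type _ := lp (fun _ : ι => ℂ) 2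

theorem Ell.sum_sq_le (ψ : Ell ι) (s : Finset ι) : ∑ i ∈ s, ‖ψ i‖ ^ 2 ≤ ‖ψ‖ ^ 2 := by
  have := lp.sum_rpow_le_norm_rpow (p := 2) (by simp) ψ s
  simpa using this

theorem Ell.summable_sq (ψ : Ell ι) : Summable fun i => ‖ψ i‖ ^ 2 :=
  summable_of_sum_le (fun _ => by positivity) ψ.sum_sq_le

theorem Ell.norm_apply_le (ψ : Ell ι) (i : ι) : ‖ψ i‖ ≤ ‖ψ‖ :=
  lp.norm_apply_le_norm (by simp) ψ i

theorem SchurBound.apply_le {k : ι → ι → ℂ} {C : ℝ} (h : SchurBound k C) (p q : ι) :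
    ‖k p q‖ ≤ C :=
  ((h.row_summable p).le_tsum q fun _ _ => norm_nonneg _).trans (h.row_le p)

theorem SchurBound.summable_mul_sq {k : ι → ι → ℂ} {C : ℝ} (h : SchurBound k C) (ψ : Ell ι) (p : ι) :
    Summable fun q => ‖k p q‖ * ‖ψ q‖ ^ 2 := by
  refine (ψ.summable_sq.mul_left C).of_nonneg_of_le (fun q => by positivity) fun q => ?_
  exact mul_le_mul_of_nonneg_right (h.apply_le p q) (by positivity)

theorem SchurBound.summable_mul {k : ι → ι → ℂ} {C : ℝ} (h : SchurBound k C) (ψ : Ell ι) (p : ι) :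
    Summable fun q => k p q * ψ q := by
  refine Summable.of_norm_bounded ((h.row_summable p).mul_right ‖ψ‖) fun q => ?_
  rw [norm_mul]
  exact mul_le_mul_of_nonneg_left (ψ.norm_apply_le q) (norm_nonneg _)

/-- Cauchy–Schwarz after splitting `|k|` into two square roots; one factor is a row sum. -/
theorem SchurBound.norm_tsum_sq_le {k : ι → ι → ℂ} {C : ℝ} (h : SchurBound k C) (ψ : Ell ι)
    (p : ι) : ‖∑' q, k p q * ψ q‖ ^ 2 ≤ C * ∑' q, ‖k p q‖ * ‖ψ q‖ ^ 2 := by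
  set S := ∑' q, ‖k p q‖ * ‖ψ q‖ ^ 2
  have hS : 0 ≤ S := tsum_nonneg fun q => by positivity
  have h1 : ‖∑' q, k p q * ψ q‖ ≤ √(C * S) := by
    refine le_of_tendsto ((h.summable_mul ψ p).hasSum.norm) (Eventually.of_forall fun s => ?_)
    refine Real.le_sqrt_of_sq_le ?_
    have h2 : ‖∑ q ∈ s, k p q * ψ q‖ ≤ ∑ q ∈ s, ‖k p q‖ * ‖ψ q‖ :=
      norm_sum_le_of_le s fun q _ => (norm_mul _ _).le
    refine (pow_le_pow_left₀ (norm_nonneg _) h2 2).trans ?_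
    refine (Finset.sum_sq_le_sum_mul_sum_of_sq_le_mul s (f := fun q => ‖k p q‖)
      (g := fun q => ‖k p q‖ * ‖ψ q‖ ^ 2) (fun q _ => by positivity) (fun q _ => by positivity)
      fun q _ => le_of_eq (by ring)).trans ?_
    exact mul_le_mul (((h.row_summable p).sum_le_tsum s fun _ _ => norm_nonneg _).trans
      (h.row_le p)) ((h.summable_mul_sq ψ p).sum_le_tsum s fun _ _ => by positivity)
      (Finset.sum_nonneg fun q _ => by positivity) h.nonneg
  calc _ ≤ √(C * S) ^ 2 := pow_le_pow_left₀ (norm_nonneg _) h1 2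
    _ = C * S := Real.sq_sqrt (mul_nonneg h.nonneg hS)

/-- Summing the pointwise Cauchy–Schwarz bounds over `p` first brings in the column sums and the
second factor `C`. -/
theorem SchurBound.sum_norm_tsum_sq_le {k : ι → ι → ℂ} {C : ℝ} (h : SchurBound k C) (ψ : Ell ι)
    (s : Finset ι) : ∑ p ∈ s, ‖∑' q, k p q * ψ q‖ ^ 2 ≤ (C * ‖ψ‖) ^ 2 := by
  have h1 : ∑ p ∈ s, ‖∑' q, k p q * ψ q‖ ^ 2 ≤ ∑ p ∈ s, C * ∑' q, ‖k p q‖ * ‖ψ q‖ ^ 2 :=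
    Finset.sum_le_sum fun p _ => h.norm_tsum_sq_le ψ p
  refine h1.trans ?_
  rw [← Finset.mul_sum, ← Summable.tsum_finsetSum fun p _ => h.summable_mul_sq ψ p]
  have h2 : ∀ q, ∑ p ∈ s, ‖k p q‖ * ‖ψ q‖ ^ 2 ≤ C * ‖ψ q‖ ^ 2 := fun q => by
    rw [← Finset.sum_mul]
    refine mul_le_mul_of_nonneg_right ?_ (by positivity)
    exact ((h.col_summable q).sum_le_tsum s fun _ _ => norm_nonneg _).trans (h.col_le q)
  have h3 : ∑' q, ∑ p ∈ s, ‖k p q‖ * ‖ψ q‖ ^ 2 ≤ C * ‖ψ‖ ^ 2 := by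
    refine (Summable.tsum_le_tsum h2 (summable_sum fun p _ => h.summable_mul_sq ψ p)
      (ψ.summable_sq.mul_left C)).trans ?_
    rw [tsum_mul_left]
    exact mul_le_mul_of_nonneg_left (ψ.summable_sq.tsum_le_of_sum_le ψ.sum_sq_le) h.nonneg
  calc _ ≤ C * (C * ‖ψ‖ ^ 2) := mul_le_mul_of_nonneg_left h3 h.nonneg
    _ = _ := by ring

theorem SchurBound.exists_clm {k : ι → ι → ℂ} {C : ℝ} (h : SchurBound k C) :
    ∃ T : Ell ι →L[ℂ] Ell ι, ‖T‖ ≤ C ∧ ∀ ψ p, HasSum (fun q => k p q * ψ q) (T ψ p) := by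
  have hmem : ∀ ψ : Ell ι, Memℓp (fun p => ∑' q, k p q * ψ q) 2 := fun ψ =>
    memℓp_gen' (C := (C * ‖ψ‖) ^ 2) fun s => by simpa using h.sum_norm_tsum_sq_le ψ s
  let T₀ : Ell ι →ₗ[ℂ] Ell ι :=
    { toFun := fun ψ => ⟨_, hmem ψ⟩
      map_add' := fun ψ φ => by
        ext p
        simp only [lp.coeFn_add, Pi.add_apply, mul_add]
        exact (h.summable_mul ψ p).tsum_add (h.summable_mul φ p)
      map_smul' := fun c ψ => by
        ext p
        simp only [lp.coeFn_smul, Pi.smul_apply, smul_eq_mul, RingHom.id_apply]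
        rw [← tsum_mul_left]
        exact tsum_congr fun q => by ring }
  refine ⟨T₀.mkContinuous C fun ψ => ?_, T₀.mkContinuous_norm_le h.nonneg _, fun ψ p => ?_⟩
  · refine lp.norm_le_of_forall_sum_le (by simp) (mul_nonneg h.nonneg (norm_nonneg _)) fun s => ?_
    have h0 : ∀ p, T₀ ψ p = ∑' q, k p q * ψ q := fun _ => rfl
    simpa [h0] using h.sum_norm_tsum_sq_le ψ s
  · exact (h.summable_mul ψ p).hasSum

open Classical in
/-- The bounded operator on `ℓ²` with the matrix `k` (zero if there is none). -/
def kerOp (k : ι → ι → ℂ) : Ell ι →L[ℂ] Ell ι :=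
  if h : ∃ T : Ell ι →L[ℂ] Ell ι, ∀ ψ p, HasSum (fun q => k p q * ψ q) (T ψ p) then h.choose else 0

theorem SchurBound.hasSum_kerOp {k : ι → ι → ℂ} {C : ℝ} (h : SchurBound k C) (ψ : Ell ι) (p : ι) :
    HasSum (fun q => k p q * ψ q) (kerOp k ψ p) := by
  have hex : ∃ T : Ell ι →L[ℂ] Ell ι, ∀ ψ p, HasSum (fun q => k p q * ψ q) (T ψ p) := by
    obtain ⟨T, -, hT⟩ := h.exists_clm
    exact ⟨T, hT⟩
  rw [kerOp, dif_pos hex]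
  exact hex.choose_spec ψ p

theorem SchurBound.eq_kerOp {k : ι → ι → ℂ} {C : ℝ} (h : SchurBound k C) {T : Ell ι →L[ℂ] Ell ι}
    (hT : ∀ ψ p, HasSum (fun q => k p q * ψ q) (T ψ p)) : T = kerOp k := by
  ext ψ p
  exact (hT ψ p).unique (h.hasSum_kerOp ψ p)

theorem SchurBound.norm_kerOp_le {k : ι → ι → ℂ} {C : ℝ} (h : SchurBound k C) : ‖kerOp k‖ ≤ C := by
  obtain ⟨T, hTC, hT⟩ := h.exists_clm
  rwa [← h.eq_kerOp hT]

theorem SchurBound.norm_kerOp_sub_le {k k' : ι → ι → ℂ} {C C' D : ℝ} (h : SchurBound k C)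
    (h' : SchurBound k' C') (hd : SchurBound (fun p q => k p q - k' p q) D) :
    ‖kerOp k - kerOp k'‖ ≤ D := by
  rw [hd.eq_kerOp (T := kerOp k - kerOp k')]
  · exact hd.norm_kerOp_le
  · intro ψ p
    simp only [sub_mul]
    exact (h.hasSum_kerOp ψ p).sub (h'.hasSum_kerOp ψ p)

theorem SchurBound.of_le {k : ι → ι → ℂ} {m : ι → ι → ℝ} {C : ℝ} (hC : 0 ≤ C)
    (hk : ∀ p q, ‖k p q‖ ≤ m p q)
    (hr : ∀ p, Summable (fun q => m p q) ∧ ∑' q, m p q ≤ C)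
    (hc : ∀ q, Summable (fun p => m p q) ∧ ∑' p, m p q ≤ C) : SchurBound k C where
  nonneg := hC
  row_summable p := (hr p).1.of_nonneg_of_le (fun _ => norm_nonneg _) (hk p)
  row_le p := ((((hr p).1.of_nonneg_of_le (fun _ => norm_nonneg _) (hk p))).tsum_le_tsum (hk p)
    (hr p).1).trans (hr p).2
  col_summable q := (hc q).1.of_nonneg_of_le (fun _ => norm_nonneg _) fun p => hk p q
  col_le q := (((hc q).1.of_nonneg_of_le (fun _ => norm_nonneg _) fun p => hk p q).tsum_le_tsum
    (fun p => hk p q) (hc q).1).trans (hc q).2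

open Classical in
/-- The matrix entries of an operator on `ℓ²`. -/
def entry (T : Ell ι →L[ℂ] Ell ι) (p q : ι) : ℂ := T (lp.single 2 q 1) p

theorem hasSum_entry (T : Ell ι →L[ℂ] Ell ι) (ψ : Ell ι) (p : ι) :
    HasSum (fun q => entry T p q * ψ q) (T ψ p) := by
  classical
  have h1 := lp.hasSum_single (p := 2) (by simp) ψ
  have h2 := h1.mapL ((lp.evalCLM ℂ (fun _ : ι => ℂ) (p := 2) p) ∘L T)
  suffices h0 : ∀ q, entry T p q * ψ q =
      (lp.evalCLM ℂ (fun _ : ι => ℂ) (p := 2) p ∘L T) (lp.single 2 q (ψ q)) by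
    simp only [h0]
    exact h2
  intro q
  have h3 : lp.single (E := fun _ : ι => ℂ) 2 q (ψ q) = ψ q • lp.single 2 q (1 : ℂ) := by
    rw [← lp.single_smul, smul_eq_mul, mul_one]
  rw [h3, map_smul, smul_eq_mul, mul_comm]
  rfl

theorem norm_entry_le (T : Ell ι →L[ℂ] Ell ι) (p q : ι) : ‖entry T p q‖ ≤ ‖T‖ := by
  classical
  refine ((Ell.norm_apply_le _ p).trans (T.le_opNorm _)).trans ?_
  rw [lp.norm_single (by simp), norm_one, mul_one]

open Classical in
theorem SchurBound.kerOp_single {k : ι → ι → ℂ} {C : ℝ} (h : SchurBound k C) (p q : ι) :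
    entry (kerOp k) p q = k p q := by
  refine (h.hasSum_kerOp _ p).unique ?_
  have := hasSum_single (f := fun r => k p r * (lp.single 2 q (1 : ℂ) : Ell ι) r) q fun r hr => by
    rw [lp.single_apply_ne _ _ _ hr, mul_zero]
  simpa using this

end Schur

/-! ### Contour integrals of products of resolvents -/

section Obs

/-- Lipschitz contours, and a function that is continuous on their product. -/
structure IsContourData {n : ℕ} (γ : Fin n → ℝ → ℂ) (g : (Fin n → ℂ) → ℂ) : Prop where
  lipschitz : ∀ k, ∃ K, LipschitzOnWith K (γ k) (Set.Icc 0 1)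
  continuousOn : ContinuousOn (fun t : Fin n → ℝ => g fun k => γ k (t k)) (Set.Icc 0 1)

variable {n : ℕ} {γ : Fin n → ℝ → ℂ} {g : (Fin n → ℂ) → ℂ}

theorem mem_Icc_apply {t : Fin n → ℝ} (ht : t ∈ Set.Icc (0 : Fin n → ℝ) 1) (k : Fin n) :
    t k ∈ Set.Icc (0 : ℝ) 1 := ⟨ht.1 k, ht.2 k⟩

theorem IsContourData.continuousOn_coord (h : IsContourData γ g) (k : Fin n) :
    ContinuousOn (fun t : Fin n → ℝ => γ k (t k)) (Set.Icc 0 1) := by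
  obtain ⟨K, hK⟩ := h.lipschitz k
  exact hK.continuousOn.comp (continuous_apply k).continuousOn fun t ht => mem_Icc_apply ht k

theorem IsContourData.integrableOn (h : IsContourData γ g) :
    IntegrableOn (fun t : Fin n → ℝ => g (fun k => γ k (t k)) * ∏ k, deriv (γ k) (t k))
      (Set.Icc 0 1) := by
  have hcomp : IsCompact (Set.Icc (0 : Fin n → ℝ) 1) := isCompact_Icc
  have hder : IntegrableOn (fun t : Fin n → ℝ => ∏ k, deriv (γ k) (t k)) (Set.Icc 0 1) := by
    choose K hK using h.lipschitz
    refine Measure.integrableOn_of_bounded (M := ∏ k, (K k : ℝ)) hcomp.measure_lt_top.ne ?_ ?_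
    · refine Finset.aestronglyMeasurable_fun_prod _ fun k _ => ?_
      exact ((measurable_deriv (γ k)).comp (measurable_pi_apply k)).aestronglyMeasurable
    -- At the faces of the cube `deriv` sees values of `γ` outside `[0,1]`, which are uncontrolled.
    -- The faces are null, and inside the Lipschitz constants bound the derivatives.
    · have : (Set.univ.pi fun i : Fin n => Set.Ioo ((0 : Fin n → ℝ) i) ((1 : Fin n → ℝ) i))
          =ᵐ[volume] Set.Icc (0 : Fin n → ℝ) 1 := Measure.univ_pi_Ioo_ae_eq_Icc
      rw [← Measure.restrict_congr_set this]
      refine (ae_restrict_iff' (MeasurableSet.univ_pi fun i => measurableSet_Ioo)).2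
        (Eventually.of_forall fun t ht => ?_)
      rw [norm_prod]
      refine Finset.prod_le_prod (fun _ _ => norm_nonneg _) fun k _ => ?_
      have hk : t k ∈ Set.Ioo (0 : ℝ) 1 := ht k trivial
      exact norm_deriv_le_of_lipschitzOn (Icc_mem_nhds hk.1 hk.2) (hK k)
  exact hder.continuousOn_mul h.continuousOn hcomp

section Algebra

variable {𝔸 : Type*} [NormedRing 𝔸] [NormedAlgebra ℂ 𝔸]

/-- The contour integral `∫ g(z) (z₁ - a₁)⁻¹ ⋯ (z_n - a_n)⁻¹ dz` in a Banach algebra. -/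
def obs (γ : Fin n → ℝ → ℂ) (g : (Fin n → ℂ) → ℂ) (a : Fin n → 𝔸) : 𝔸 :=
  ∫ t in Set.Icc (0 : Fin n → ℝ) 1,
    (g (fun k => γ k (t k)) * ∏ k, deriv (γ k) (t k)) •
      (List.ofFn fun k => resolvent (a k) (γ k (t k))).prod

/-- The contours run in the resolvent sets. -/
def AvoidsSpectra (γ : Fin n → ℝ → ℂ) (a : Fin n → 𝔸) : Prop :=
  ∀ k, ∀ t ∈ Set.Icc (0 : ℝ) 1, γ k t ∈ resolventSet ℂ (a k)

theorem AvoidsSpectra.isUnit {a : Fin n → 𝔸} (h : AvoidsSpectra γ a) (k : Fin n) {t : ℝ}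
    (ht : t ∈ Set.Icc (0 : ℝ) 1) : IsUnit (algebraMap ℂ 𝔸 (γ k t) - a k) := h k t ht

theorem continuousOn_resolvent [CompleteSpace 𝔸] (h : IsContourData γ g) {a : Fin n → 𝔸}
    (ha : AvoidsSpectra γ a) (k : Fin n) :
    ContinuousOn (fun t : Fin n → ℝ => resolvent (a k) (γ k (t k))) (Set.Icc 0 1) := by
  intro t ht
  obtain ⟨u, hu⟩ := ha.isUnit k (mem_Icc_apply ht k)
  have h1 := NormedRing.inverse_continuousAt u
  rw [hu] at h1
  refine h1.comp_continuousWithinAt (f := fun t : Fin n → ℝ => algebraMap ℂ 𝔸 (γ k (t k)) - a k) ?_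
  exact (((algebraMapCLM ℂ 𝔸).continuous.comp_continuousOn
    (h.continuousOn_coord k)).sub continuousOn_const) t ht

theorem integrableOn_obs [CompleteSpace 𝔸] (h : IsContourData γ g) {a : Fin n → 𝔸}
    (ha : AvoidsSpectra γ a) :
    IntegrableOn (fun t : Fin n → ℝ => (g (fun k => γ k (t k)) * ∏ k, deriv (γ k) (t k)) •
      (List.ofFn fun k => resolvent (a k) (γ k (t k))).prod) (Set.Icc 0 1) := by
  refine h.integrableOn.smul_continuousOn ?_ isCompact_Icc
  simp only [List.ofFn_eq_map]
  exact continuousOn_list_prod _ fun k _ => continuousOn_resolvent h ha k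

theorem map_ringInverse_of_isUnit {𝔸 𝔹 : Type*} [Ring 𝔸] [Ring 𝔹] (φ : 𝔸 →+* 𝔹) {a : 𝔸}
    (ha : IsUnit a) : φ (Ring.inverse a) = Ring.inverse (φ a) := by
  obtain ⟨u, rfl⟩ := ha
  have : φ (u : 𝔸) = (Units.map (φ : 𝔸 →* 𝔹) u : 𝔹ˣ) := rfl
  rw [Ring.inverse_unit, this, Ring.inverse_unit]
  rfl

theorem AvoidsSpectra.map {𝔹 : Type*} [NormedRing 𝔹] [NormedAlgebra ℂ 𝔹] {a : Fin n → 𝔸}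
    (ha : AvoidsSpectra γ a) (φ : 𝔸 →ₐ[ℂ] 𝔹) : AvoidsSpectra γ fun k => φ (a k) := fun k t ht => by
  have := (ha.isUnit k ht).map φ
  rwa [map_sub, AlgHom.commutes] at this

/-- A continuous algebra homomorphism respects inverses of units and Bochner integrals. It is used
for evaluation at a point and for the representation by multiplication operators. -/
theorem map_obs [CompleteSpace 𝔸] {𝔹 : Type*} [NormedRing 𝔹] [NormedAlgebra ℂ 𝔹] [CompleteSpace 𝔹]
    (h : IsContourData γ g) {a : Fin n → 𝔸} (ha : AvoidsSpectra γ a) (φ : 𝔸 →ₐ[ℂ] 𝔹)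
    (hφ : Continuous φ) : φ (obs γ g a) = obs γ g fun k => φ (a k) := by
  let Φ : 𝔸 →L[ℂ] 𝔹 := ⟨φ.toLinearMap, hφ⟩
  have h1 := Φ.integral_comp_comm (integrableOn_obs h ha)
  rw [obs, obs]
  refine h1.symm.trans ?_
  refine setIntegral_congr_fun measurableSet_Icc fun t ht => ?_
  simp only [map_smul]
  congr 1
  change φ _ = _
  rw [map_list_prod, List.map_ofFn]
  congr 2
  funext k
  simp only [Function.comp, resolvent]
  have := map_ringInverse_of_isUnit (φ : 𝔸 →+* 𝔹) (ha.isUnit k (mem_Icc_apply ht k))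
  simpa using this

end Algebra

section Intertwine

variable {X Y : Type*} [NormedAddCommGroup X] [NormedSpace ℂ X]
  [NormedAddCommGroup Y] [NormedSpace ℂ Y]

theorem comp_inverse_of_comp_eq {J : X →L[ℂ] Y} {a : X →L[ℂ] X} {b : Y →L[ℂ] Y} (ha : IsUnit a)
    (hb : IsUnit b) (h : J ∘L a = b ∘L J) : J ∘L Ring.inverse a = Ring.inverse b ∘L J := by
  have h1 : Ring.inverse b ∘L (b ∘L J) ∘L Ring.inverse a = Ring.inverse b ∘L (J ∘L a) ∘L Ring.inverse a := by
    rw [h]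
  have ha' : a ∘L Ring.inverse a = ContinuousLinearMap.id ℂ X := Ring.mul_inverse_cancel a ha
  have hb' : Ring.inverse b ∘L b = ContinuousLinearMap.id ℂ Y := Ring.inverse_mul_cancel b hb
  rw [ContinuousLinearMap.comp_assoc, ContinuousLinearMap.comp_assoc, ha',
    ContinuousLinearMap.comp_id, ← ContinuousLinearMap.comp_assoc, hb',
    ContinuousLinearMap.id_comp] at h1
  exact h1

theorem comp_list_prod {κ : Type*} (J : X →L[ℂ] Y) (a : κ → X →L[ℂ] X) (b : κ → Y →L[ℂ] Y)
    (h : ∀ k, J ∘L a k = b k ∘L J) (l : List κ) : J ∘L (l.map a).prod = (l.map b).prod ∘L J := by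
  induction l with
  | nil => rfl
  | cons k l ih =>
    rw [List.map_cons, List.map_cons, List.prod_cons, List.prod_cons, ContinuousLinearMap.mul_def,
      ContinuousLinearMap.mul_def, ← ContinuousLinearMap.comp_assoc, h k,
      ContinuousLinearMap.comp_assoc, ih, ContinuousLinearMap.comp_assoc]

/-- A bounded operator which intertwines the `a k` and the `b k` intertwines the observables. -/
theorem comp_obs [CompleteSpace X] [CompleteSpace Y] (h : IsContourData γ g) {a : Fin n → X →L[ℂ] X} {b : Fin n → Y →L[ℂ] Y}
    (ha : AvoidsSpectra γ a) (hb : AvoidsSpectra γ b) {J : X →L[ℂ] Y}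
    (hJ : ∀ k, J ∘L a k = b k ∘L J) : J ∘L obs γ g a = obs γ g b ∘L J := by
  have h1 := (ContinuousLinearMap.compL ℂ X X Y J).integral_comp_comm (integrableOn_obs h ha)
  have h2 := ((ContinuousLinearMap.compL ℂ X Y Y).flip J).integral_comp_comm (integrableOn_obs h hb)
  simp only [ContinuousLinearMap.compL_apply, ContinuousLinearMap.flip_apply] at h1 h2
  rw [obs, obs, ← h1, ← h2]
  refine setIntegral_congr_fun measurableSet_Icc fun t ht => ?_
  simp only [ContinuousLinearMap.comp_smul, ContinuousLinearMap.smul_comp, List.ofFn_eq_map]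
  congr 1
  refine comp_list_prod J _ _ (fun k => ?_) _
  refine comp_inverse_of_comp_eq (ha.isUnit k (mem_Icc_apply ht k))
    (hb.isUnit k (mem_Icc_apply ht k)) ?_
  ext x
  have := congrArg (fun T : X →L[ℂ] Y => T x) (hJ k)
  simp only [ContinuousLinearMap.comp_apply] at this
  simp [Algebra.algebraMap_eq_smul_one, this]

end Intertwine

/-- Writing `b = a (1 - a⁻¹ (a - b))`, the perturbation has norm at most 1/2 and a Neumann series
inverts it. The resolvent identity then gives `‖b⁻¹‖ ≤ M + ‖b⁻¹‖ / 2`. -/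
theorem isUnit_of_norm_sub_le {𝔸 : Type*} [NormedRing 𝔸] [CompleteSpace 𝔸] {a b : 𝔸} {M : ℝ}
    (hM : 0 < M) (ha : IsUnit a) (haM : ‖Ring.inverse a‖ ≤ M) (hab : ‖b - a‖ ≤ (2 * M)⁻¹) :
    IsUnit b ∧ ‖Ring.inverse b‖ ≤ 2 * M := by
  set a' := Ring.inverse a with ha'
  have e1 : a * a' = 1 := Ring.mul_inverse_cancel a ha
  have hsmall : ‖a' * (a - b)‖ ≤ 1 / 2 := by
    refine (norm_mul_le _ _).trans ?_
    rw [norm_sub_rev]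
    calc ‖a'‖ * ‖b - a‖ ≤ M * (2 * M)⁻¹ := mul_le_mul haM hab (norm_nonneg _) hM.le
      _ = 1 / 2 := by field_simp
  have hb : IsUnit b := by
    have h1 : b = a * (1 - a' * (a - b)) := by
      rw [mul_sub, ← mul_assoc, e1]
      simp
    rw [h1]
    exact ha.mul (Units.oneSub _ (hsmall.trans_lt (by norm_num))).isUnit
  refine ⟨hb, ?_⟩
  set b' := Ring.inverse b with hb'
  have e2 : b * b' = 1 := Ring.mul_inverse_cancel b hb
  have e3 : a' * a = 1 := Ring.inverse_mul_cancel a ha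
  have h2 : b' = a' + a' * (a - b) * b' := by
    rw [mul_sub, sub_mul, e3, mul_assoc, e2]
    simp
  have h3 : ‖b'‖ ≤ M + 1 / 2 * ‖b'‖ := by
    nth_rewrite 1 [h2]
    refine (norm_add_le _ _).trans (add_le_add haM ((norm_mul_le _ _).trans ?_))
    exact mul_le_mul_of_nonneg_right hsmall (norm_nonneg _)
  linarith

theorem AvoidsSpectra.exists_norm_resolvent_le {𝔸 : Type*} [NormedRing 𝔸] [NormedAlgebra ℂ 𝔸]
    [CompleteSpace 𝔸] (h : IsContourData γ g) {a : Fin n → 𝔸} (ha : AvoidsSpectra γ a) :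
    ∃ M : ℝ, 0 < M ∧ ∀ k, ∀ t ∈ Set.Icc (0 : ℝ) 1, ‖resolvent (a k) (γ k t)‖ ≤ M := by
  have h1 : ∀ k, ∃ M : ℝ, ∀ t ∈ Set.Icc (0 : Fin n → ℝ) 1, ‖resolvent (a k) (γ k (t k))‖ ≤ M :=
    fun k => isCompact_Icc.exists_bound_of_continuousOn (continuousOn_resolvent h ha k)
  choose M hM using h1
  refine ⟨1 + ∑ k, |M k|, by positivity, fun k t ht => ?_⟩
  have := hM k (fun _ => t) ⟨fun _ => ht.1, fun _ => ht.2⟩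
  have h2 := Finset.single_le_sum (f := fun k => |M k|) (fun _ _ => abs_nonneg _) (Finset.mem_univ k)
  have h3 := le_abs_self (M k)
  linarith

end Obs

end

noncomputable section

/-! ### The fibre matrices over configuration space -/

theorem other_zero : other 0 = 1 := rfl

theorem other_one : other 1 = 0 := rfl

theorem eq_other_of_ne {i j : Fin 2} (h : i ≠ j) : j = other i := by
  revert i j; decide

/-- Matrix entries of a hopping operator: `intra j R x` is the amplitude of the hop by `R` in
layer `j` at the point `x`, and `inter i j _ x` the amplitude between the layers. -/
structure HopData (𝒜 : Fin 2 → Type u) where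
  intra : ∀ j, Plane → Plane → Matrix (𝒜 j) (𝒜 j) ℂ
  inter : ∀ i j, i ≠ j → Plane → Matrix (𝒜 i) (𝒜 j) ℂ

variable {𝒜 : Fin 2 → Type u}

/-- Periodicity, rapid decay and uniform continuity of the matrix entries. -/
structure HopData.IsGood (L : Fin 2 → Matrix (Fin 2) (Fin 2) ℝ) (D : HopData 𝒜) : Prop where
  periodic : ∀ j, ∀ R ∈ lattice (L j), ∀ K ∈ lattice (L (other j)), ∀ x,
    D.intra j R (x + K) = D.intra j R x
  intra_decay : ∀ N, ∃ C : ℝ, 0 ≤ C ∧ ∀ j, ∀ R ∈ lattice (L j), ∀ x α β,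
    ‖D.intra j R x α β‖ ≤ C * dec N R
  inter_decay : ∀ N, ∃ C : ℝ, 0 ≤ C ∧ ∀ i j hij x α β, ‖D.inter i j hij x α β‖ ≤ C * dec N x
  intra_unif : ∀ ε > (0 : ℝ), ∃ δ > (0 : ℝ), ∀ x x', ‖x - x'‖ < δ → ∀ j, ∀ R ∈ lattice (L j),
    ∀ α β, ‖D.intra j R x α β - D.intra j R x' α β‖ ≤ ε
  inter_unif : ∀ ε > (0 : ℝ), ∃ δ > (0 : ℝ), ∀ x x', ‖x - x'‖ < δ → ∀ i j hij α β,
    ‖D.inter i j hij x α β - D.inter i j hij x' α β‖ ≤ ε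

/-- The orientation of the layers with respect to each other. -/
def lsign (s : ℝ) (j : Fin 2) : ℝ := if j = 0 then 1 else s

@[simp] theorem lsign_zero (s : ℝ) : lsign s 0 = 1 := rfl

@[simp] theorem lsign_one (s : ℝ) : lsign s 1 = s := rfl

theorem lsign_sq {s : ℝ} (hs : s ^ 2 = 1) (j : Fin 2) : lsign s j * lsign s j = 1 := by
  fin_cases j
  · simp
  · simpa [sq] using hs

theorem lsign_other {s : ℝ} (hs : s ^ 2 = 1) (j : Fin 2) : lsign s (other j) = s * lsign s j := by
  fin_cases j
  · simp [other_zero]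
  · simpa [other_one, sq] using hs.symm

theorem norm_sign_smul {s : ℝ} (hs : s ^ 2 = 1) (x : Plane) : ‖s • x‖ = ‖x‖ := by
  have h : |s| = 1 := by
    rw [← sq_abs] at hs
    exact (pow_eq_one_iff_of_nonneg (abs_nonneg s) two_ne_zero).1 hs
  rw [norm_smul, Real.norm_eq_abs, h, one_mul]

variable {L : Fin 2 → Matrix (Fin 2) (Fin 2) ℝ} {s : ℝ} {D : HopData 𝒜}

/-- The fibre matrix at the point `y` of configuration space. -/
def fiberKer (L : Fin 2 → Matrix (Fin 2) (Fin 2) ℝ) (s : ℝ) (D : HopData 𝒜) (y : Plane)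
    (p q : Sites L 𝒜) : ℂ :=
  if h : q.1 = p.1 then
    D.intra p.1 (p.2.1 - q.2.1) (lsign s p.1 • y + p.2.1) p.2.2 (h ▸ q.2.2)
  else D.inter p.1 q.1 (Ne.symm h) (lsign s p.1 • y + p.2.1 + s • (q.2.1 : Plane)) p.2.2 q.2.2

theorem fiberKer_same (y : Plane) (j : Fin 2) (R R' : lattice (L j)) (α β : 𝒜 j) :
    fiberKer L s D y ⟨j, (R, α)⟩ ⟨j, (R', β)⟩ = D.intra j (R - R') (lsign s j • y + R) α β := by
  simp [fiberKer]

theorem fiberKer_ne (y : Plane) {i j : Fin 2} (h : i ≠ j) (R : lattice (L i)) (R' : lattice (L j))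
    (α : 𝒜 i) (β : 𝒜 j) : fiberKer L s D y ⟨i, (R, α)⟩ ⟨j, (R', β)⟩ =
      D.inter i j h (lsign s i • y + R + s • (R' : Plane)) α β := by
  simp [fiberKer, Ne.symm h]

/-- The position of a site in the bilayer with configuration `y`. -/
def sitePos (s : ℝ) (y : Plane) (p : Sites L 𝒜) : Plane :=
  if p.1 = 0 then y + p.2.1 else -(s • (p.2.1 : Plane))

@[simp] theorem sitePos_zero (y : Plane) (R : lattice (L 0)) (α : 𝒜 0) :
    sitePos s y (⟨0, (R, α)⟩ : Sites L 𝒜) = y + R := rfl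

@[simp] theorem sitePos_one (y : Plane) (R : lattice (L 1)) (α : 𝒜 1) :
    sitePos s y (⟨1, (R, α)⟩ : Sites L 𝒜) = -(s • (R : Plane)) := rfl

theorem dec_congr_norm {N : ℕ} {x x' : Plane} (h : ‖x‖ = ‖x'‖) : dec N x = dec N x' := by
  rw [dec, dec, h]

/-- `sitePos` is arranged so that in all four blocks the hopping vector has the norm of the
difference of the positions: layer 0 sits at `y + R` and layer 1 at `-(s • R)`. Decay of the
amplitudes thus becomes off-diagonal decay. -/
theorem norm_fiberKer_le (hs : s ^ 2 = 1) (hD : D.IsGood L) (N : ℕ) :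
    ∃ C : ℝ, 0 ≤ C ∧ ∀ y (p q : Sites L 𝒜),
      ‖fiberKer L s D y p q‖ ≤ C * dec N (sitePos s y p - sitePos s y q) := by
  obtain ⟨C, hC0, hC⟩ := hD.intra_decay N
  obtain ⟨C', hC'0, hC'⟩ := hD.inter_decay N
  refine ⟨max C C', le_max_of_le_left hC0, ?_⟩
  rintro y ⟨i, R, α⟩ ⟨j, R', β⟩
  by_cases h : i = j
  · subst h
    rw [fiberKer_same]
    refine (hC i _ (sub_mem R.2 R'.2) _ _ _).trans ?_
    refine mul_le_mul (le_max_left _ _) (le_of_eq (dec_congr_norm ?_)) (dec_nonneg _ _)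
      (le_max_of_le_left hC0)
    revert R R' α β
    fin_cases i
    · intro R α R' β
      simp
    · intro R α R' β
      simp only [Fin.mk_one, sitePos_one]
      rw [← norm_sign_smul hs, ← norm_neg, smul_sub]
      congr 1
      abel
  · rw [fiberKer_ne _ h]
    refine (hC' i j h _ _ _).trans ?_
    refine mul_le_mul (le_max_right _ _) (le_of_eq (dec_congr_norm ?_)) (dec_nonneg _ _)
      (le_max_of_le_left hC0)
    have hj := eq_other_of_ne h
    subst hj
    revert R R' α β h
    fin_cases i
    · intro R α R' β h
      change ‖lsign s 0 • y + R + s • (R' : Plane)‖ = ‖y + (R : Plane) - -(s • (R' : Plane))‖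
      rw [lsign_zero, one_smul, sub_neg_eq_add]
    · intro R α R' β h
      change ‖lsign s 1 • y + R + s • (R' : Plane)‖ = ‖-(s • (R : Plane)) - (y + (R' : Plane))‖
      rw [lsign_one, ← norm_sign_smul hs, ← norm_neg, smul_add, smul_add, smul_smul, smul_smul, ← sq,
        hs, one_smul, one_smul]
      congr 1
      abel

theorem exists_tsum_sites_le [∀ j, Fintype (𝒜 j)] (hL : ∀ j, (L j).det ≠ 0) :
    ∃ S : ℝ, 0 < S ∧ ∀ u : Sites L 𝒜 → ℝ,
      (∀ j, ∃ x : Plane, ∀ R α, u ⟨j, (R, α)⟩ = dec 3 (x + R)) → Summable u ∧ ∑' p, u p ≤ S := by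
  choose C hC0 hC using fun j => exists_tsum_dec_le (hL j)
  refine ⟨1 + ∑ j, Fintype.card (𝒜 j) * C j, by
    have : 0 ≤ ∑ j, Fintype.card (𝒜 j) * C j :=
      Finset.sum_nonneg fun j _ => mul_nonneg (Nat.cast_nonneg _) (hC0 j).le
    linarith, fun u hu => ?_⟩
  choose x hx using hu
  have hu0 : 0 ≤ u := fun ⟨j, R, α⟩ => by rw [hx]; exact dec_nonneg _ _
  have h1 : ∀ j, Summable fun a : lattice (L j) × 𝒜 j => u ⟨j, a⟩ := fun j => by
    have := ((hC j (x j)).1).mul_of_nonneg (Summable.of_finite (f := fun _ : 𝒜 j => (1 : ℝ)))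
      (fun R => dec_nonneg _ _) (fun _ => zero_le_one)
    refine this.congr fun a => ?_
    rw [mul_one, ← hx j a.1 a.2]
  have h2 : ∀ j, ∑' a : lattice (L j) × 𝒜 j, u ⟨j, a⟩ ≤ Fintype.card (𝒜 j) * C j := fun j => by
    rw [(h1 j).tsum_prod' fun R => Summable.of_finite]
    simp only [hx, tsum_fintype, Finset.sum_const, Finset.card_univ, nsmul_eq_mul, tsum_mul_left]
    exact mul_le_mul_of_nonneg_left (hC j (x j)).2 (Nat.cast_nonneg _)
  have h3 : Summable u := (summable_sigma_of_nonneg fun p => hu0 p).2 ⟨h1, Summable.of_finite⟩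
  refine ⟨h3, ?_⟩
  rw [h3.tsum_sigma' h1, tsum_fintype]
  have := Finset.sum_le_sum (s := Finset.univ) fun j _ => h2 j
  linarith

/-- The Schur test for kernels which are bounded by the weight of the distance of the sites. -/
theorem exists_schurBound [∀ j, Fintype (𝒜 j)] (hL : ∀ j, (L j).det ≠ 0) (hs : s ^ 2 = 1) :
    ∃ S : ℝ, 0 < S ∧ ∀ (y : Plane) (k : Sites L 𝒜 → Sites L 𝒜 → ℂ) (C : ℝ), 0 ≤ C →
      (∀ p q, ‖k p q‖ ≤ C * dec 3 (sitePos s y p - sitePos s y q)) → SchurBound k (C * S) := by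
  obtain ⟨S, hS0, hS⟩ := exists_tsum_sites_le (𝒜 := 𝒜) hL
  refine ⟨S, hS0, fun y k C hC hk => ?_⟩
  have key : ∀ x : Plane, Summable (fun q : Sites L 𝒜 => dec 3 (x - sitePos s y q)) ∧
      ∑' q : Sites L 𝒜, dec 3 (x - sitePos s y q) ≤ S := by
    intro x
    refine hS _ fun j => ?_
    fin_cases j
    · refine ⟨y - x, fun R α => ?_⟩
      change dec 3 (x - (y + R)) = dec 3 (y - x + R)
      rw [← dec_neg]
      congr 1
      abel
    · refine ⟨s • x, fun R α => ?_⟩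
      change dec 3 (x - -(s • (R : Plane))) = dec 3 (s • x + R)
      refine dec_congr_norm ?_
      rw [sub_neg_eq_add, ← norm_sign_smul hs, smul_add, smul_smul, ← sq, hs, one_smul]
  refine SchurBound.of_le (mul_nonneg hC hS0.le) hk (fun p => ?_) fun q => ?_
  · refine ⟨(key _).1.mul_left C, ?_⟩
    rw [tsum_mul_left]
    exact mul_le_mul_of_nonneg_left (key _).2 hC
  · have e : ∀ p : Sites L 𝒜, dec 3 (sitePos s y p - sitePos s y q) =
        dec 3 (sitePos s y q - sitePos s y p) := fun p => by
      rw [← dec_neg, neg_sub]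
    simp only [e]
    refine ⟨(key _).1.mul_left C, ?_⟩
    rw [tsum_mul_left]
    exact mul_le_mul_of_nonneg_left (key _).2 hC

/-! ### Weights -/

/-- The weight `1 + ε |R|` of a site. -/
def siteWt (ε : ℝ) (p : Sites L 𝒜) : ℝ := 1 + ε * ‖(p.2.1 : Plane)‖

theorem one_le_siteWt {ε : ℝ} (hε : 0 ≤ ε) (p : Sites L 𝒜) : 1 ≤ siteWt ε p := by
  unfold siteWt
  have := mul_nonneg hε (norm_nonneg (p.2.1 : Plane))
  linarith

theorem siteWt_pos {ε : ℝ} (hε : 0 ≤ ε) (p : Sites L 𝒜) : 0 < siteWt ε p :=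
  zero_lt_one.trans_le (one_le_siteWt hε p)

/-- The ratio of the weights of two sites. -/
def wtRatio (ε : ℝ) (p q : Sites L 𝒜) : ℝ := (siteWt ε q / siteWt ε p) ^ 3

/-- The conjugated fibre matrix. -/
def wtKer (L : Fin 2 → Matrix (Fin 2) (Fin 2) ℝ) (s : ℝ) (D : HopData 𝒜) (ε : ℝ) (y : Plane)
    (p q : Sites L 𝒜) : ℂ := fiberKer L s D y p q * (wtRatio ε p q : ℂ)

theorem wtKer_zero (y : Plane) : wtKer L s D 0 y = fiberKer L s D y := by
  funext p q
  simp [wtKer, wtRatio, siteWt]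

/-- Position and lattice vector of a site differ in norm by at most `‖y‖`, so the
position-independent weights are compatible with the distance of positions for bounded `y`. -/
theorem norm_site_sub_le (hs : s ^ 2 = 1) {ρ : ℝ} {y : Plane} (hy : ‖y‖ ≤ ρ) (p q : Sites L 𝒜) :
    ‖(q.2.1 : Plane)‖ - ‖(p.2.1 : Plane)‖ ≤ ‖sitePos s y p - sitePos s y q‖ + 2 * ρ := by
  have key : ∀ p : Sites L 𝒜, |‖(p.2.1 : Plane)‖ - ‖sitePos s y p‖| ≤ ρ := by
    rintro ⟨j, R, α⟩
    revert R α
    have hρ := (norm_nonneg y).trans hy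
    fin_cases j
    · intro R α
      change |‖(R : Plane)‖ - ‖y + (R : Plane)‖| ≤ ρ
      have := abs_norm_sub_norm_le (R : Plane) (y + R)
      rw [show (R : Plane) - (y + R) = -y by abel, norm_neg] at this
      exact this.trans hy
    · intro R α
      change |‖(R : Plane)‖ - ‖-(s • (R : Plane))‖| ≤ ρ
      rw [norm_neg, norm_sign_smul hs, sub_self, abs_zero]
      exact hρ
  have h1 := abs_le.1 (key p)
  have h2 := abs_le.1 (key q)
  have h3 := norm_sub_norm_le (sitePos s y q) (sitePos s y p)
  rw [norm_sub_rev] at h3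
  linarith [h1.1, h2.2]

theorem wtRatio_nonneg {ε : ℝ} (hε : 0 ≤ ε) (p q : Sites L 𝒜) : 0 ≤ wtRatio ε p q := by
  have := (siteWt_pos hε p).le
  have := (siteWt_pos hε q).le
  unfold wtRatio
  positivity

theorem siteWt_div_le (hs : s ^ 2 = 1) {ε ρ : ℝ} (hε : 0 ≤ ε) {y : Plane} (hy : ‖y‖ ≤ ρ)
    (p q : Sites L 𝒜) : siteWt ε q / siteWt ε p ≤
      1 + ε * (‖sitePos s y p - sitePos s y q‖ + 2 * ρ) := by
  have hρ := (norm_nonneg y).trans hy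
  rw [div_le_iff₀ (siteWt_pos hε p)]
  have h1 := norm_site_sub_le hs hy p q
  set t := ‖sitePos s y p - sitePos s y q‖ + 2 * ρ with ht
  have ht0 : 0 ≤ t := by positivity
  have h2 := one_le_siteWt hε p
  have h3 : siteWt ε q ≤ siteWt ε p + ε * t := by
    unfold siteWt
    nlinarith
  nlinarith [mul_nonneg hε ht0]

/-- Conjugation by the weights changes an entry by a factor within `ε` times a cubic polynomial of
the distance. Rapid decay of the kernel absorbs the polynomial. -/
theorem wtRatio_sub_one_le (hs : s ^ 2 = 1) {ε ρ : ℝ} (hε : 0 ≤ ε) (hε1 : ε ≤ 1) {y : Plane}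
    (hy : ‖y‖ ≤ ρ) (p q : Sites L 𝒜) : |wtRatio ε p q - 1| ≤
      ε * ((1 + 2 * ρ) ^ 3 * (1 + ‖sitePos s y p - sitePos s y q‖) ^ 3) := by
  have hρ := (norm_nonneg y).trans hy
  have h1 := siteWt_div_le hs hε hy p q
  have h2 := siteWt_div_le hs hε hy q p
  rw [norm_sub_rev] at h2
  set d := ‖sitePos s y p - sitePos s y q‖ with hd
  have hd0 : 0 ≤ d := norm_nonneg _
  set x := siteWt ε q / siteWt ε p with hx
  have hx0 : 0 < x := div_pos (siteWt_pos hε q) (siteWt_pos hε p)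
  have hxi : siteWt ε p / siteWt ε q = x⁻¹ := by rw [hx, inv_div]
  rw [hxi] at h2
  set t := d + 2 * ρ with ht
  have ht0 : 0 ≤ t := by positivity
  have hu : (1 + ε * t) ^ 3 - 1 ≤ ε * (1 + t) ^ 3 := by
    have e2 : ε ^ 2 ≤ ε := by nlinarith
    have e3 : ε ^ 3 ≤ ε := by nlinarith
    have := mul_le_mul_of_nonneg_right e2 (sq_nonneg t)
    have := mul_le_mul_of_nonneg_right e3 (pow_nonneg ht0 3)
    nlinarith
  have hv : (1 + t) ^ 3 ≤ (1 + 2 * ρ) ^ 3 * (1 + d) ^ 3 := by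
    rw [← mul_pow]
    refine pow_le_pow_left₀ (by positivity) ?_ 3
    nlinarith [mul_nonneg hρ hd0]
  -- The lower bound comes from the inverse ratio: for positive `a`, `b` with `a b = 1` one has `a +
  -- b ≥ 2`, that is `1 - a ≤ b - 1`.
  have hw : |x ^ 3 - 1| ≤ (1 + ε * t) ^ 3 - 1 := by
    have hb1 : (1 : ℝ) ≤ 1 + ε * t := by nlinarith [mul_nonneg hε ht0]
    have hx3 : x ^ 3 ≤ (1 + ε * t) ^ 3 := pow_le_pow_left₀ hx0.le h1 3
    have hx3' : (x⁻¹) ^ 3 ≤ (1 + ε * t) ^ 3 := pow_le_pow_left₀ (by positivity) h2 3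
    rw [abs_le]
    refine ⟨?_, by linarith⟩
    have hz : x ^ 3 * (x⁻¹) ^ 3 = 1 := by rw [← mul_pow, mul_inv_cancel₀ hx0.ne', one_pow]
    have hz0 : 0 < x ^ 3 := by positivity
    set a := x ^ 3
    set b := (x⁻¹) ^ 3
    have hb0 : 0 < b := by positivity
    nlinarith [sq_nonneg (a - 1), sq_nonneg (b - 1)]
  calc _ ≤ (1 + ε * t) ^ 3 - 1 := hw
    _ ≤ ε * (1 + t) ^ 3 := hu
    _ ≤ _ := mul_le_mul_of_nonneg_left hv hε

theorem wtRatio_le (hs : s ^ 2 = 1) {ε ρ : ℝ} (hε : 0 ≤ ε) (hε1 : ε ≤ 1) {y : Plane}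
    (hy : ‖y‖ ≤ ρ) (p q : Sites L 𝒜) : wtRatio ε p q ≤
      2 * (1 + 2 * ρ) ^ 3 * (1 + ‖sitePos s y p - sitePos s y q‖) ^ 3 := by
  have hρ := (norm_nonneg y).trans hy
  have h1 := (le_abs_self _).trans (wtRatio_sub_one_le hs hε hε1 hy p q)
  set d := ‖sitePos s y p - sitePos s y q‖ with hd
  have hd0 : 0 ≤ d := norm_nonneg _
  have h2 : (1 : ℝ) ≤ (1 + 2 * ρ) ^ 3 * (1 + d) ^ 3 := by
    refine one_le_mul_of_one_le_of_one_le (one_le_pow₀ (by linarith)) (one_le_pow₀ (by linarith))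
  nlinarith [mul_le_mul_of_nonneg_right hε1 (zero_le_one.trans h2)]

theorem dec_add_mul_pow (N M : ℕ) (x : Plane) : dec (N + M) x * (1 + ‖x‖) ^ M = dec N x := by
  rw [← dec_mul, mul_assoc, dec_mul_pow, mul_one]

/-- Of the six orders of decay used, three pay for the ratio of the weights and three are left for
summability. -/
theorem norm_wtKer_le (hs : s ^ 2 = 1) (hD : D.IsGood L) (ρ : ℝ) :
    ∃ C : ℝ, 0 ≤ C ∧ ∀ ε : ℝ, 0 ≤ ε → ε ≤ 1 → ∀ y : Plane, ‖y‖ ≤ ρ → ∀ p q : Sites L 𝒜,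
      ‖wtKer L s D ε y p q‖ ≤ C * dec 3 (sitePos s y p - sitePos s y q) ∧
      ‖wtKer L s D ε y p q - fiberKer L s D y p q‖ ≤
        ε * C * dec 3 (sitePos s y p - sitePos s y q) := by
  obtain ⟨C, hC0, hC⟩ := norm_fiberKer_le hs hD (3 + 3)
  refine ⟨C * (2 * (1 + 2 * |ρ|) ^ 3), by positivity, fun ε hε hε1 y hy p q => ?_⟩
  have hρ : |ρ| = ρ := abs_of_nonneg ((norm_nonneg y).trans hy)
  have hρ0 : 0 ≤ ρ := (norm_nonneg y).trans hy
  rw [hρ]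
  have e := dec_add_mul_pow 3 3 (sitePos s y p - sitePos s y q)
  have hdec := dec_nonneg (3 + 3) (sitePos s y p - sitePos s y q)
  constructor
  · rw [wtKer, norm_mul, Complex.norm_real, Real.norm_of_nonneg (wtRatio_nonneg hε p q)]
    refine (mul_le_mul (hC y p q) (wtRatio_le hs hε hε1 hy p q) (wtRatio_nonneg hε p q)
      (mul_nonneg hC0 hdec)).trans (le_of_eq ?_)
    rw [← e]
    ring
  · have : wtKer L s D ε y p q - fiberKer L s D y p q =
        fiberKer L s D y p q * ((wtRatio ε p q - 1 : ℝ) : ℂ) := by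
      rw [wtKer]
      push_cast
      ring
    rw [this, norm_mul, Complex.norm_real, Real.norm_eq_abs]
    refine (mul_le_mul (hC y p q) (wtRatio_sub_one_le hs hε hε1 hy p q) (abs_nonneg _)
      (mul_nonneg hC0 hdec)).trans ?_
    rw [← e]
    have : 0 ≤ C * dec (3 + 3) (sitePos s y p - sitePos s y q) * (ε * ((1 + 2 * ρ) ^ 3 *
      (1 + ‖sitePos s y p - sitePos s y q‖) ^ 3)) := by positivity
    linarith

/-- The constant is uniform in `ε`, so for small `ε` the conjugated operators stay close enough to
the fibre operators to keep their resolvents. -/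
theorem exists_schurBound_wtKer [∀ j, Fintype (𝒜 j)] (hL : ∀ j, (L j).det ≠ 0) (hs : s ^ 2 = 1)
    (hD : D.IsGood L) (ρ : ℝ) :
    ∃ C : ℝ, 0 ≤ C ∧ ∀ ε : ℝ, 0 ≤ ε → ε ≤ 1 → ∀ y : Plane, ‖y‖ ≤ ρ →
      SchurBound (wtKer L s D ε y) C ∧
      ‖kerOp (wtKer L s D ε y) - kerOp (fiberKer L s D y)‖ ≤ ε * C := by
  obtain ⟨C, hC0, hC⟩ := norm_wtKer_le hs hD ρ
  obtain ⟨S, hS0, hS⟩ := exists_schurBound (𝒜 := 𝒜) hL hs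
  have h1 : ∀ ε : ℝ, 0 ≤ ε → ε ≤ 1 → ∀ y : Plane, ‖y‖ ≤ ρ →
      SchurBound (wtKer L s D ε y) (C * S) := fun ε hε hε1 y hy =>
    hS y _ C hC0 fun p q => (hC ε hε hε1 y hy p q).1
  refine ⟨C * S, by positivity, fun ε hε hε1 y hy => ⟨h1 ε hε hε1 y hy, ?_⟩⟩
  have h2 := h1 0 le_rfl zero_le_one y hy
  rw [wtKer_zero] at h2
  rw [← mul_assoc]
  exact (h1 ε hε hε1 y hy).norm_kerOp_sub_le h2
    (hS y _ (ε * C) (by positivity) fun p q => (hC ε hε hε1 y hy p q).2)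

theorem exists_schurBound_fiberKer [∀ j, Fintype (𝒜 j)] (hL : ∀ j, (L j).det ≠ 0) (hs : s ^ 2 = 1) (hD : D.IsGood L)
    (y : Plane) : ∃ C : ℝ, SchurBound (fiberKer L s D y) C := by
  obtain ⟨C, -, hC⟩ := exists_schurBound_wtKer hL hs hD ‖y‖
  refine ⟨C, ?_⟩
  rw [← wtKer_zero]
  exact (hC 0 le_rfl zero_le_one y le_rfl).1

theorem norm_fiberKer_sub_le (hs : s ^ 2 = 1) (hD : D.IsGood L) {η : ℝ} (hη : 0 < η) :
    ∃ δ > (0 : ℝ), ∀ y y', ‖y - y'‖ < δ → ∀ p q : Sites L 𝒜,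
      ‖fiberKer L s D y p q - fiberKer L s D y' p q‖ ≤ η := by
  obtain ⟨δ, hδ, h⟩ := hD.intra_unif η hη
  obtain ⟨δ', hδ', h'⟩ := hD.inter_unif η hη
  refine ⟨min δ δ', lt_min hδ hδ', fun y y' hy => ?_⟩
  have hl : ∀ j, ‖lsign s j • y - lsign s j • y'‖ < min δ δ' := fun j => by
    rw [← smul_sub, norm_sign_smul (by rw [sq, lsign_sq hs])]
    exact hy
  rintro ⟨i, R, α⟩ ⟨j, R', β⟩
  by_cases hij : i = j
  · subst hij
    rw [fiberKer_same, fiberKer_same]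
    refine h _ _ ?_ i _ (sub_mem R.2 R'.2) _ _
    rw [add_sub_add_right_eq_sub]
    exact (hl i).trans_le (min_le_left _ _)
  · rw [fiberKer_ne _ hij, fiberKer_ne _ hij]
    refine h' _ _ ?_ i j hij _ _
    rw [add_sub_add_right_eq_sub, add_sub_add_right_eq_sub]
    exact (hl i).trans_le (min_le_right _ _)

theorem sitePos_sub_sitePos (y y' : Plane) (p q : Sites L 𝒜) :
    ∃ v : Plane, ‖v‖ ≤ ‖y - y'‖ ∧
      sitePos s y p - sitePos s y q = sitePos s y' p - sitePos s y' q + v := by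
  unfold sitePos
  by_cases hp : p.1 = 0 <;> by_cases hq : q.1 = 0
  · exact ⟨0, by simp, by simp only [if_pos hp, if_pos hq]; abel⟩
  · exact ⟨y - y', le_rfl, by simp only [if_pos hp, if_neg hq]; abel⟩
  · exact ⟨-(y - y'), by rw [norm_neg], by simp only [if_neg hp, if_pos hq]; abel⟩
  · exact ⟨0, by simp, by simp only [if_neg hp, if_neg hq]; abel⟩

/-- The difference of two kernels is uniformly small entrywise and also decays. The geometric mean
of the two bounds is small and still decays fast enough for the Schur test. -/
theorem continuousOn_wtKer [∀ j, Fintype (𝒜 j)] (hL : ∀ j, (L j).det ≠ 0) (hs : s ^ 2 = 1) (hD : D.IsGood L) (ρ : ℝ)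
    {ε : ℝ} (hε : 0 ≤ ε) (hε1 : ε ≤ 1) :
    ContinuousOn (fun y => kerOp (wtKer L s D ε y)) (Metric.closedBall 0 ρ) := by
  obtain ⟨S, hS0, hS⟩ := exists_schurBound (𝒜 := 𝒜) hL hs
  obtain ⟨C', -, hC'⟩ := exists_schurBound_wtKer hL hs hD ρ
  -- Order 12 becomes 6 after the square root: three orders for the weights, three for the sums.
  obtain ⟨C, hC0, hC⟩ := norm_fiberKer_le hs hD 12
  set Q := 2 * (1 + 2 * |ρ|) ^ 3 with hQ
  set P := C * (1 + 2 ^ 12) with hP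
  have hQ0 : 0 < Q := by positivity
  rw [Metric.continuousOn_iff]
  intro y hy ζ hζ
  -- Chosen so that the final operator bound equals `ζ / 2`. Since the bound is a geometric mean,
  -- the entries are required to be within `θ ^ 2`.
  set θ := ζ / (2 * (Q * S * (√P + 1))) with hθ
  have hθ0 : 0 < θ := by positivity
  obtain ⟨δ, hδ, hclose⟩ := norm_fiberKer_sub_le hs hD (pow_pos hθ0 2)
  refine ⟨min δ 1, lt_min hδ one_pos, fun y' hy' hyy' => ?_⟩
  rw [mem_closedBall_zero_iff] at hy hy'
  rw [dist_eq_norm] at hyy' ⊢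
  have h1 : ‖y' - y‖ ≤ 1 := (hyy'.trans_le (min_le_right _ _)).le
  have h2 : ∀ p q : Sites L 𝒜, ‖fiberKer L s D y' p q - fiberKer L s D y p q‖ ≤ θ ^ 2 :=
    hclose y' y (hyy'.trans_le (min_le_left _ _))
  have h3 : ∀ p q : Sites L 𝒜, ‖fiberKer L s D y' p q - fiberKer L s D y p q‖ ≤
      P * dec 12 (sitePos s y' p - sitePos s y' q) := by
    intro p q
    refine (norm_sub_le _ _).trans ((add_le_add (hC y' p q) (hC y p q)).trans ?_)
    obtain ⟨v, hv, e⟩ := sitePos_sub_sitePos (s := s) y' y p q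
    have h4 := dec_le_dec_add 12 (sitePos s y p - sitePos s y q) v
    rw [← e] at h4
    have h5 : (1 + ‖v‖) ^ 12 ≤ (2 : ℝ) ^ 12 :=
      pow_le_pow_left₀ (by positivity) (by linarith) _
    have hd := dec_nonneg 12 (sitePos s y' p - sitePos s y' q)
    have h6 := h4.trans (mul_le_mul_of_nonneg_left h5 hd)
    have := mul_le_mul_of_nonneg_left h6 hC0
    rw [hP]
    linarith
  have h4 : ∀ p q : Sites L 𝒜, ‖wtKer L s D ε y' p q - wtKer L s D ε y p q‖ ≤
      θ * √P * Q * dec 3 (sitePos s y' p - sitePos s y' q) := by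
    intro p q
    set z := ‖fiberKer L s D y' p q - fiberKer L s D y p q‖ with hz
    set d := sitePos s y' p - sitePos s y' q with hd
    have hz0 : 0 ≤ z := norm_nonneg _
    have h5 : z ≤ θ * √P * dec 6 d := by
      have h6 : z ^ 2 ≤ (θ * √P * dec 6 d) ^ 2 := by
        have : (θ * √P * dec 6 d) ^ 2 = θ ^ 2 * (P * dec 12 d) := by
          rw [mul_pow, mul_pow, Real.sq_sqrt (by positivity), sq (dec 6 d), dec_mul]
          ring
        rw [this, sq]
        exact mul_le_mul (h2 p q) (h3 p q) hz0 (by positivity)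
      exact (sq_le_sq₀ hz0 (mul_nonneg (by positivity) (dec_nonneg _ _))).1 h6
    have h7 : wtRatio ε p q ≤ Q * (1 + ‖d‖) ^ 3 := by
      rw [hQ, abs_of_nonneg ((norm_nonneg y).trans hy)]
      exact wtRatio_le hs hε hε1 hy' p q
    rw [wtKer, wtKer, ← sub_mul, norm_mul, Complex.norm_real,
      Real.norm_of_nonneg (wtRatio_nonneg hε p q), ← hz]
    refine (mul_le_mul h5 h7 (wtRatio_nonneg hε p q)
      (mul_nonneg (by positivity) (dec_nonneg _ _))).trans (le_of_eq ?_)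
    rw [← dec_add_mul_pow 3 3 d]
    ring
  have h5 := ((hC' ε hε hε1 y' hy').1).norm_kerOp_sub_le (hC' ε hε hε1 y hy).1
    (hS y' _ (θ * √P * Q) (by positivity) h4)
  refine h5.trans_lt ?_
  have h6 : θ * √P * Q * S ≤ θ * (√P + 1) * Q * S := by
    gcongr
    linarith
  refine h6.trans_lt ?_
  have h7 : θ * (√P + 1) * Q * S = ζ / 2 := by
    rw [hθ]
    field_simp
  rw [h7]
  linarith

end

noncomputable section

/-! ### Permutation and multiplication operators -/

section Basic

variable {ι : Type*}

open Classical in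
/-- The operator `(U ψ)(p) = w p ψ(τ p)`. -/
def wtPermOp (τ : Equiv.Perm ι) (w : ι → ℂ) : Ell ι →L[ℂ] Ell ι :=
  kerOp fun p q => if q = τ p then w p else 0

theorem schurBound_wtPermOp [DecidableEq ι] (τ : Equiv.Perm ι) {w : ι → ℂ} (hw : ∀ p, ‖w p‖ ≤ 1) :
    SchurBound (fun p q => if q = τ p then w p else 0) 1 := by
  have hr : ∀ p, HasSum (fun q => ‖if q = τ p then w p else 0‖) ‖w p‖ := fun p => by
    convert hasSum_ite_eq (τ p) ‖w p‖ using 2 with q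
    split_ifs <;> simp
  have hc : ∀ q, HasSum (fun p => ‖if q = τ p then w p else 0‖) ‖w (τ.symm q)‖ := fun q => by
    convert hasSum_ite_eq (τ.symm q) ‖w (τ.symm q)‖ using 2 with p
    by_cases h : q = τ p
    · rw [if_pos h, if_pos (by rw [h, Equiv.symm_apply_apply]), h, Equiv.symm_apply_apply]
    · rw [if_neg h, if_neg (fun h' => h (by rw [h', Equiv.apply_symm_apply])), norm_zero]
  exact ⟨zero_le_one, fun p => (hr p).summable, fun p => (hr p).tsum_eq.trans_le (hw p),
    fun q => (hc q).summable, fun q => (hc q).tsum_eq.trans_le (hw _)⟩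

theorem wtPermOp_apply (τ : Equiv.Perm ι) {w : ι → ℂ} (hw : ∀ p, ‖w p‖ ≤ 1) (ψ : Ell ι) (p : ι) :
    wtPermOp τ w ψ p = w p * ψ (τ p) := by
  classical
  refine ((schurBound_wtPermOp τ hw).hasSum_kerOp ψ p).unique ?_
  convert hasSum_ite_eq (τ p) (w p * ψ (τ p)) using 2 with q
  split_ifs with h
  · rw [h]
  · rw [zero_mul]

theorem norm_wtPermOp_le (τ : Equiv.Perm ι) {w : ι → ℂ} (hw : ∀ p, ‖w p‖ ≤ 1) :
    ‖wtPermOp τ w‖ ≤ 1 := by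
  classical
  exact (schurBound_wtPermOp τ hw).norm_kerOp_le

/-- `V` is the inverse of `U`, so `b = U a V`, and conjugation by contractions does not increase the
norm of the inverse. -/
theorem isUnit_and_norm_le_of_conj {𝔸 : Type*} [NormedRing 𝔸] {U V a b : 𝔸} (hUV : U * V = 1)
    (hVU : V * U = 1) (hU : ‖U‖ ≤ 1) (hV : ‖V‖ ≤ 1) (h : U * a = b * U) {M : ℝ} (ha : IsUnit a)
    (haM : ‖Ring.inverse a‖ ≤ M) : IsUnit b ∧ ‖Ring.inverse b‖ ≤ M := by
  have e1 : a * Ring.inverse a = 1 := Ring.mul_inverse_cancel a ha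
  have e2 : Ring.inverse a * a = 1 := Ring.inverse_mul_cancel a ha
  have hb : b = U * a * V := by rw [h, mul_assoc, hUV, mul_one]
  let u : 𝔸ˣ := ⟨b, U * Ring.inverse a * V, by
    rw [hb]
    calc U * a * V * (U * Ring.inverse a * V) = U * a * (V * U) * Ring.inverse a * V := by
          simp only [mul_assoc]
      _ = 1 := by rw [hVU, mul_one, mul_assoc U, e1, mul_one, hUV], by
    rw [hb]
    calc U * Ring.inverse a * V * (U * a * V) = U * Ring.inverse a * (V * U) * a * V := by
          simp only [mul_assoc]
      _ = 1 := by rw [hVU, mul_one, mul_assoc U, e2, mul_one, hUV]⟩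
  have hu : (u : 𝔸) = b := rfl
  refine ⟨⟨u, hu⟩, ?_⟩
  rw [← hu, Ring.inverse_unit]
  change ‖U * Ring.inverse a * V‖ ≤ M
  have hM := (norm_nonneg _).trans haM
  calc ‖U * Ring.inverse a * V‖ ≤ ‖U‖ * ‖Ring.inverse a‖ * ‖V‖ :=
        (norm_mul_le _ _).trans (mul_le_mul_of_nonneg_right (norm_mul_le _ _) (norm_nonneg _))
    _ ≤ 1 * M * 1 := by gcongr
    _ = M := by ring

/-- The pointwise inverses form a continuous function because inversion is continuous on units; the
uniform bound `M` keeps it in the algebra. -/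
theorem isUnit_bcf {X 𝔸 : Type*} [TopologicalSpace X] [NormedRing 𝔸] [CompleteSpace 𝔸]
    (a : X →ᵇ 𝔸) {M : ℝ} (h : ∀ x, IsUnit (a x) ∧ ‖Ring.inverse (a x)‖ ≤ M) : IsUnit a := by
  have hc : Continuous fun x => Ring.inverse (a x) := by
    rw [continuous_iff_continuousAt]
    intro x
    obtain ⟨u, hu⟩ := (h x).1
    have := NormedRing.inverse_continuousAt u
    rw [hu] at this
    exact this.comp (f := a) a.continuous.continuousAt
  let b : X →ᵇ 𝔸 := BoundedContinuousFunction.ofNormedAddCommGroup _ hc M fun x => (h x).2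
  refine ⟨⟨a, b, ?_, ?_⟩, rfl⟩
  · ext x
    exact Ring.mul_inverse_cancel _ (h x).1
  · ext x
    exact Ring.inverse_mul_cancel _ (h x).1

theorem entry_eq [inst : DecidableEq ι] (T : Ell ι →L[ℂ] Ell ι) (p q : ι) :
    entry T p q = T (lp.single 2 q 1) p := by
  obtain rfl : inst = fun a b => Classical.propDecidable (a = b) := Subsingleton.elim _ _
  rfl

/-- Evaluation at a point, as a homomorphism of algebras. -/
def bcfEval {X : Type*} [TopologicalSpace X] (𝔸 : Type*) [NormedRing 𝔸] [NormedAlgebra ℂ 𝔸]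
    (x : X) : (X →ᵇ 𝔸) →ₐ[ℂ] 𝔸 where
  toFun f := f x
  map_one' := rfl
  map_mul' _ _ := rfl
  map_zero' := rfl
  map_add' _ _ := rfl
  commutes' _ := rfl

theorem continuous_bcfEval {X : Type*} [TopologicalSpace X] (𝔸 : Type*) [NormedRing 𝔸]
    [NormedAlgebra ℂ 𝔸] (x : X) : Continuous (bcfEval 𝔸 x) :=
  (BoundedContinuousFunction.evalCLM ℂ x).continuous

/-- The radial retraction of the plane to the disc of radius `ρ`. -/
def clampPt (ρ : ℝ) (y : Plane) : Plane := (max 1 (‖y‖ / ρ))⁻¹ • y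

theorem continuous_clampPt (ρ : ℝ) : Continuous (clampPt ρ) := by
  unfold clampPt
  refine Continuous.smul (Continuous.inv₀ (continuous_const.max (continuous_norm.div_const ρ))
    fun y => ?_) continuous_id
  exact (zero_lt_one.trans_le (le_max_left _ _)).ne'

theorem norm_clampPt_le {ρ : ℝ} (hρ : 0 < ρ) (y : Plane) : ‖clampPt ρ y‖ ≤ ρ := by
  have h : 0 < max 1 (‖y‖ / ρ) := zero_lt_one.trans_le (le_max_left _ _)
  rw [clampPt, norm_smul, norm_inv, Real.norm_of_nonneg h.le, inv_mul_le_iff₀ h]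
  have := le_max_right 1 (‖y‖ / ρ)
  rwa [div_le_iff₀ hρ] at this

theorem clampPt_of_norm_le {ρ : ℝ} (hρ : 0 < ρ) {y : Plane} (hy : ‖y‖ ≤ ρ) : clampPt ρ y = y := by
  rw [clampPt, max_eq_left ((div_le_one hρ).2 hy), inv_one, one_smul]

end Basic

/-! ### Covariance and resolvents of the fibre operators -/

variable {𝒜 : Fin 2 → Type u} {L : Fin 2 → Matrix (Fin 2) (Fin 2) ℝ} {s : ℝ}

theorem smul_mem_lattice (hs : s ^ 2 = 1) {B : Matrix (Fin 2) (Fin 2) ℝ} {R : Plane}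
    (hR : R ∈ lattice B) : s • R ∈ lattice B := by
  rcases (mul_self_eq_one_iff.1 ((sq s).symm.trans hs)) with rfl | rfl
  · simpa using hR
  · simpa using hR

/-- The translation of all layers by lattice vectors. -/
def shiftSites (R₀ : ∀ j, lattice (L j)) : Equiv.Perm (Sites L 𝒜) where
  toFun p := ⟨p.1, (p.2.1 + R₀ p.1, p.2.2)⟩
  invFun p := ⟨p.1, (p.2.1 - R₀ p.1, p.2.2)⟩
  left_inv := by rintro ⟨j, R, α⟩; simp
  right_inv := by rintro ⟨j, R, α⟩; simp

/-- The shift of the configuration that corresponds to a translation of the layers. -/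
def shiftPt (s : ℝ) (R₀ : ∀ j, lattice (L j)) : Plane := (R₀ 0 : Plane) + s • (R₀ 1 : Plane)

theorem lsign_smul_shiftPt (hs : s ^ 2 = 1) (R₀ : ∀ j, lattice (L j)) (i : Fin 2) :
    lsign s i • shiftPt s R₀ = (R₀ i : Plane) + s • (R₀ (other i) : Plane) := by
  fin_cases i
  · simp [shiftPt, other_zero]
  · simp [shiftPt, other_one, smul_smul, ← sq, hs, add_comm]

variable {D : HopData 𝒜}

/-- In the interlayer blocks the arguments coincide exactly. In the intralayer blocks the extra
displacement lies in the opposite lattice, under which the amplitudes are periodic. -/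
theorem fiberKer_shift (hs : s ^ 2 = 1) (hD : D.IsGood L) (R₀ : ∀ j, lattice (L j)) (y : Plane)
    (p q : Sites L 𝒜) : fiberKer L s D (y + shiftPt s R₀) p q =
      fiberKer L s D y (shiftSites R₀ p) (shiftSites R₀ q) := by
  obtain ⟨i, R, α⟩ := p
  obtain ⟨j, R', β⟩ := q
  simp only [shiftSites, Equiv.coe_fn_mk]
  by_cases h : i = j
  · subst h
    rw [fiberKer_same, fiberKer_same, smul_add, lsign_smul_shiftPt hs]
    have e1 : lsign s i • y + (((R₀ i : Plane)) + s • (R₀ (other i) : Plane)) + R =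
        lsign s i • y + ((R + R₀ i : lattice (L i)) : Plane) + s • (R₀ (other i) : Plane) := by
      push_cast
      abel
    have e2 : ((R + R₀ i : lattice (L i)) : Plane) - ((R' + R₀ i : lattice (L i)) : Plane) =
        (R : Plane) - R' := by
      push_cast
      abel
    rw [e1, e2, hD.periodic i _ (sub_mem R.2 R'.2) _ (smul_mem_lattice hs (R₀ (other i)).2)]
  · have hj := eq_other_of_ne h
    subst hj
    rw [fiberKer_ne _ h, fiberKer_ne _ h, smul_add, lsign_smul_shiftPt hs]
    congr 1
    push_cast
    rw [smul_add]
    abel_nf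

theorem norm_inv_siteWt_le {ε : ℝ} (hε : 0 ≤ ε) (p : Sites L 𝒜) :
    ‖(((siteWt ε p ^ 3)⁻¹ : ℝ) : ℂ)‖ ≤ 1 := by
  rw [Complex.norm_real, norm_inv, norm_pow, Real.norm_of_nonneg (siteWt_pos hε p).le]
  exact inv_le_one_of_one_le₀ (one_le_pow₀ (one_le_siteWt hε p))

variable [∀ j, Fintype (𝒜 j)]

/-- The fibre operator at the point `y` of configuration space. -/
def fiberOp (L : Fin 2 → Matrix (Fin 2) (Fin 2) ℝ) (s : ℝ) (D : HopData 𝒜) (y : Plane) :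
    SiteSpace L 𝒜 →L[ℂ] SiteSpace L 𝒜 := kerOp (fiberKer L s D y)

theorem hasSum_fiberOp (hL : ∀ j, (L j).det ≠ 0) (hs : s ^ 2 = 1) (hD : D.IsGood L) (y : Plane)
    (ψ : SiteSpace L 𝒜) (p : Sites L 𝒜) :
    HasSum (fun q => fiberKer L s D y p q * ψ q) (fiberOp L s D y ψ p) := by
  obtain ⟨C, hC⟩ := exists_schurBound_fiberKer hL hs hD y
  exact hC.hasSum_kerOp ψ p

theorem wtPermOp_comp_fiberOp (hL : ∀ j, (L j).det ≠ 0) (hs : s ^ 2 = 1) (hD : D.IsGood L)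
    (R₀ : ∀ j, lattice (L j)) (y : Plane) :
    wtPermOp (shiftSites R₀) (fun _ => 1) ∘L fiberOp L s D y =
      fiberOp L s D (y + shiftPt s R₀) ∘L wtPermOp (shiftSites R₀) (fun _ => 1) := by
  have hw : ∀ p : Sites L 𝒜, ‖(1 : ℂ)‖ ≤ 1 := fun _ => by simp
  ext ψ p
  simp only [ContinuousLinearMap.comp_apply]
  rw [wtPermOp_apply _ hw, one_mul]
  refine HasSum.unique ?_ (hasSum_fiberOp hL hs hD _ _ p)
  have h1 := hasSum_fiberOp hL hs hD y ψ (shiftSites R₀ p)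
  rw [← (shiftSites (𝒜 := 𝒜) R₀).hasSum_iff] at h1
  convert h1 using 2 with q
  rw [fiberKer_shift hs hD, wtPermOp_apply _ hw, one_mul]
  rfl

theorem wtPermOp_mul_inv {ι : Type*} (τ : Equiv.Perm ι) :
    wtPermOp τ (fun _ => 1) * wtPermOp τ.symm (fun _ => 1) = 1 := by
  have hw : ∀ _ : ι, ‖(1 : ℂ)‖ ≤ 1 := fun _ => by simp
  ext ψ p
  change wtPermOp τ (fun _ => 1) (wtPermOp τ.symm (fun _ => 1) ψ) p = ψ p
  rw [wtPermOp_apply _ hw, wtPermOp_apply _ hw]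
  simp

theorem continuous_fiberOp (hL : ∀ j, (L j).det ≠ 0) (hs : s ^ 2 = 1) (hD : D.IsGood L) :
    Continuous (fiberOp L s D) := by
  rw [continuous_iff_continuousAt]
  intro y
  have h := continuousOn_wtKer (𝒜 := 𝒜) hL hs hD (‖y‖ + 1) le_rfl zero_le_one
  simp only [wtKer_zero] at h
  refine h.continuousAt (Filter.mem_of_superset (Metric.ball_mem_nhds y one_pos) fun z hz => ?_)
  rw [Metric.mem_ball, dist_eq_norm] at hz
  rw [mem_closedBall_zero_iff]
  have := norm_add_le (z - y) y
  rw [sub_add_cancel] at this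
  linarith

/-- By covariance the fibre at a sum of lattice vectors is conjugate to the fibre at 0 and inherits
its resolvent bound. Such sums are dense and `fiberOp` is norm continuous, so a Neumann series
reaches every `y` at the cost of a factor 2. -/
theorem isUnit_fiberOp (hL : ∀ j, (L j).det ≠ 0) (hs : s ^ 2 = 1) (hD : D.IsGood L)
    (hinc : lattice (recip (L 0)) ⊓ lattice (recip (L 1)) = ⊥) {z : ℂ} {M : ℝ} (hM : 0 < M)
    (h0 : IsUnit (algebraMap ℂ _ z - fiberOp L s D 0))
    (h0M : ‖Ring.inverse (algebraMap ℂ _ z - fiberOp L s D 0)‖ ≤ M) (y : Plane) :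
    IsUnit (algebraMap ℂ _ z - fiberOp L s D y) ∧
      ‖Ring.inverse (algebraMap ℂ _ z - fiberOp L s D y)‖ ≤ 2 * M := by
  have hw : ∀ p : Sites L 𝒜, ‖(1 : ℂ)‖ ≤ 1 := fun _ => by simp
  obtain ⟨δ, hδ, hclose⟩ := Metric.continuous_iff.1 (continuous_fiberOp hL hs hD) y (2 * M)⁻¹
    (by positivity)
  obtain ⟨R, hR, K, hK, hRK⟩ := exists_lattice_near (hL 0) (hL 1) hinc y hδ
  -- The component in layer 1 is `s • K`, since `shiftPt` multiplies it by `s` once more and `s ^ 2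
  -- = 1`.
  let R₀ : ∀ j, lattice (L j) := fun j =>
    if h : j = 0 then ⟨R, h ▸ hR⟩ else ⟨s • K, (eq_other_of_ne (Ne.symm h)) ▸ smul_mem_lattice hs hK⟩
  have hR₀ : shiftPt s R₀ = R + K := by
    simp [shiftPt, R₀, smul_smul, ← sq, hs]
  have hcov := wtPermOp_comp_fiberOp hL hs hD R₀ 0
  rw [zero_add, hR₀] at hcov
  have h1 := isUnit_and_norm_le_of_conj (𝔸 := SiteSpace L 𝒜 →L[ℂ] SiteSpace L 𝒜)
    (wtPermOp_mul_inv (shiftSites (𝒜 := 𝒜) R₀)) (wtPermOp_mul_inv (shiftSites (𝒜 := 𝒜) R₀).symm)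
    (norm_wtPermOp_le _ hw) (norm_wtPermOp_le _ hw)
    (b := algebraMap ℂ _ z - fiberOp L s D (R + K)) (by
      rw [mul_sub, sub_mul, Algebra.commutes]
      congr 1) h0 h0M
  refine isUnit_of_norm_sub_le hM h1.1 h1.2 ?_
  rw [sub_sub_sub_cancel_left, ← dist_eq_norm]
  refine (hclose _ ?_).le
  rwa [dist_eq_norm]

/-! ### Observables of the fibre operators: covariance, continuity and decay. -/

section Observables

variable {n : ℕ} {γ : Fin n → ℝ → ℂ} {g : (Fin n → ℂ) → ℂ} {D : Fin n → HopData 𝒜}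

theorem exists_isUnit_fiberOp (hL : ∀ j, (L j).det ≠ 0) (hs : s ^ 2 = 1) (hD : ∀ k, (D k).IsGood L)
    (hinc : lattice (recip (L 0)) ⊓ lattice (recip (L 1)) = ⊥) (hγ : IsContourData γ g)
    (h0 : AvoidsSpectra γ fun k => fiberOp L s (D k) 0) :
    ∃ M : ℝ, 0 < M ∧ ∀ k, ∀ t ∈ Set.Icc (0 : ℝ) 1, ∀ y,
      IsUnit (algebraMap ℂ _ (γ k t) - fiberOp L s (D k) y) ∧
      ‖Ring.inverse (algebraMap ℂ _ (γ k t) - fiberOp L s (D k) y)‖ ≤ M := by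
  obtain ⟨M, hM, h⟩ := h0.exists_norm_resolvent_le hγ
  exact ⟨2 * M, by positivity, fun k t ht y =>
    isUnit_fiberOp hL hs (hD k) hinc hM (h0.isUnit k ht) (h k t ht) y⟩

theorem avoidsSpectra_fiberOp (hL : ∀ j, (L j).det ≠ 0) (hs : s ^ 2 = 1) (hD : ∀ k, (D k).IsGood L)
    (hinc : lattice (recip (L 0)) ⊓ lattice (recip (L 1)) = ⊥) (hγ : IsContourData γ g)
    (h0 : AvoidsSpectra γ fun k => fiberOp L s (D k) 0) (y : Plane) :
    AvoidsSpectra γ fun k => fiberOp L s (D k) y := by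
  obtain ⟨M, -, h⟩ := exists_isUnit_fiberOp hL hs hD hinc hγ h0
  exact fun k t ht => (h k t ht y).1

/-- The weighted fibre operators, as bounded continuous functions of the configuration. -/
theorem exists_wtFamily (hL : ∀ j, (L j).det ≠ 0) (hs : s ^ 2 = 1) (hD : ∀ k, (D k).IsGood L)
    (hinc : lattice (recip (L 0)) ⊓ lattice (recip (L 1)) = ⊥) (hγ : IsContourData γ g)
    (h0 : AvoidsSpectra γ fun k => fiberOp L s (D k) 0) {ρ : ℝ} (hρ : 0 < ρ) :
    ∃ ε : ℝ, 0 < ε ∧ ε ≤ 1 ∧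
      ∃ W : Fin n → (Plane →ᵇ (SiteSpace L 𝒜 →L[ℂ] SiteSpace L 𝒜)),
        (∀ k y, ‖y‖ ≤ ρ → W k y = kerOp (wtKer L s (D k) ε y)) ∧ AvoidsSpectra γ W := by
  obtain ⟨M, hM, hinv⟩ := exists_isUnit_fiberOp hL hs hD hinc hγ h0
  choose C hC0 hC using fun k => exists_schurBound_wtKer hL hs (hD k) ρ
  set C' := 1 + ∑ k, C k with hC'
  have hCC' : ∀ k, C k ≤ C' := fun k => by
    have := Finset.single_le_sum (f := C) (fun k _ => hC0 k) (Finset.mem_univ k)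
    linarith
  have hC'0 : 0 < C' := by
    have : 0 ≤ ∑ k, C k := Finset.sum_nonneg fun k _ => hC0 k
    linarith
  -- With this `ε` every weighted fibre operator is within `(2 * M)⁻¹` of the unweighted one, for
  -- all `k` simultaneously.
  set ε := min 1 ((2 * M)⁻¹ / C') with hε
  have hε0 : 0 < ε := lt_min one_pos (by positivity)
  have hε1 : ε ≤ 1 := min_le_left _ _
  have hcont : ∀ k, Continuous fun y => kerOp (wtKer L s (D k) ε (clampPt ρ y)) := fun k =>
    (continuousOn_wtKer hL hs (hD k) ρ hε0.le hε1).comp_continuous (continuous_clampPt ρ)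
      fun y => by simpa using norm_clampPt_le hρ y
  -- The estimates on weighted kernels hold only for bounded `y`. Precomposing with the retraction
  -- `clampPt` gives bounded continuous functions on the whole plane without changing them on the
  -- disc.
  let W : Fin n → (Plane →ᵇ (SiteSpace L 𝒜 →L[ℂ] SiteSpace L 𝒜)) := fun k =>
    BoundedContinuousFunction.ofNormedAddCommGroup _ (hcont k) (C k) fun y =>
      ((hC k ε hε0.le hε1 _ (norm_clampPt_le hρ y)).1).norm_kerOp_le
  refine ⟨ε, hε0, hε1, W, fun k y hy => ?_, fun k t ht => ?_⟩
  · change kerOp (wtKer L s (D k) ε (clampPt ρ y)) = _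
    rw [clampPt_of_norm_le hρ hy]
  · refine isUnit_bcf (M := 2 * M) _ fun y => ?_
    have h1 := hinv k t ht (clampPt ρ y)
    refine isUnit_of_norm_sub_le hM h1.1 h1.2 ?_
    change ‖algebraMap ℂ _ (γ k t) - kerOp (wtKer L s (D k) ε (clampPt ρ y)) - _‖ ≤ _
    rw [sub_sub_sub_cancel_left, norm_sub_rev]
    refine ((hC k ε hε0.le hε1 _ (norm_clampPt_le hρ y)).2).trans ?_
    have h2 : ε ≤ (2 * M)⁻¹ / C' := min_le_right _ _
    rw [le_div_iff₀ hC'0] at h2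
    exact (mul_le_mul_of_nonneg_left (hCC' k) hε0.le).trans h2

/-- The observable of the fibre at `y`. -/
def fiberObs (L : Fin 2 → Matrix (Fin 2) (Fin 2) ℝ) (s : ℝ) (γ : Fin n → ℝ → ℂ)
    (g : (Fin n → ℂ) → ℂ) (D : Fin n → HopData 𝒜) (y : Plane) :
    SiteSpace L 𝒜 →L[ℂ] SiteSpace L 𝒜 := obs γ g fun k => fiberOp L s (D k) y

/-- The site permutation intertwines the Hamiltonians of the two fibres, hence also their contour
integrals. -/
theorem entry_fiberObs_shift (hL : ∀ j, (L j).det ≠ 0) (hs : s ^ 2 = 1) (hD : ∀ k, (D k).IsGood L)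
    (hinc : lattice (recip (L 0)) ⊓ lattice (recip (L 1)) = ⊥) (hγ : IsContourData γ g)
    (h0 : AvoidsSpectra γ fun k => fiberOp L s (D k) 0) (R₀ : ∀ j, lattice (L j)) (y : Plane)
    (p q : Sites L 𝒜) : entry (fiberObs L s γ g D (y + shiftPt s R₀)) p q =
      entry (fiberObs L s γ g D y) (shiftSites R₀ p) (shiftSites R₀ q) := by
  classical
  have hw : ∀ p : Sites L 𝒜, ‖(1 : ℂ)‖ ≤ 1 := fun _ => by simp
  have h1 := comp_obs hγ (avoidsSpectra_fiberOp hL hs hD hinc hγ h0 y)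
    (avoidsSpectra_fiberOp hL hs hD hinc hγ h0 (y + shiftPt s R₀))
    (fun k => wtPermOp_comp_fiberOp hL hs (hD k) R₀ y)
  have h2 := congrArg (fun T : SiteSpace L 𝒜 →L[ℂ] SiteSpace L 𝒜 =>
    T (lp.single 2 (shiftSites R₀ q) 1) p) h1
  simp only [ContinuousLinearMap.comp_apply] at h2
  rw [wtPermOp_apply _ hw, one_mul] at h2
  have h3 : wtPermOp (shiftSites R₀) (fun _ => 1) (lp.single 2 (shiftSites R₀ q) (1 : ℂ)) =
      (lp.single 2 q (1 : ℂ) : SiteSpace L 𝒜) := by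
    ext r
    rw [wtPermOp_apply _ hw, one_mul]
    by_cases hr : r = q
    · subst hr
      rw [lp.single_apply_self, lp.single_apply_self]
    · rw [lp.single_apply_ne _ _ _ hr, lp.single_apply_ne]
      exact fun h => hr ((shiftSites R₀).injective h)
  rw [h3] at h2
  rw [entry_eq, entry_eq]
  exact h2.symm

/-- Multiplication by the decaying weight. -/
def wtOp (L : Fin 2 → Matrix (Fin 2) (Fin 2) ℝ) (𝒜 : Fin 2 → Type u) [∀ j, Fintype (𝒜 j)] (ε : ℝ) :
    SiteSpace L 𝒜 →L[ℂ] SiteSpace L 𝒜 :=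
  wtPermOp (Equiv.refl _) fun p => (((siteWt ε p ^ 3)⁻¹ : ℝ) : ℂ)

theorem wtOp_apply {ε : ℝ} (hε : 0 ≤ ε) (ψ : SiteSpace L 𝒜) (p : Sites L 𝒜) :
    wtOp L 𝒜 ε ψ p = (((siteWt ε p ^ 3)⁻¹ : ℝ) : ℂ) * ψ p :=
  wtPermOp_apply (Equiv.refl _) (norm_inv_siteWt_le hε) ψ p

theorem wtOp_comp_fiberOp (hL : ∀ j, (L j).det ≠ 0) (hs : s ^ 2 = 1) {D : HopData 𝒜}
    (hD : D.IsGood L) {ε : ℝ} (hε : 0 ≤ ε) (hε1 : ε ≤ 1) (y : Plane) :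
    wtOp L 𝒜 ε ∘L fiberOp L s D y = kerOp (wtKer L s D ε y) ∘L wtOp L 𝒜 ε := by
  obtain ⟨C, -, hC⟩ := exists_schurBound_wtKer hL hs hD ‖y‖
  ext ψ p
  simp only [ContinuousLinearMap.comp_apply]
  refine HasSum.unique ?_ ((hC ε hε hε1 y le_rfl).1.hasSum_kerOp _ p)
  rw [wtOp_apply hε]
  suffices h0 : ∀ q, wtKer L s D ε y p q * wtOp L 𝒜 ε ψ q =
      (((siteWt ε p ^ 3)⁻¹ : ℝ) : ℂ) * (fiberKer L s D y p q * ψ q) by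
    simp only [h0]
    exact (hasSum_fiberOp hL hs hD y ψ p).mul_left _
  intro q
  rw [wtOp_apply hε, wtKer, wtRatio, div_pow]
  have h1 : ((siteWt ε q : ℝ) : ℂ) ≠ 0 := by exact_mod_cast (siteWt_pos hε q).ne'
  have h2 : ((siteWt ε p : ℝ) : ℂ) ≠ 0 := by exact_mod_cast (siteWt_pos hε p).ne'
  push_cast
  field_simp

theorem wtOp_single [DecidableEq (Sites L 𝒜)] {ε : ℝ} (hε : 0 ≤ ε) (q : Sites L 𝒜) :
    wtOp L 𝒜 ε (lp.single 2 q 1) =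
      (((siteWt ε q ^ 3)⁻¹ : ℝ) : ℂ) • (lp.single 2 q (1 : ℂ) : SiteSpace L 𝒜) := by
  ext r
  rw [wtOp_apply hε, lp.coeFn_smul, Pi.smul_apply, smul_eq_mul]
  by_cases hr : r = q
  · subst hr
    rfl
  · rw [lp.single_apply_ne _ _ _ hr, mul_zero, mul_zero]

/-- The matrix entries of the fibre observables in terms of the weighted family. -/
theorem entry_fiberObs_eq (hL : ∀ j, (L j).det ≠ 0) (hs : s ^ 2 = 1) (hD : ∀ k, (D k).IsGood L)
    (hinc : lattice (recip (L 0)) ⊓ lattice (recip (L 1)) = ⊥) (hγ : IsContourData γ g)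
    (h0 : AvoidsSpectra γ fun k => fiberOp L s (D k) 0) {ρ ε : ℝ} (hε : 0 ≤ ε) (hε1 : ε ≤ 1)
    {W : Fin n → (Plane →ᵇ (SiteSpace L 𝒜 →L[ℂ] SiteSpace L 𝒜))}
    (hW : ∀ k y, ‖y‖ ≤ ρ → W k y = kerOp (wtKer L s (D k) ε y)) (hWγ : AvoidsSpectra γ W)
    {y : Plane} (hy : ‖y‖ ≤ ρ) (p q : Sites L 𝒜) :
    (((siteWt ε p ^ 3)⁻¹ : ℝ) : ℂ) * entry (fiberObs L s γ g D y) p q =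
      (((siteWt ε q ^ 3)⁻¹ : ℝ) : ℂ) * entry (obs γ g W y) p q := by
  classical
  have h1 := map_obs hγ hWγ (bcfEval _ y) (continuous_bcfEval _ y)
  have h2 := hWγ.map (bcfEval _ y)
  have h3 := comp_obs hγ (avoidsSpectra_fiberOp hL hs hD hinc hγ h0 y) h2 (J := wtOp L 𝒜 ε) fun k => by
    change _ = (W k y) ∘L _
    rw [hW k y hy]
    exact wtOp_comp_fiberOp hL hs (hD k) hε hε1 y
  rw [← h1] at h3
  have h4 := congrArg (fun T : SiteSpace L 𝒜 →L[ℂ] SiteSpace L 𝒜 => T (lp.single 2 q 1) p) h3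
  simp only [ContinuousLinearMap.comp_apply] at h4
  rw [wtOp_apply hε, wtOp_single hε, map_smul, lp.coeFn_smul, Pi.smul_apply, smul_eq_mul] at h4
  rw [entry_eq, entry_eq]
  exact h4

/-- Forming the observable inside the Banach algebra of bounded continuous operator-valued functions
yields continuity for free. Near `y` the fibre entry is a constant multiple of an entry of that
function. -/
theorem continuousOn_entry_fiberObs (hL : ∀ j, (L j).det ≠ 0) (hs : s ^ 2 = 1)
    (hD : ∀ k, (D k).IsGood L)
    (hinc : lattice (recip (L 0)) ⊓ lattice (recip (L 1)) = ⊥) (hγ : IsContourData γ g)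
    (h0 : AvoidsSpectra γ fun k => fiberOp L s (D k) 0) (p q : Sites L 𝒜) :
    Continuous fun y => entry (fiberObs L s γ g D y) p q := by
  rw [continuous_iff_continuousAt]
  intro y
  obtain ⟨ε, hε, hε1, W, hW, hWγ⟩ := exists_wtFamily hL hs hD hinc hγ h0 (ρ := ‖y‖ + 1) (by positivity)
  have hc : Continuous fun z => entry (obs γ g W z) p q := by
    classical
    exact ((lp.evalCLM ℂ (fun _ : Sites L 𝒜 => ℂ) (p := 2) p).continuous.comp
      ((obs γ g W).continuous.clm_apply continuous_const))
  have h1 : Continuous fun z => (siteWt ε p ^ 3 : ℂ) *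
      ((((siteWt ε q ^ 3)⁻¹ : ℝ) : ℂ) * entry (obs γ g W z) p q) := by fun_prop
  refine h1.continuousAt.congr ?_
  filter_upwards [Metric.ball_mem_nhds y one_pos] with z hz
  have hz' : ‖z‖ ≤ ‖y‖ + 1 := by
    rw [Metric.mem_ball, dist_eq_norm] at hz
    have := norm_add_le (z - y) y
    rw [sub_add_cancel] at this
    linarith
  rw [← entry_fiberObs_eq hL hs hD hinc hγ h0 hε.le hε1 hW hWγ hz' p q]
  have h2 : ((siteWt ε p : ℝ) : ℂ) ≠ 0 := by exact_mod_cast (siteWt_pos hε.le p).ne'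
  push_cast
  rw [mul_inv_cancel_left₀ (pow_ne_zero 3 h2)]

/-- Decay of the matrix entries of the fibre observables. -/
theorem exists_norm_entry_fiberObs_le (hL : ∀ j, (L j).det ≠ 0) (hs : s ^ 2 = 1)
    (hD : ∀ k, (D k).IsGood L)
    (hinc : lattice (recip (L 0)) ⊓ lattice (recip (L 1)) = ⊥) (hγ : IsContourData γ g)
    (h0 : AvoidsSpectra γ fun k => fiberOp L s (D k) 0) (ρ : ℝ) :
    ∃ C : ℝ, ∀ y : Plane, ‖y‖ ≤ ρ → ∀ p q : Sites L 𝒜, (p.2.1 : Plane) = 0 →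
      ‖entry (fiberObs L s γ g D y) p q‖ ≤ C * dec 3 (q.2.1 : Plane) := by
  obtain ⟨ε, hε, hε1, W, hW, hWγ⟩ := exists_wtFamily hL hs hD hinc hγ h0 (ρ := |ρ| + 1) (by positivity)
  refine ⟨‖obs γ g W‖ * (ε ^ 3)⁻¹, fun y hy p q hp => ?_⟩
  have h1 := entry_fiberObs_eq hL hs hD hinc hγ h0 hε.le hε1 hW hWγ
    (y := y) (by linarith [le_abs_self ρ]) p q
  -- The row weight is 1 at the origin, so all decay comes from the column weight, using `ε (1 +
  -- ‖R‖) ≤ 1 + ε ‖R‖`.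
  have hp1 : siteWt ε p = 1 := by simp [siteWt, hp]
  rw [hp1, one_pow, inv_one, Complex.ofReal_one, one_mul] at h1
  rw [h1, norm_mul, mul_comm, mul_assoc]
  refine mul_le_mul ((norm_entry_le _ p q).trans ((obs γ g W).norm_coe_le_norm y)) ?_
    (norm_nonneg _) (norm_nonneg (obs γ g W))
  rw [Complex.norm_real, norm_inv, norm_pow, Real.norm_of_nonneg (siteWt_pos hε.le q).le, dec,
    ← mul_inv, ← mul_pow]
  refine inv_anti₀ (by positivity) (pow_le_pow_left₀ (by positivity) ?_ 3)
  rw [siteWt, mul_add, mul_one]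
  linarith

end Observables

end

noncomputable section

/-! ### Translations between the cells -/

section Shift

variable {B : Matrix (Fin 2) (Fin 2) ℝ}

theorem lintegral_smul_add {s : ℝ} (hs : s ^ 2 = 1) (v : Plane) (G : Plane → ENNReal) :
    ∫⁻ x : Plane, G (s • x + v) = ∫⁻ x, G x := by
  rw [← lintegral_add_right_eq_self G v]
  rcases (mul_self_eq_one_iff.1 ((sq s).symm.trans hs)) with rfl | rfl
  · simp
  · simp only [neg_smul, one_smul]
    exact lintegral_neg_eq_self (μ := (volume : Measure Plane)) (fun x => G (x + v))

/-- On the cell of `B'` the function `(1 + d) ^ 3 * dec 3` is at least 1. Moving it along and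
integrating over the plane, the integral unfolds over `lattice B`, where the sums of `dec 3` are
bounded uniformly in the translation. -/
theorem exists_setLIntegral_le (hB : B.det ≠ 0) {B' : Matrix (Fin 2) (Fin 2) ℝ}
    (hB' : B'.det ≠ 0) :
    ∃ C : ℝ, 0 < C ∧ ∀ s : ℝ, s ^ 2 = 1 → ∀ (v : Plane) (F : Plane → ENNReal), Measurable F →
      LatPeriodic B F → ∫⁻ x in cell B', F (s • x + v) ≤ ENNReal.ofReal C * ∫⁻ x in cell B, F x := by
  obtain ⟨d, hd0, hd⟩ := exists_norm_le_of_mem_cell B'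
  obtain ⟨C, hC0, hC⟩ := exists_tsum_dec_le hB
  refine ⟨(1 + d) ^ 3 * C, by positivity, fun s hs v F hF hper => ?_⟩
  set G : Plane → ENNReal := fun u => ENNReal.ofReal ((1 + d) ^ 3 * dec 3 (u - v)) * F u with hG
  have h1 : ∫⁻ x in cell B', F (s • x + v) ≤ ∫⁻ x, G x := by
    rw [← lintegral_smul_add hs v G]
    refine le_trans ?_ (setLIntegral_le_lintegral (cell B') _)
    refine setLIntegral_mono' (measurableSet_cell hB') fun x hx => ?_
    · have h2 : 1 ≤ (1 + d) ^ 3 * dec 3 x := by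
        calc (1 : ℝ) = (1 + ‖x‖) ^ 3 * dec 3 x := by rw [mul_comm, dec_mul_pow]
          _ ≤ (1 + d) ^ 3 * dec 3 x := by
            have := dec_nonneg 3 x
            have := hd x hx
            gcongr
      have h3 : dec 3 (s • x) = dec 3 x := dec_congr_norm (norm_sign_smul hs x)
      simp only [hG, add_sub_cancel_right, h3]
      exact le_mul_of_one_le_left' (ENNReal.one_le_ofReal.2 h2)
  refine h1.trans ?_
  rw [(isAddFundamentalDomain_cell hB volume).lintegral_eq_tsum'']
  have h4 : ∀ (K : lattice B) (x : Plane), G (K +ᵥ x) =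
      ENNReal.ofReal ((1 + d) ^ 3 * dec 3 (x - v + K)) * F x := fun K x => by
    rw [AddSubgroup.vadd_def, vadd_eq_add, add_comm (K : Plane) x]
    simp only [hG]
    rw [hper _ K.2, add_sub_right_comm]
  simp only [h4]
  have hm : ∀ K : lattice B, Measurable fun x : Plane =>
      ENNReal.ofReal ((1 + d) ^ 3 * dec 3 (x - v + K)) := fun K =>
    (continuous_const.mul ((continuous_dec 3).comp
      ((continuous_id.sub continuous_const).add continuous_const))).measurable.ennreal_ofReal
  have hm' : ∀ K : lattice B, AEMeasurable (fun x : Plane =>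
      ENNReal.ofReal ((1 + d) ^ 3 * dec 3 (x - v + K)) * F x) (volume.restrict (cell B)) :=
    fun K => ((hm K).mul hF).aemeasurable
  rw [← lintegral_tsum hm', ← lintegral_const_mul' _ _ ENNReal.ofReal_ne_top]
  refine lintegral_mono fun x => ?_
  rw [ENNReal.tsum_mul_right]
  gcongr
  rw [← ENNReal.ofReal_tsum_of_nonneg (fun K => mul_nonneg (by positivity) (dec_nonneg _ _))
    ((hC (x - v)).1.mul_left _), tsum_mul_left]
  exact ENNReal.ofReal_le_ofReal (mul_le_mul_of_nonneg_left (hC (x - v)).2 (by positivity))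

variable {𝓃 : Type*} [Fintype 𝓃]

theorem perVal_periodic (hB : B.det ≠ 0)
    (φ : Lp (EuclideanSpace ℂ 𝓃) 2 (volume.restrict (cell B))) : LatPeriodic B (perVal B φ) :=
  fun K hK x => by
    funext α
    rw [perVal, perVal, reduce_add_lattice hB hK]

theorem measurable_perVal (φ : Lp (EuclideanSpace ℂ 𝓃) 2 (volume.restrict (cell B))) (α : 𝓃) :
    Measurable fun x => perVal B φ x α :=
  ((EuclideanSpace.proj α : EuclideanSpace ℂ 𝓃 →L[ℂ] ℂ).continuous.measurable.comp
    (Lp.stronglyMeasurable φ).measurable).comp (measurable_reduce B)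

theorem ae_perVal_add (hB : B.det ≠ 0)
    (φ φ' : Lp (EuclideanSpace ℂ 𝓃) 2 (volume.restrict (cell B))) :
    ∀ᵐ x : Plane, ∀ α, perVal B (φ + φ') x α = perVal B φ x α + perVal B φ' x α := by
  filter_upwards [ae_reduce hB (Lp.coeFn_add φ φ')] with x hx α
  simp only [perVal]
  rw [hx]
  rfl

theorem ae_perVal_smul (hB : B.det ≠ 0) (c : ℂ)
    (φ : Lp (EuclideanSpace ℂ 𝓃) 2 (volume.restrict (cell B))) :
    ∀ᵐ x : Plane, ∀ α, perVal B (c • φ) x α = c * perVal B φ x α := by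
  filter_upwards [ae_reduce hB (Lp.coeFn_smul c φ)] with x hx α
  simp only [perVal]
  rw [hx]
  rfl

theorem ae_smul_add {s : ℝ} (hs : s ^ 2 = 1) (v : Plane) {P : Plane → Prop} (h : ∀ᵐ x : Plane, P x) :
    ∀ᵐ x : Plane, P (s • x + v) := by
  have h1 : MeasurePreserving (fun x : Plane => x + v) volume volume :=
    measurePreserving_add_right _ _
  have h2 : MeasurePreserving (fun x : Plane => s • x) volume volume := by
    rcases (mul_self_eq_one_iff.1 ((sq s).symm.trans hs)) with rfl | rfl
    · simp only [one_smul]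
      exact MeasurePreserving.id (volume : Measure Plane)
    · simpa using Measure.measurePreserving_neg (volume : Measure Plane)
  exact (h1.comp h2).quasiMeasurePreserving.ae h

/-- The norm bound is uniform in `v`, `s` and `β`. This allows infinitely many translates to be
assembled with summable weights. -/
theorem exists_perShift (hB : B.det ≠ 0) {B' : Matrix (Fin 2) (Fin 2) ℝ}
    (hB' : B'.det ≠ 0) :
    ∃ C : ℝ, 0 ≤ C ∧ ∀ s : ℝ, s ^ 2 = 1 → ∀ (v : Plane) (β : 𝓃),
      ∃ T : Lp (EuclideanSpace ℂ 𝓃) 2 (volume.restrict (cell B)) →L[ℂ]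
        Lp ℂ 2 (volume.restrict (cell B')), ‖T‖ ≤ C ∧
        ∀ φ, ∀ᵐ x ∂(volume.restrict (cell B')), T φ x = perVal B φ (s • x + v) β := by
  obtain ⟨C, hC0, hC⟩ := exists_setLIntegral_le hB hB'
  refine ⟨√C, Real.sqrt_nonneg _, fun s hs v β => ?_⟩
  have hmeas : ∀ φ : Lp (EuclideanSpace ℂ 𝓃) 2 (volume.restrict (cell B)),
      Measurable fun x : Plane => perVal B φ (s • x + v) β := fun φ =>
    (measurable_perVal φ β).comp ((continuous_id.const_smul s).add continuous_const).measurable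
  have hle : ∀ φ : Lp (EuclideanSpace ℂ 𝓃) 2 (volume.restrict (cell B)),
      eLpNorm (fun x => perVal B φ (s • x + v) β) 2 (volume.restrict (cell B')) ≤
        ENNReal.ofReal (√C) * eLpNorm φ 2 (volume.restrict (cell B)) := fun φ => by
    have h1 := hC s hs v (fun u => ‖φ (reduce B u)‖ₑ ^ (2 : ℝ))
      ((((Lp.stronglyMeasurable φ).measurable.comp (measurable_reduce B)).enorm).pow_const _)
      fun K hK x => by simp only [reduce_add_lattice hB hK]
    have h2 : ∫⁻ x in cell B, ‖φ (reduce B x)‖ₑ ^ (2 : ℝ) = ∫⁻ x in cell B, ‖φ x‖ₑ ^ (2 : ℝ) :=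
      setLIntegral_congr_fun (measurableSet_cell hB) fun x hx => by
        simp only [reduce_of_mem_cell hB hx]
    rw [h2] at h1
    rw [eLpNorm_eq_lintegral_rpow_enorm_toReal (by simp) (by simp),
      eLpNorm_eq_lintegral_rpow_enorm_toReal (by simp) (by simp)]
    simp only [ENNReal.toReal_ofNat]
    have h3 : ENNReal.ofReal (√C) = ENNReal.ofReal C ^ (1 / (2 : ℝ)) := by
      rw [Real.sqrt_eq_rpow, ENNReal.ofReal_rpow_of_pos hC0]
    rw [h3, ← ENNReal.mul_rpow_of_nonneg _ _ (by norm_num)]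
    refine ENNReal.rpow_le_rpow (le_trans (lintegral_mono fun x => ?_) h1) (by norm_num)
    refine ENNReal.rpow_le_rpow ?_ (by norm_num)
    rw [enorm_le_iff_norm_le]
    exact PiLp.norm_apply_le _ β
  have hmem : ∀ φ : Lp (EuclideanSpace ℂ 𝓃) 2 (volume.restrict (cell B)),
      MemLp (fun x => perVal B φ (s • x + v) β) 2 (volume.restrict (cell B')) := fun φ =>
    ⟨(hmeas φ).aestronglyMeasurable, (hle φ).trans_lt
      (ENNReal.mul_lt_top ENNReal.ofReal_lt_top (Lp.memLp φ).2)⟩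
  let T₀ : Lp (EuclideanSpace ℂ 𝓃) 2 (volume.restrict (cell B)) →ₗ[ℂ]
      Lp ℂ 2 (volume.restrict (cell B')) :=
    { toFun := fun φ => (hmem φ).toLp _
      map_add' := fun φ φ' => by
        rw [← MemLp.toLp_add, MemLp.toLp_eq_toLp_iff]
        filter_upwards [ae_restrict_of_ae (ae_smul_add hs v (ae_perVal_add hB φ φ'))] with x hx
        exact hx β
      map_smul' := fun c φ => by
        rw [RingHom.id_apply, ← MemLp.toLp_const_smul, MemLp.toLp_eq_toLp_iff]
        filter_upwards [ae_restrict_of_ae (ae_smul_add hs v (ae_perVal_smul hB c φ))] with x hx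
        exact hx β }
  refine ⟨T₀.mkContinuous (√C) fun φ => ?_, T₀.mkContinuous_norm_le (Real.sqrt_nonneg _) _,
    fun φ => (hmem φ).coeFn_toLp⟩
  change ‖(hmem φ).toLp _‖ ≤ _
  rw [Lp.norm_toLp, Lp.norm_def, ← ENNReal.toReal_ofReal (Real.sqrt_nonneg C),
    ← ENNReal.toReal_mul]
  exact ENNReal.toReal_mono (ENNReal.mul_ne_top ENNReal.ofReal_ne_top (Lp.memLp φ).2.ne) (hle φ)

end Shift

/-! ### Multiplication by operator-valued functions -/

section Mul

variable {E : Type*} [NormedAddCommGroup E] [NormedSpace ℂ E] (μ : Measure Plane) (c : ℝ)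

theorem ae_norm_mulFun_le (W : Plane →ᵇ (E →L[ℂ] E)) (v : Plane → E) :
    ∀ᵐ x ∂μ, ‖W (c • x) (v x)‖ ≤ ‖W‖ * ‖v x‖ :=
  Eventually.of_forall fun x => ((W (c • x)).le_opNorm _).trans
    (mul_le_mul_of_nonneg_right (W.norm_coe_le_norm _) (norm_nonneg _))

theorem memLp_mulFun (W : Plane →ᵇ (E →L[ℂ] E)) (v : Lp E 2 μ) :
    MemLp (fun x => W (c • x) (v x)) 2 μ := by
  refine (Lp.memLp v).of_le_mul ?_ (ae_norm_mulFun_le μ c W v)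
  have h1 : AEStronglyMeasurable (fun x => W (c • x)) μ :=
    (W.continuous.comp (continuous_const_smul c)).aestronglyMeasurable
  exact ContinuousLinearMap.aestronglyMeasurable_comp₂ (ContinuousLinearMap.id ℂ (E →L[ℂ] E)) h1
    (Lp.aestronglyMeasurable v)

/-- The multiplication operator of `W (c • ·)`. -/
def mulFun (W : Plane →ᵇ (E →L[ℂ] E)) : Lp E 2 μ →L[ℂ] Lp E 2 μ :=
  LinearMap.mkContinuous
    { toFun := fun v => (memLp_mulFun μ c W v).toLp _
      map_add' := fun v v' => by
        rw [← MemLp.toLp_add, MemLp.toLp_eq_toLp_iff]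
        filter_upwards [Lp.coeFn_add v v'] with x hx
        rw [hx]
        exact map_add (W (c • x)) (v x) (v' x)
      map_smul' := fun a v => by
        rw [RingHom.id_apply, ← MemLp.toLp_const_smul, MemLp.toLp_eq_toLp_iff]
        filter_upwards [Lp.coeFn_smul a v] with x hx
        rw [hx]
        exact map_smul (W (c • x)) a (v x) } ‖W‖ fun v => by
    refine Lp.norm_le_mul_norm_of_ae_le_mul ?_
    filter_upwards [(memLp_mulFun μ c W v).coeFn_toLp] with x hx
    refine (congrArg norm hx).trans_le ?_
    exact ((W (c • x)).le_opNorm _).trans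
      (mul_le_mul_of_nonneg_right (W.norm_coe_le_norm _) (norm_nonneg _))

theorem mulFun_ae (W : Plane →ᵇ (E →L[ℂ] E)) (v : Lp E 2 μ) :
    ∀ᵐ x ∂μ, mulFun μ c W v x = W (c • x) (v x) := (memLp_mulFun μ c W v).coeFn_toLp

theorem norm_mulFun_le (W : Plane →ᵇ (E →L[ℂ] E)) : ‖mulFun μ c W‖ ≤ ‖W‖ :=
  LinearMap.mkContinuous_norm_le _ (norm_nonneg W) _

/-- The representation of operator-valued functions by multiplication operators. -/
def mulAlgHom : (Plane →ᵇ (E →L[ℂ] E)) →ₐ[ℂ] (Lp E 2 μ →L[ℂ] Lp E 2 μ) :=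
  AlgHom.ofLinearMap
    { toFun := mulFun μ c
      map_add' := fun W W' => by
        ext1 v
        refine Lp.ext ?_
        filter_upwards [mulFun_ae μ c (W + W') v, mulFun_ae μ c W v, mulFun_ae μ c W' v,
          Lp.coeFn_add (mulFun μ c W v) (mulFun μ c W' v)] with x h1 h2 h3 h4
        refine h1.trans (Eq.trans ?_ h4.symm)
        rw [Pi.add_apply, h2, h3]
        rfl
      map_smul' := fun a W => by
        ext1 v
        refine Lp.ext ?_
        filter_upwards [mulFun_ae μ c (a • W) v, mulFun_ae μ c W v,
          Lp.coeFn_smul a (mulFun μ c W v)] with x h1 h2 h3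
        refine h1.trans (Eq.trans ?_ h3.symm)
        rw [Pi.smul_apply, h2]
        rfl }
    (by
      ext1 v
      refine Lp.ext ?_
      filter_upwards [mulFun_ae μ c (1 : Plane →ᵇ (E →L[ℂ] E)) v] with x h1
      exact h1)
    (fun W W' => by
      ext1 v
      refine Lp.ext ?_
      filter_upwards [mulFun_ae μ c (W * W') v, mulFun_ae μ c W (mulFun μ c W' v),
        mulFun_ae μ c W' v] with x h1 h2 h3
      refine h1.trans (Eq.trans ?_ h2.symm)
      rw [h3]
      rfl)

theorem mulAlgHom_ae (W : Plane →ᵇ (E →L[ℂ] E)) (v : Lp E 2 μ) :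
    ∀ᵐ x ∂μ, mulAlgHom μ c W v x = W (c • x) (v x) := mulFun_ae μ c W v

theorem continuous_mulAlgHom : Continuous (mulAlgHom (E := E) μ c) :=
  AddMonoidHomClass.continuous_of_bound (mulAlgHom (E := E) μ c) 1 fun W => by
    rw [one_mul]
    exact norm_mulFun_le μ c W

end Mul

end

/-! ### Fibres of functions on the tori and operators acting on them. -/

noncomputable section

variable {𝒜 : Fin 2 → Type u} {B L : Fin 2 → Matrix (Fin 2) (Fin 2) ℝ} {s : ℝ}

instance countable_sites [∀ j, Fintype (𝒜 j)] : Countable (Sites L 𝒜) :=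
  inferInstanceAs (Countable (Σ j, lattice (L j) × 𝒜 j))

/-- A sum over the sites is the sum of the sums over the two layers. -/
theorem hasSum_sites [∀ j, Fintype (𝒜 j)] {f : Sites L 𝒜 → ℂ} {a : ℂ} (h : HasSum f a) (j : Fin 2) :
    a = (∑' R : lattice (L j), ∑ β, f ⟨j, (R, β)⟩) +
      ∑' R : lattice (L (other j)), ∑ β, f ⟨other j, (R, β)⟩ := by
  have h1 : ∀ i, Summable fun c : lattice (L i) × 𝒜 i => f ⟨i, c⟩ := fun i =>
    h.summable.comp_injective sigma_mk_injective
  have h2 := (h.sigma fun i => (h1 i).hasSum).unique (hasSum_fintype _)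
  rw [h2, Fin.sum_univ_two]
  have h3 : ∀ i, ∑' c : lattice (L i) × 𝒜 i, f ⟨i, c⟩ =
      ∑' R : lattice (L i), ∑ β, f ⟨i, (R, β)⟩ := fun i => by
    rw [(h1 i).tsum_prod]
    exact tsum_congr fun R => tsum_fintype _
  rw [h3, h3]
  fin_cases j
  · rfl
  · exact add_comm _ _

theorem exists_shift (hs : s ^ 2 = 1) (j : Fin 2) {R K : Plane} (hR : R ∈ lattice (L j))
    (hK : K ∈ lattice (L (other j))) : ∃ R₀ : ∀ j, lattice (L j), (R₀ j : Plane) = R ∧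
      shiftPt s R₀ = lsign s j • (R + K) := by
  have h : ∃ R₀ : ∀ j, lattice (L j), (R₀ j : Plane) = R ∧ (R₀ (other j) : Plane) = s • K := by
    fin_cases j
    · exact ⟨fun | 0 => ⟨R, hR⟩ | 1 => ⟨s • K, smul_mem_lattice hs hK⟩, rfl, rfl⟩
    · exact ⟨fun | 0 => ⟨s • K, smul_mem_lattice hs hK⟩ | 1 => ⟨R, hR⟩, rfl, rfl⟩
  obtain ⟨R₀, h1, h2⟩ := h
  refine ⟨R₀, h1, ?_⟩
  have h3 := lsign_smul_shiftPt hs R₀ j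
  rw [h1, h2, smul_smul, ← sq, hs, one_smul] at h3
  rw [← h3, smul_smul, lsign_sq hs, one_smul]

theorem siteWt_origin (ε : ℝ) (j : Fin 2) (α : 𝒜 j) :
    siteWt ε (⟨j, (0, α)⟩ : Sites L 𝒜) = 1 := by
  simp [siteWt]

variable [∀ j, Fintype (𝒜 j)]

/-- The fibre over `y` of an element of the torus space. -/
def fibVal (B : Fin 2 → Matrix (Fin 2) (Fin 2) ℝ) (s : ℝ) (ψ : TorusSpace B 𝒜) (y : Plane)
    (q : Sites L 𝒜) : ℂ := perVal (B q.1) (ψ q.1) (lsign s q.1 • y + q.2.1) q.2.2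

theorem fibVal_shift (hL : ∀ j, (L j).det ≠ 0) (hB : ∀ j, B j = L (other j)) (hs : s ^ 2 = 1)
    (R₀ : ∀ j, lattice (L j)) (ψ : TorusSpace B 𝒜) (y : Plane) (q : Sites L 𝒜) :
    fibVal B s ψ (y + shiftPt s R₀) q = fibVal B s ψ y (shiftSites R₀ q) := by
  have hBd : (B q.1).det ≠ 0 := by rw [hB]; exact hL _
  simp only [fibVal, shiftSites, Equiv.coe_fn_mk]
  rw [smul_add, lsign_smul_shiftPt hs]
  have e : lsign s q.1 • y + ((R₀ q.1 : Plane) + s • (R₀ (other q.1) : Plane)) + (q.2.1 : Plane) =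
      lsign s q.1 • y + ((q.2.1 + R₀ q.1 : lattice (L q.1)) : Plane) +
        s • (R₀ (other q.1) : Plane) := by
    push_cast
    abel
  have hmem : s • (R₀ (other q.1) : Plane) ∈ lattice (B q.1) := by
    rw [hB]
    exact smul_mem_lattice hs (R₀ (other q.1)).2
  rw [e, perVal_periodic hBd _ _ hmem]
  rfl

theorem ae_fibVal (hs : s ^ 2 = 1) {P : (j : Fin 2) → Plane → Prop} (h : ∀ j, ∀ᵐ x : Plane, P j x) :
    ∀ᵐ y : Plane, ∀ q : Sites L 𝒜, P q.1 (lsign s q.1 • y + q.2.1) :=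
  ae_all_iff.2 fun q => ae_smul_add (by rw [sq, lsign_sq hs]) _ (h q.1)

theorem norm_lsign (hs : s ^ 2 = 1) (j : Fin 2) (x : Plane) : ‖lsign s j • x‖ = ‖x‖ :=
  norm_sign_smul (by rw [sq, lsign_sq hs]) x

/-- Assembling a weighted family of scalar operators to an operator with values in `ℓ²`. -/
theorem exists_assemble {ι X : Type*} [Countable ι] [NormedAddCommGroup X] [NormedSpace ℂ X]
    (μ : Measure Plane) {w : ι → ℝ} (hw0 : ∀ q, 0 ≤ w q) (hw : Summable w)
    (T : ι → X →L[ℂ] Lp ℂ 2 μ) {C : ℝ} (hT : ∀ q, ‖T q‖ ≤ C) :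
    ∃ Θ : X →L[ℂ] Lp (Ell ι) 2 μ, ∀ ψ, ∀ᵐ x ∂μ, ∀ q, Θ ψ x q = (w q : ℂ) * T q ψ x := by
  classical
  let S : ι → (ℂ →L[ℂ] Ell ι) := fun q => lp.singleContinuousLinearMap ℂ (fun _ : ι => ℂ) 2 q
  have hS : ∀ q, ‖S q‖ ≤ 1 := fun q => ContinuousLinearMap.opNorm_le_bound _ zero_le_one fun c => by
    rw [one_mul]
    exact (lp.norm_single (E := fun _ : ι => ℂ) (p := 2) (by simp) q c).le
  let U : ι → (X →L[ℂ] Lp (Ell ι) 2 μ) := fun q => (w q : ℂ) • ((S q).compLpL 2 μ ∘L T q)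
  have hsum : Summable U := by
    refine Summable.of_norm_bounded (hw.mul_right C) fun q => ?_
    rw [norm_smul, Complex.norm_real, Real.norm_of_nonneg (hw0 q)]
    refine mul_le_mul_of_nonneg_left ?_ (hw0 q)
    refine (ContinuousLinearMap.opNorm_comp_le _ _).trans ?_
    calc ‖(S q).compLpL 2 μ‖ * ‖T q‖ ≤ 1 * C :=
          mul_le_mul (((S q).norm_compLpL_le).trans (hS q)) (hT q) (norm_nonneg _) zero_le_one
      _ = C := one_mul C
  refine ⟨∑' q, U q, fun ψ => ae_all_iff.2 fun q => ?_⟩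
  let E : Ell ι →L[ℂ] ℂ := lp.evalCLM ℂ (fun _ : ι => ℂ) (p := 2) q
  -- Evaluation at `q` annihilates every inserted component except the one at `q`, so it extracts a
  -- single term of the series.
  have hES : ∀ r (v : Lp ℂ 2 μ), E.compLpL 2 μ ((S r).compLpL 2 μ v) = if r = q then v else 0 :=
    fun r v => by
      refine Lp.ext ?_
      filter_upwards [E.coeFn_compLpL ((S r).compLpL 2 μ v), (S r).coeFn_compLpL v,
        Lp.coeFn_zero ℂ 2 μ] with x h1 h2 h3
      rw [h1, h2]
      change (lp.single 2 r (v x) : Ell ι) q = _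
      split_ifs with h
      · subst h
        exact lp.single_apply_self (E := fun _ : ι => ℂ) 2 r (v x)
      · rw [h3, lp.single_apply_ne _ _ _ (Ne.symm h)]
        rfl
  have h2 : HasSum (fun r => E.compLpL 2 μ (U r ψ)) (E.compLpL 2 μ ((∑' r, U r) ψ)) :=
    (hsum.hasSum.mapL (ContinuousLinearMap.apply ℂ _ ψ)).mapL (E.compLpL 2 μ)
  have h3 : ∀ r, E.compLpL 2 μ (U r ψ) = if r = q then (w q : ℂ) • T q ψ else 0 := fun r => by
    change E.compLpL 2 μ ((w r : ℂ) • ((S r).compLpL 2 μ (T r ψ))) = _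
    rw [map_smul, hES]
    split_ifs with h
    · subst h
      rfl
    · exact smul_zero _
  simp only [h3] at h2
  have h1 := h2.unique (hasSum_ite_eq q _)
  have h4 := E.coeFn_compLpL (p := 2) (μ := μ) ((∑' r, U r) ψ)
  rw [h1] at h4
  filter_upwards [h4, Lp.coeFn_smul (w q : ℂ) (T q ψ)] with x h5 h6
  change E ((∑' r, U r) ψ x) = _
  rw [← h5, h6, Pi.smul_apply, smul_eq_mul]

theorem summable_inv_siteWt (hL : ∀ j, (L j).det ≠ 0) {ε : ℝ} (hε : 0 < ε) (hε1 : ε ≤ 1) :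
    Summable fun q : Sites L 𝒜 => (siteWt ε q ^ 3)⁻¹ := by
  obtain ⟨S', -, hS'⟩ := exists_tsum_sites_le (𝒜 := 𝒜) hL
  have h1 := (hS' (fun q => dec 3 (q.2.1 : Plane)) fun i =>
    ⟨0, fun R α => by rw [zero_add]⟩).1.mul_left (ε ^ 3)⁻¹
  refine h1.of_nonneg_of_le (fun q => by have := siteWt_pos hε.le q; positivity) fun q => ?_
  rw [dec, ← mul_inv, ← mul_pow]
  refine inv_anti₀ (by positivity) (pow_le_pow_left₀ (by positivity) ?_ 3)
  rw [siteWt, mul_add, mul_one]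
  linarith

/-- The weighted fibres, as a bounded operator. -/
theorem exists_fibreMap (hL : ∀ j, (L j).det ≠ 0) (hBd : ∀ j, (B j).det ≠ 0) (hs : s ^ 2 = 1)
    (j : Fin 2) {ε : ℝ} (hε : 0 < ε) (hε1 : ε ≤ 1) :
    ∃ Θ : TorusSpace B 𝒜 →L[ℂ] Lp (SiteSpace L 𝒜) 2 (volume.restrict (cell (B j))),
      ∀ ψ, ∀ᵐ x ∂(volume.restrict (cell (B j))), ∀ q, Θ ψ x q =
        (((siteWt ε q ^ 3)⁻¹ : ℝ) : ℂ) * fibVal B s ψ (lsign s j • x) q := by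
  choose C hC0 hC using fun i => exists_perShift (𝓃 := 𝒜 i) (hBd i) (hBd j)
  have hss : ∀ i, (lsign s i * lsign s j) ^ 2 = 1 := fun i => by
    rw [mul_pow, sq, sq, lsign_sq hs, lsign_sq hs, one_mul]
  choose T hTC hT using fun q : Sites L 𝒜 => hC q.1 _ (hss q.1) q.2.1 q.2.2
  let P : ∀ i, TorusSpace B 𝒜 →L[ℂ] Lp (EuclideanSpace ℂ (𝒜 i)) 2 (volume.restrict (cell (B i))) :=
    fun i => PiLp.proj 2 _ i
  have hP : ∀ i, ‖P i‖ ≤ 1 := fun i => ContinuousLinearMap.opNorm_le_bound _ zero_le_one fun ψ => by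
    rw [one_mul]
    exact PiLp.norm_apply_le ψ i
  have hTP : ∀ q : Sites L 𝒜, ‖T q ∘L P q.1‖ ≤ ∑ i, C i := fun q => by
    refine (ContinuousLinearMap.opNorm_comp_le _ _).trans ?_
    have h1 := Finset.single_le_sum (f := C) (fun k _ => hC0 k) (Finset.mem_univ q.1)
    calc ‖T q‖ * ‖P q.1‖ ≤ ‖T q‖ * 1 := mul_le_mul_of_nonneg_left (hP _) (norm_nonneg _)
      _ ≤ ∑ i, C i := by
        rw [mul_one]
        exact (hTC q).trans h1
  -- The values of an `L²` function along a lattice need not be square summable. Summable weights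
  -- and uniformly bounded shifts make the weighted fibre an element of `ℓ²`.
  obtain ⟨Θ, hΘ⟩ := exists_assemble (volume.restrict (cell (B j)))
    (fun q : Sites L 𝒜 => by have := siteWt_pos hε.le q; positivity)
    (summable_inv_siteWt (𝒜 := 𝒜) hL hε hε1) (fun q => T q ∘L P q.1) hTP
  refine ⟨Θ, fun ψ => ?_⟩
  filter_upwards [hΘ ψ, ae_all_iff.2 fun q => hT q (ψ q.1)] with x h1 h2 q
  rw [h1 q, fibVal, smul_smul, ← h2 q]
  rfl

/-- The fibre `f` need not lie in `ℓ²`, so its matrix sums are obtained by applying the conjugated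
operator to the weighted vector and removing the weight. -/
theorem hasSum_of_weighted (hL : ∀ j, (L j).det ≠ 0) (hs : s ^ 2 = 1) {D : HopData 𝒜}
    (hD : D.IsGood L) {ε : ℝ} (hε : 0 ≤ ε) (hε1 : ε ≤ 1) (y : Plane) {v : SiteSpace L 𝒜}
    {f : Sites L 𝒜 → ℂ} (hv : ∀ q, v q = (((siteWt ε q ^ 3)⁻¹ : ℝ) : ℂ) * f q) (p : Sites L 𝒜) :
    HasSum (fun q => fiberKer L s D y p q * f q)
      ((siteWt ε p ^ 3 : ℝ) * kerOp (wtKer L s D ε y) v p) := by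
  obtain ⟨C, -, hC⟩ := exists_schurBound_wtKer hL hs hD ‖y‖
  have h1 := ((hC ε hε hε1 y le_rfl).1.hasSum_kerOp v p).mul_left ((siteWt ε p ^ 3 : ℝ) : ℂ)
  suffices h0 : ∀ q, fiberKer L s D y p q * f q =
      ((siteWt ε p ^ 3 : ℝ) : ℂ) * (wtKer L s D ε y p q * v q) by
    simp only [h0]
    exact h1
  intro q
  rw [hv, wtKer, wtRatio, div_pow]
  have h1 : ((siteWt ε q : ℝ) : ℂ) ≠ 0 := by exact_mod_cast (siteWt_pos hε q).ne'
  have h2 : ((siteWt ε p : ℝ) : ℂ) ≠ 0 := by exact_mod_cast (siteWt_pos hε p).ne'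
  push_cast
  field_simp

/-- The operator `T` acts on the fibres by the fibre operators. -/
def IsFibred (B L : Fin 2 → Matrix (Fin 2) (Fin 2) ℝ) (s : ℝ) (D : HopData 𝒜)
    (T : TorusSpace B 𝒜 →L[ℂ] TorusSpace B 𝒜) : Prop :=
  ∀ ψ j, ∀ᵐ x : Plane, ∀ α, HasSum (fun q : Sites L 𝒜 =>
    fiberKer L s D (lsign s j • x) ⟨j, (0, α)⟩ q * fibVal B s ψ (lsign s j • x) q)
    (perVal (B j) ((T ψ) j) x α)

theorem hasSum_fibVal_shift (hL : ∀ j, (L j).det ≠ 0) (hB : ∀ j, B j = L (other j))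
    (hs : s ^ 2 = 1) {D : HopData 𝒜} (hD : D.IsGood L) (R₀ : ∀ j, lattice (L j))
    (ψ : TorusSpace B 𝒜) (y : Plane) (p : Sites L 𝒜) {a : ℂ} :
    HasSum (fun q : Sites L 𝒜 => fiberKer L s D (y + shiftPt s R₀) p q *
      fibVal B s ψ (y + shiftPt s R₀) q) a ↔
    HasSum (fun q : Sites L 𝒜 => fiberKer L s D y (shiftSites R₀ p) q * fibVal B s ψ y q) a := by
  simp only [fiberKer_shift hs hD, fibVal_shift hL hB hs]
  exact (shiftSites (𝒜 := 𝒜) R₀).hasSum_iff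
    (f := fun q => fiberKer L s D y (shiftSites R₀ p) q * fibVal B s ψ y q)

theorem exists_wtKer_bcf (hL : ∀ j, (L j).det ≠ 0) (hs : s ^ 2 = 1) {D : HopData 𝒜}
    (hD : D.IsGood L) {ρ : ℝ} (hρ : 0 < ρ) :
    ∃ W : Plane →ᵇ (SiteSpace L 𝒜 →L[ℂ] SiteSpace L 𝒜),
      ∀ y, ‖y‖ ≤ ρ → W y = kerOp (wtKer L s D 1 y) := by
  obtain ⟨C, -, hC⟩ := exists_schurBound_wtKer hL hs hD ρ
  refine ⟨BoundedContinuousFunction.ofNormedAddCommGroup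
    (fun y => kerOp (wtKer L s D 1 (clampPt ρ y)))
    ((continuousOn_wtKer hL hs hD ρ zero_le_one le_rfl).comp_continuous (continuous_clampPt ρ)
      fun y => by simpa using norm_clampPt_le hρ y) C fun y =>
    ((hC 1 zero_le_one le_rfl _ (norm_clampPt_le hρ y)).1).norm_kerOp_le, fun y hy => ?_⟩
  change kerOp (wtKer L s D 1 (clampPt ρ y)) = _
  rw [clampPt_of_norm_le hρ hy]

/-- The operator is a composition: take weighted fibres, multiply by the weighted fibre operators,
and read off the sites at the origin, where the weight is 1. Covariance extends the formula from the
cell to the plane. -/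
theorem exists_isFibred (hL : ∀ j, (L j).det ≠ 0) (hB : ∀ j, B j = L (other j)) (hs : s ^ 2 = 1)
    {D : HopData 𝒜} (hD : D.IsGood L) :
    ∃ T : TorusSpace B 𝒜 →L[ℂ] TorusSpace B 𝒜, IsFibred B L s D T := by
  have hBd : ∀ j, (B j).det ≠ 0 := fun j => by rw [hB]; exact hL _
  choose d hd0 hd using fun j => exists_norm_le_of_mem_cell (B j)
  -- The weight parameter 1 suffices here, since only boundedness and not invertibility is needed.
  choose W hW using fun j => exists_wtKer_bcf (𝒜 := 𝒜) hL hs hD (hd0 j)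
  choose Θ hΘ using fun j => exists_fibreMap (𝒜 := 𝒜) (L := L) hL hBd hs j one_pos le_rfl
  let Ev : ∀ j, SiteSpace L 𝒜 →L[ℂ] EuclideanSpace ℂ (𝒜 j) := fun j =>
    (PiLp.continuousLinearEquiv 2 ℂ fun _ : 𝒜 j => ℂ).symm.toContinuousLinearMap ∘L
      ContinuousLinearMap.pi fun α => lp.evalCLM ℂ (fun _ : Sites L 𝒜 => ℂ) (p := 2) ⟨j, (0, α)⟩
  let T : ∀ j, TorusSpace B 𝒜 →L[ℂ] Lp (EuclideanSpace ℂ (𝒜 j)) 2 (volume.restrict (cell (B j))) :=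
    fun j => (Ev j).compLpL 2 _ ∘L mulFun _ (lsign s j) (W j) ∘L Θ j
  refine ⟨(PiLp.continuousLinearEquiv 2 ℂ _).symm.toContinuousLinearMap ∘L
    ContinuousLinearMap.pi T, fun ψ j => ?_⟩
  change ∀ᵐ x : Plane, ∀ α, HasSum _ (perVal (B j) (T j ψ) x α)
  refine ae_of_ae_cell (hBd j) ?_ fun K hK x hx α => ?_
  · filter_upwards [(Ev j).coeFn_compLpL (mulFun _ (lsign s j) (W j) (Θ j ψ)), hΘ j ψ,
      mulFun_ae _ (lsign s j) (W j) (Θ j ψ), ae_restrict_mem (measurableSet_cell (hBd j))]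
      with x h1 h2 h3 h4 α
    have h5 := hasSum_of_weighted hL hs hD zero_le_one le_rfl (lsign s j • x) h2 ⟨j, (0, α)⟩
    convert h5 using 1
    rw [perVal, reduce_of_mem_cell (hBd j) h4]
    change ((Ev j).compLpL 2 _ (mulFun _ (lsign s j) (W j) (Θ j ψ)) x) α = _
    rw [h1, h3, hW j _ (by rw [norm_lsign hs]; exact hd j x h4), siteWt_origin]
    simp [Ev]
    rfl
  · rw [hB j] at hK
    obtain ⟨R₀, h1, h2⟩ := exists_shift (L := L) hs j (zero_mem _) hK
    rw [zero_add] at h2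
    have h3 : lsign s j • (x + K) = lsign s j • x + shiftPt s R₀ := by rw [smul_add, h2]
    rw [h3, hasSum_fibVal_shift hL hB hs hD]
    have h4 : shiftSites R₀ (⟨j, (0, α)⟩ : Sites L 𝒜) = ⟨j, (0, α)⟩ := by
      have : R₀ j = 0 := Subtype.ext h1
      simp [shiftSites, this]
    rw [h4, perVal_periodic (hBd j) _ K (by rw [hB j]; exact hK)]
    exact hx α

/-- `IsFibred` speaks only of sites at the origin. All other sites are reached by covariance, at the
price of countably many null sets. -/
theorem IsFibred.ae_hasSum (hL : ∀ j, (L j).det ≠ 0) (hB : ∀ j, B j = L (other j)) (hs : s ^ 2 = 1)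
    {D : HopData 𝒜} (hD : D.IsGood L) {T : TorusSpace B 𝒜 →L[ℂ] TorusSpace B 𝒜}
    (hT : IsFibred B L s D T) (ψ : TorusSpace B 𝒜) : ∀ᵐ y : Plane, ∀ p : Sites L 𝒜,
      HasSum (fun q => fiberKer L s D y p q * fibVal B s ψ y q) (fibVal B s (T ψ) y p) := by
  filter_upwards [ae_fibVal (L := L) (𝒜 := 𝒜) hs fun j => hT ψ j]
  rintro y hy ⟨j, R, α⟩
  have h1 := hy ⟨j, R, α⟩ α
  obtain ⟨R₀, h2, h3⟩ := exists_shift (L := L) hs j R.2 (zero_mem _)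
  rw [add_zero] at h3
  simp only at h1
  rw [smul_add, smul_smul, lsign_sq hs, one_smul, ← h3, hasSum_fibVal_shift hL hB hs hD] at h1
  have h4 : shiftSites R₀ (⟨j, (0, α)⟩ : Sites L 𝒜) = ⟨j, (R, α)⟩ := by
    have : R₀ j = R := Subtype.ext h2
    simp [shiftSites, this]
  rw [h4] at h1
  exact h1

/-! ### Observables on the torus spaces and their hopping functions. -/

section Observables

variable {n : ℕ} {γ : Fin n → ℝ → ℂ} {g : (Fin n → ℂ) → ℂ} {D : Fin n → HopData 𝒜}

/-- The observables act on the fibres by the fibre observables. -/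
theorem ae_hasSum_obs (hL : ∀ j, (L j).det ≠ 0) (hB : ∀ j, B j = L (other j)) (hs : s ^ 2 = 1)
    (hD : ∀ k, (D k).IsGood L)
    (hinc : lattice (recip (L 0)) ⊓ lattice (recip (L 1)) = ⊥) (hγ : IsContourData γ g)
    (h0 : AvoidsSpectra γ fun k => fiberOp L s (D k) 0)
    {T : Fin n → TorusSpace B 𝒜 →L[ℂ] TorusSpace B 𝒜} (hT : ∀ k, IsFibred B L s (D k) (T k))
    (hTγ : AvoidsSpectra γ T) (ψ : TorusSpace B 𝒜) (j : Fin 2) :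
    ∀ᵐ x ∂(volume.restrict (cell (B j))), ∀ α, HasSum (fun q : Sites L 𝒜 =>
      entry (fiberObs L s γ g D (lsign s j • x)) ⟨j, (0, α)⟩ q * fibVal B s ψ (lsign s j • x) q)
      (perVal (B j) ((obs γ g T ψ) j) x α) := by
  have hBd : ∀ j, (B j).det ≠ 0 := fun j => by rw [hB]; exact hL _
  obtain ⟨d, hd0, hd⟩ := exists_norm_le_of_mem_cell (B j)
  obtain ⟨ε, hε, hε1, W, hW, hWγ⟩ := exists_wtFamily hL hs hD hinc hγ h0 hd0
  set μ := volume.restrict (cell (B j)) with hμ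
  obtain ⟨Θ, hΘ⟩ : ∃ Θ : TorusSpace B 𝒜 →L[ℂ] Lp (SiteSpace L 𝒜) 2 μ, ∀ ψ, ∀ᵐ x ∂μ, ∀ q,
      Θ ψ x q = (((siteWt ε q ^ 3)⁻¹ : ℝ) : ℂ) * fibVal B s ψ (lsign s j • x) q :=
    exists_fibreMap (𝒜 := 𝒜) (L := L) hL hBd hs j hε hε1
  -- The weighted fibre map intertwines each Hamiltonian with multiplication by its weighted fibre
  -- operators. It therefore intertwines the observables too.
  have hint : ∀ k, Θ ∘L T k = mulAlgHom μ (lsign s j) (W k) ∘L Θ := fun k => by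
    ext1 φ
    refine Lp.ext ?_
    have h1 := ae_smul_add (v := 0) (s := lsign s j) (by rw [sq, lsign_sq hs])
      ((hT k).ae_hasSum hL hB hs (hD k) φ)
    filter_upwards [hΘ φ, hΘ (T k φ), mulAlgHom_ae μ (lsign s j) (W k) (Θ φ),
      ae_restrict_of_ae h1, ae_restrict_mem (measurableSet_cell (hBd j))] with x h2 h3 h4 h5 h6
    rw [add_zero] at h5
    change Θ (T k φ) x = mulAlgHom μ (lsign s j) (W k) (Θ φ) x
    rw [h4, hW k _ (by rw [norm_lsign hs]; exact hd x h6)]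
    ext p
    rw [h3, (h5 p).unique (hasSum_of_weighted hL hs (hD k) hε.le hε1 (lsign s j • x) h2 p)]
    have h7 : ((siteWt ε p : ℝ) : ℂ) ≠ 0 := by exact_mod_cast (siteWt_pos hε.le p).ne'
    push_cast
    rw [inv_mul_cancel_left₀ (pow_ne_zero 3 h7)]
  have hmap := comp_obs hγ hTγ (hWγ.map (mulAlgHom μ (lsign s j))) hint
  -- Multiplication is an algebra homomorphism, so the observable of the multiplication operators is
  -- multiplication by the observable of the weighted family.
  rw [← map_obs hγ hWγ (mulAlgHom μ (lsign s j)) (continuous_mulAlgHom μ _)] at hmap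
  have hmap' : Θ (obs γ g T ψ) = mulAlgHom μ (lsign s j) (obs γ g W) (Θ ψ) :=
    congrArg (fun S : TorusSpace B 𝒜 →L[ℂ] Lp (SiteSpace L 𝒜) 2 μ => S ψ) hmap
  have h1 := hΘ (obs γ g T ψ)
  rw [hmap'] at h1
  filter_upwards [h1, hΘ ψ, mulAlgHom_ae μ (lsign s j) (obs γ g W) (Θ ψ),
    ae_restrict_mem (measurableSet_cell (hBd j))] with x h2 h3 h4 h6 α
  have h5 := h2 ⟨j, (0, α)⟩
  rw [h4, siteWt_origin, fibVal] at h5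
  simp only [one_pow, inv_one, Complex.ofReal_one, one_mul, smul_smul, lsign_sq hs, one_smul,
    ZeroMemClass.coe_zero, add_zero] at h5
  rw [← h5]
  have h7 := hasSum_entry (obs γ g W (lsign s j • x)) (Θ ψ x) ⟨j, (0, α)⟩
  suffices h8 : ∀ q, entry (fiberObs L s γ g D (lsign s j • x)) ⟨j, (0, α)⟩ q *
      fibVal B s ψ (lsign s j • x) q =
      entry (obs γ g W (lsign s j • x)) ⟨j, (0, α)⟩ q * Θ ψ x q by
    simp only [h8]
    exact h7
  intro q
  have h9 := entry_fiberObs_eq hL hs hD hinc hγ h0 hε.le hε1 hW hWγ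
    (y := lsign s j • x) (by rw [norm_lsign hs]; exact hd x h6) ⟨j, (0, α)⟩ q
  rw [siteWt_origin, one_pow, inv_one, Complex.ofReal_one, one_mul] at h9
  rw [h9, h3]
  ring

/-- The hopping functions of the observable. -/
def obsHop (L : Fin 2 → Matrix (Fin 2) (Fin 2) ℝ) (s : ℝ) (γ : Fin n → ℝ → ℂ)
    (g : (Fin n → ℂ) → ℂ) (D : Fin n → HopData 𝒜) (j : Fin 2) (R : lattice (L j)) (x : Plane) :
    Matrix (𝒜 j) (𝒜 j) ℂ :=
  Matrix.of fun α β => entry (fiberObs L s γ g D (lsign s j • x)) ⟨j, (0, α)⟩ ⟨j, (-R, β)⟩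

theorem obsHop_periodic (hL : ∀ j, (L j).det ≠ 0) (hs : s ^ 2 = 1) (hD : ∀ k, (D k).IsGood L)
    (hinc : lattice (recip (L 0)) ⊓ lattice (recip (L 1)) = ⊥) (hγ : IsContourData γ g)
    (h0 : AvoidsSpectra γ fun k => fiberOp L s (D k) 0) (j : Fin 2) (R : lattice (L j)) :
    LatPeriodic (L (other j)) (obsHop L s γ g D j R) := fun K hK x => by
  ext α β
  obtain ⟨R₀, h1, h2⟩ := exists_shift (L := L) hs j (zero_mem _) hK
  rw [zero_add] at h2
  have h3 : R₀ j = 0 := Subtype.ext h1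
  simp only [obsHop, Matrix.of_apply]
  rw [smul_add, ← h2, entry_fiberObs_shift hL hs hD hinc hγ h0]
  simp [shiftSites, h3]

theorem continuous_obsHop (hL : ∀ j, (L j).det ≠ 0) (hs : s ^ 2 = 1) (hD : ∀ k, (D k).IsGood L)
    (hinc : lattice (recip (L 0)) ⊓ lattice (recip (L 1)) = ⊥) (hγ : IsContourData γ g)
    (h0 : AvoidsSpectra γ fun k => fiberOp L s (D k) 0) (j : Fin 2) (R : lattice (L j)) (α β : 𝒜 j) :
    Continuous fun x => obsHop L s γ g D j R x α β :=
  (continuousOn_entry_fiberObs hL hs hD hinc hγ h0 ⟨j, (0, α)⟩ ⟨j, (-R, β)⟩).comp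
    (continuous_const_smul (lsign s j))

/-- A row at the origin of the fibre observable acts on the fibre values, and the site `-R` carries
the value at `x - R`. Summability comes from the decay of that row, on the cell first and everywhere
by periodicity. -/
theorem isBlockHopping_obsHop (hL : ∀ j, (L j).det ≠ 0) (hB : ∀ j, B j = L (other j))
    (hs : s ^ 2 = 1) (hD : ∀ k, (D k).IsGood L)
    (hinc : lattice (recip (L 0)) ⊓ lattice (recip (L 1)) = ⊥) (hγ : IsContourData γ g)
    (h0 : AvoidsSpectra γ fun k => fiberOp L s (D k) 0)
    {T : Fin n → TorusSpace B 𝒜 →L[ℂ] TorusSpace B 𝒜} (hT : ∀ k, IsFibred B L s (D k) (T k))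
    (hTγ : AvoidsSpectra γ T) (j : Fin 2) :
    IsBlockHopping (obs γ g T) L j (obsHop L s γ g D j) := by
  have hBd : ∀ j, (B j).det ≠ 0 := fun j => by rw [hB]; exact hL _
  have hper : ∀ R, LatPeriodic (B j) (obsHop L s γ g D j R) := fun R => by
    rw [hB j]
    exact obsHop_periodic hL hs hD hinc hγ h0 j R
  refine ⟨continuous_obsHop hL hs hD hinc hγ h0 j, hper, ?_, fun φ => ?_⟩
  · obtain ⟨d, hd0, hd⟩ := exists_norm_le_of_mem_cell (B j)
    obtain ⟨C, hC⟩ := exists_norm_entry_fiberObs_le hL hs hD hinc hγ h0 d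
    refine ⟨fun R => C * dec 3 (R : Plane), ?_, fun R x α β => ?_⟩
    · have := summable_dec (hL j) le_rfl 0
      simp only [zero_add] at this
      exact this.mul_left C
    · obtain ⟨K, hK, hx⟩ := exists_lattice_add_mem_cell (hBd j) x
      rw [← hper R K hK x]
      have := hC (lsign s j • (x + K)) (by rw [norm_lsign hs]; exact hd _ hx) ⟨j, (0, α)⟩
        ⟨j, (-R, β)⟩ rfl
      rw [AddSubgroup.coe_neg, dec_neg] at this
      exact this
  · refine ae_of_ae_cell (hBd j) ?_ fun K hK x hx α => ?_
    · have h1 : ∀ i, ∀ᵐ x : Plane, i ≠ j → ∀ α,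
          perVal (B i) ((PiLp.single 2 j φ : TorusSpace B 𝒜) i) x α = 0 := fun i => by
        by_cases hij : i = j
        · exact Eventually.of_forall fun x h => absurd hij h
        · have h2 : (PiLp.single 2 j φ : TorusSpace B 𝒜) i = 0 := by
            simp [hij]
          rw [h2]
          filter_upwards [ae_reduce (hBd i) (Lp.coeFn_zero (EuclideanSpace ℂ (𝒜 i)) 2 _)]
            with x hx _ α
          rw [perVal, hx]
          rfl
      have h2 := ae_smul_add (v := 0) (s := lsign s j) (by rw [sq, lsign_sq hs])
        (ae_fibVal (L := L) (𝒜 := 𝒜) hs h1)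
      filter_upwards [ae_hasSum_obs hL hB hs hD hinc hγ h0 hT hTγ (PiLp.single 2 j φ) j,
        ae_restrict_of_ae h2] with x h3 h4 α
      rw [add_zero] at h4
      rw [hasSum_sites (h3 α) j]
      have h5 : ∀ (R : lattice (L (other j))) (β : 𝒜 (other j)),
          fibVal B s (PiLp.single 2 j φ) (lsign s j • x) (⟨other j, (R, β)⟩ : Sites L 𝒜) = 0 :=
        fun R β => h4 ⟨other j, (R, β)⟩ (ne_other j).symm β
      simp only [h5, mul_zero, Finset.sum_const_zero, tsum_zero, add_zero]
      rw [← (Equiv.neg (lattice (L j))).tsum_eq]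
      refine tsum_congr fun R => Finset.sum_congr rfl fun β _ => ?_
      rw [Equiv.neg_apply, fibVal]
      simp only [smul_smul, lsign_sq hs, one_smul, AddSubgroup.coe_neg, ← sub_eq_add_neg]
      rw [PiLp.single_eq_same]
      rfl
    · rw [perVal_periodic (hBd j) _ K hK, hx α]
      refine tsum_congr fun R => Finset.sum_congr rfl fun β _ => ?_
      rw [hper R K hK, add_sub_right_comm, perVal_periodic (hBd j) _ K hK]

end Observables

end

noncomputable section

variable {𝒜 : Fin 2 → Type u} [∀ j, Fintype (𝒜 j)] {A B L : Fin 2 → Matrix (Fin 2) (Fin 2) ℝ} {s : ℝ}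

theorem other_other (j : Fin 2) : other (other j) = j := by
  revert j; decide

/-! ### The hopping data of a hopping function -/

/-- Fourier modes of the intralayer functions, together with the interlayer functions. -/
def Hopping.data (B₁ : Fin 2 → Matrix (Fin 2) (Fin 2) ℝ) (h : Hopping 𝒜) : HopData 𝒜 where
  intra j R x := mode₁ (B₁ j) (h.intra j) R x
  inter := h.inter

/-- Smoothness of the intralayer functions gives decaying, uniformly Lipschitz Fourier modes, and
exponential decay handles the interlayer functions. Finiteness of the layers and orbitals allows
common constants. -/
theorem isGood_data {B₁ : Fin 2 → Matrix (Fin 2) (Fin 2) ℝ} (hL : ∀ j, (L j).det ≠ 0)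
    (hB₁ : ∀ j, (B₁ j).det ≠ 0) (hlat : ∀ j, recip (B₁ j) = L j) {h : Hopping 𝒜}
    (hf : ∀ j α β, SmoothPer (B₁ j) (L (other j)) fun x y => h.intra j x y α β)
    (hc : ∀ i j hij α β, Continuous fun x => h.inter i j hij x α β)
    (hd : ∀ i j hij, ExpDecay (h.inter i j hij)) : (h.data B₁).IsGood L where
  periodic j R _ K hK x := by
    ext α β
    change fcoef (B₁ j) _ R = fcoef (B₁ j) _ R
    congr 1
    funext ξ
    exact (hf j α β).per₂ K hK ξ x
  intra_decay N := by
    choose C hC0 hC using fun c : Σ j, 𝒜 j × 𝒜 j =>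
      (hf c.1 c.2.1 c.2.2).fcoef_decay (hB₁ c.1) (hL _) N
    obtain ⟨M, hM⟩ := Finite.exists_le C
    refine ⟨max M 0, le_max_right _ _, fun j R hR x α β => ?_⟩
    rw [← hlat] at hR
    exact (hC ⟨j, (α, β)⟩ R hR x).trans (mul_le_mul_of_nonneg_right
      ((hM ⟨j, (α, β)⟩).trans (le_max_left _ _)) (dec_nonneg _ _))
  inter_decay N := by
    choose C hC0 hC using fun c : {c : Fin 2 × Fin 2 // c.1 ≠ c.2} =>
      (hd c.1.1 c.1.2 c.2).exists_le_dec N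
    obtain ⟨M, hM⟩ := Finite.exists_le C
    exact ⟨max M 0, le_max_right _ _, fun i j hij x α β => (hC ⟨(i, j), hij⟩ x α β).trans
      (mul_le_mul_of_nonneg_right ((hM ⟨(i, j), hij⟩).trans (le_max_left _ _)) (dec_nonneg _ _))⟩
  intra_unif ε hε := by
    choose C hC0 hC using fun c : Σ j, 𝒜 j × 𝒜 j =>
      (hf c.1 c.2.1 c.2.2).fcoef_lipschitz (hB₁ c.1) (hL _)
    obtain ⟨M, hM⟩ := Finite.exists_le C
    refine ⟨ε / (max M 0 + 1), by positivity, fun x x' hx j R _ α β => ?_⟩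
    refine (hC ⟨j, (α, β)⟩ R x x').trans ?_
    rw [lt_div_iff₀ (by positivity)] at hx
    have h1 := (hM ⟨j, (α, β)⟩).trans (le_max_left _ (0 : ℝ))
    nlinarith [norm_nonneg (x - x')]
  inter_unif ε hε := by
    have h1 : ∀ i j hij α β, ∀ᶠ p in uniformity Plane,
        ‖h.inter i j hij p.1 α β - h.inter i j hij p.2 α β‖ ≤ ε := fun i j hij α β => by
      obtain ⟨C, -, hC⟩ := (hd i j hij).exists_le_dec 1
      have h2 := uniformContinuous_of_le_dec (hc i j hij α β) fun x => hC x α β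
      have h3 := h2 (Metric.dist_mem_uniformity hε)
      filter_upwards [h3] with p hp
      have hp' : dist (h.inter i j hij p.1 α β) (h.inter i j hij p.2 α β) < ε := hp
      rw [← dist_eq_norm]
      exact hp'.le
    have h2 : ∀ᶠ p in uniformity Plane, ∀ i j hij α β,
        ‖h.inter i j hij p.1 α β - h.inter i j hij p.2 α β‖ ≤ ε := by
      simp only [eventually_all]
      exact h1
    obtain ⟨δ, hδ, h3⟩ := Metric.mem_uniformity_dist.1 h2
    exact ⟨δ, hδ, fun x x' hx => h3 (by rwa [dist_eq_norm])⟩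

theorem det_rlLat (hA : ∀ j, (A j).det ≠ 0) (j : Fin 2) : (rlLat A j).det ≠ 0 := hA j

theorem det_rpLat (hA : ∀ j, (A j).det ≠ 0) (j : Fin 2) : (rpLat A j).det ≠ 0 :=
  det_recip_ne_zero (hA _)

theorem cfTori_eq (j : Fin 2) : cfTori A j = rlLat A (other j) := rfl

theorem msTori_eq (j : Fin 2) : msTori A j = rpLat A (other j) := by
  rw [msTori, rpLat, other_other]

theorem Hopping.IsCfHerm.isGood_cf (hA : ∀ j, (A j).det ≠ 0) {h : Hopping 𝒜} (hh : h.IsCfHerm A) :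
    (h.data fun j => recip (A j)).IsGood (rlLat A) :=
  isGood_data (det_rlLat hA) (fun j => det_recip_ne_zero (hA j)) (fun j => recip_recip (hA j))
    (fun j => (hh.analytic j).smoothPer) (fun i j hij => (hh.interlayer i j hij).continuous)
    fun i j hij => (hh.interlayer i j hij).decay

theorem SmoothPer.conj_swap {B₁ B₂ : Matrix (Fin 2) (Fin 2) ℝ} {f : Plane → Plane → ℂ}
    (hf : SmoothPer B₁ B₂ f) : SmoothPer B₂ B₁ fun b q => star (f (-q) b) where
  contDiff := by
    have h1 : ContDiff ℝ ∞ fun p : Plane × Plane => f (-p.2) p.1 :=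
      hf.contDiff.comp (contDiff_snd.neg.prodMk contDiff_fst)
    exact (Complex.conjCLE.toContinuousLinearMap.contDiff).comp h1
  per₁ K hK x y := by rw [hf.per₂ K hK]
  per₂ K hK x y := by rw [neg_add, hf.per₁ _ (neg_mem hK)]

theorem continuous_fourierPlane {𝓂 𝓃 : Type u} {f : Plane → Matrix 𝓂 𝓃 ℂ} (hf : IsInterlayer f)
    (α : 𝓂) (β : 𝓃) : Continuous fun ξ => fourierPlane f ξ α β := by
  obtain ⟨C, -, hC⟩ := hf.decay.exists_le_dec 3
  exact continuous_const.mul (continuous_integral_expI (hf.continuous α β) fun x => hC x α β)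

theorem Hopping.IsCfHerm.isGood_ms (hA : ∀ j, (A j).det ≠ 0) {h : Hopping 𝒜} (hh : h.IsCfHerm A) :
    ((h.dual A).data fun j => A (other j)).IsGood (rpLat A) := by
  refine isGood_data (det_rpLat hA) (fun j => hA _) (fun j => rfl) (fun j α β => ?_)
    (fun i j hij α β => ?_) fun i j hij => ?_
  · rw [← msTori_eq]
    exact ((hh.analytic j).smoothPer β α).conj_swap
  · exact continuous_const.mul (continuous_fourierPlane (hh.interlayer i j hij) α β)
  · obtain ⟨c, hc, C, hC⟩ := (hh.interlayer i j hij).fourier_decay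
    refine ⟨c, hc, ‖((√(cellArea (recip (A 0))) * √(cellArea (recip (A 1))) : ℝ) : ℂ)‖ * C,
      fun x α β => ?_⟩
    simp only [Hopping.dual, Matrix.smul_apply, smul_eq_mul]
    rw [norm_mul, mul_assoc]
    exact mul_le_mul_of_nonneg_left (hC x α β) (norm_nonneg _)

/-! ### The four Hamiltonians as fibred operators and fibre operators -/

/-- `torusOp` is defined by choice with default 0. The operator built from the fibres shows that the
defining formula is realized, so the chosen operator obeys it. -/
theorem isFibred_torusOp (hL : ∀ j, (L j).det ≠ 0) (hB : ∀ j, B j = L (other j)) (hs : s ^ 2 = 1)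
    {D : HopData 𝒜} (hD : D.IsGood L) {F : TorusSpace B 𝒜 → ∀ j, Plane → 𝒜 j → ℂ}
    (hF : ∀ ψ j x α a, HasSum (fun q : Sites L 𝒜 => fiberKer L s D (lsign s j • x) ⟨j, (0, α)⟩ q *
      fibVal B s ψ (lsign s j • x) q) a → F ψ j x α = a) : IsFibred B L s D (torusOp F) := by
  obtain ⟨T, hT⟩ := exists_isFibred hL hB hs hD
  have hex : ∃ T : TorusSpace B 𝒜 →L[ℂ] TorusSpace B 𝒜,
      ∀ ψ j, ∀ᵐ x : Plane, ∀ α, perVal (B j) ((T ψ) j) x α = F ψ j x α := by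
    refine ⟨T, fun ψ j => ?_⟩
    filter_upwards [hT ψ j] with x hx α
    exact (hF ψ j x α _ (hx α)).symm
  rw [torusOp, dif_pos hex]
  intro ψ j
  filter_upwards [hT ψ j, hex.choose_spec ψ j] with x h1 h2 α
  rw [h2, hF ψ j x α _ (h1 α)]
  exact h1 α

theorem siteOp_eq_fiberOp (hL : ∀ j, (L j).det ≠ 0) (hs : s ^ 2 = 1) {D : HopData 𝒜}
    (hD : D.IsGood L) {F : SiteSpace L 𝒜 → Sites L 𝒜 → ℂ}
    (hF : ∀ ψ p a, HasSum (fun q : Sites L 𝒜 => fiberKer L s D 0 p q * ψ q) a → F ψ p = a) :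
    siteOp F = fiberOp L s D 0 := by
  have hex : ∃ T : SiteSpace L 𝒜 →L[ℂ] SiteSpace L 𝒜, ∀ ψ p, (T ψ) p = F ψ p :=
    ⟨fiberOp L s D 0, fun ψ p => (hF ψ p _ (hasSum_fiberOp hL hs hD 0 ψ p)).symm⟩
  rw [siteOp, dif_pos hex]
  ext ψ p
  rw [hex.choose_spec, hF ψ p _ (hasSum_fiberOp hL hs hD 0 ψ p)]

theorem neg_one_sq' : (-1 : ℝ) ^ 2 = 1 := by norm_num

theorem lsign_smul_smul (hs : s ^ 2 = 1) (j : Fin 2) (x : Plane) :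
    lsign s j • lsign s j • x = x := by rw [smul_smul, lsign_sq hs, one_smul]

theorem lsign_other_smul_smul (hs : s ^ 2 = 1) (j : Fin 2) (x : Plane) :
    lsign s (other j) • lsign s j • x = s • x := by
  rw [lsign_other hs, mul_smul, lsign_smul_smul hs]

/-- The formula for the configuration space Hamiltonian. -/
def cfForm (A : Fin 2 → Matrix (Fin 2) (Fin 2) ℝ) (h : Hopping 𝒜) (ψ : TorusSpace (cfTori A) 𝒜)
    (j : Fin 2) (b : Plane) (α : 𝒜 j) : ℂ :=
  (∑' R : lattice (A j), ∑ β, mode₁ (recip (A j)) (h.intra j) R b α β *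
    perVal (cfTori A j) (ψ j) (b - R) β) +
  ∑' R : lattice (A (other j)), ∑ β, h.inter j (other j) (ne_other j) (b - R) α β *
    perVal (cfTori A (other j)) (ψ (other j)) (-b + R) β

/-- The fibre sum splits into the two layers. Within the layer, the sum over sites becomes the sum
over hops after `R ↦ -R`. -/
theorem cfForm_eq_of_hasSum {h : Hopping 𝒜} {ψ : TorusSpace (cfTori A) 𝒜} {j : Fin 2} {x : Plane}
    {α : 𝒜 j} {a : ℂ} (ha : HasSum (fun q : Sites (rlLat A) 𝒜 =>
      fiberKer (rlLat A) (-1) (h.data fun j => recip (A j)) (lsign (-1) j • x) ⟨j, (0, α)⟩ q *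
        fibVal (cfTori A) (-1) ψ (lsign (-1) j • x) q) a) : cfForm A h ψ j x α = a := by
  rw [hasSum_sites ha j]
  refine congrArg₂ (· + ·) ?_ ?_
  · rw [← (Equiv.neg (lattice (A j))).tsum_eq]
    refine tsum_congr fun R => Finset.sum_congr rfl fun β _ => ?_
    refine Eq.trans ?_ (congrArg (· * _) (fiberKer_same _ j 0 R α β).symm)
    simp only [fibVal, lsign_smul_smul neg_one_sq', Equiv.neg_apply, AddSubgroup.coe_neg,
      ZeroMemClass.coe_zero, add_zero, zero_sub, sub_neg_eq_add]
    rfl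
  · refine tsum_congr fun R => Finset.sum_congr rfl fun β _ => ?_
    refine Eq.trans ?_ (congrArg (· * _) (fiberKer_ne _ (ne_other j) 0 R α β).symm)
    simp only [fibVal, lsign_smul_smul neg_one_sq', lsign_other_smul_smul neg_one_sq',
      ZeroMemClass.coe_zero, add_zero, neg_smul, one_smul, ← sub_eq_add_neg]
    rfl

theorem isFibred_piCf (hA : ∀ j, (A j).det ≠ 0) {h : Hopping 𝒜} (hh : h.IsCfHerm A) :
    IsFibred (cfTori A) (rlLat A) (-1) (h.data fun j => recip (A j)) (piCf A h) :=
  isFibred_torusOp (F := cfForm A h) (det_rlLat hA) cfTori_eq neg_one_sq' (hh.isGood_cf hA)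
    fun _ _ _ _ _ ha => cfForm_eq_of_hasSum ha

theorem piCf_ae (hA : ∀ j, (A j).det ≠ 0) {h : Hopping 𝒜} (hh : h.IsCfHerm A)
    (ψ : TorusSpace (cfTori A) 𝒜) (j : Fin 2) : ∀ᵐ x : Plane, ∀ α,
      perVal (cfTori A j) ((piCf A h ψ) j) x α = cfForm A h ψ j x α := by
  filter_upwards [isFibred_piCf hA hh ψ j] with x hx α
  exact (cfForm_eq_of_hasSum (hx α)).symm

theorem isFibred_piMs (hA : ∀ j, (A j).det ≠ 0) {h : Hopping 𝒜} (hh : h.IsCfHerm A) :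
    IsFibred (msTori A) (rpLat A) 1 ((h.dual A).data fun j => A (other j))
      (piMs A (h.dual A)) := by
  have hs : (1 : ℝ) ^ 2 = 1 := one_pow 2
  refine isFibred_torusOp (det_rpLat hA) msTori_eq hs (hh.isGood_ms hA) fun ψ j x α a ha => ?_
  rw [hasSum_sites ha j]
  congr 1
  · have h1 : ∀ R : lattice (rpLat A j), ∀ β : 𝒜 j,
        fiberKer (rpLat A) 1 ((h.dual A).data fun j => A (other j)) (lsign 1 j • x)
          ⟨j, (0, α)⟩ ⟨j, (R, β)⟩ *
          fibVal (msTori A) 1 ψ (lsign 1 j • x) (⟨j, (R, β)⟩ : Sites (rpLat A) 𝒜) =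
        mode₁ (A (other j)) ((h.dual A).intra j) (-R) x α β *
          perVal (msTori A j) (ψ j) (x + R) β := fun R β => by
      refine (congrArg (· * _) (fiberKer_same _ j 0 R α β)).trans ?_
      simp only [fibVal, lsign_smul_smul hs, ZeroMemClass.coe_zero, add_zero, zero_sub]
      rfl
    simp only [h1]
    rw [← (Equiv.neg (lattice (recip (A (other j))))).tsum_eq]
    refine tsum_congr fun R => Finset.sum_congr rfl fun β _ => ?_
    simp only [Equiv.neg_apply, AddSubgroup.coe_neg, sub_neg_eq_add]
  · have h1 : ∀ R : lattice (rpLat A (other j)), ∀ β : 𝒜 (other j),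
        fiberKer (rpLat A) 1 ((h.dual A).data fun j => A (other j)) (lsign 1 j • x)
          ⟨j, (0, α)⟩ ⟨other j, (R, β)⟩ *
          fibVal (msTori A) 1 ψ (lsign 1 j • x) (⟨other j, (R, β)⟩ : Sites (rpLat A) 𝒜) =
        (h.dual A).inter j (other j) (ne_other j) (x + R) α β *
          perVal (msTori A (other j)) (ψ (other j)) (x + R) β := fun R β => by
      refine (congrArg (· * _) (fiberKer_ne _ (ne_other j) 0 R α β)).trans ?_
      simp only [fibVal, lsign_smul_smul hs, lsign_other_smul_smul hs,
        ZeroMemClass.coe_zero, add_zero, one_smul]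
      rfl
    simp only [h1]
    rw [← msTori_eq]
    rfl

theorem piRl_eq_fiberOp (hA : ∀ j, (A j).det ≠ 0) {h : Hopping 𝒜} (hh : h.IsCfHerm A) :
    piRl A h = fiberOp (rlLat A) (-1) (h.data fun j => recip (A j)) 0 := by
  refine siteOp_eq_fiberOp (det_rlLat hA) neg_one_sq' (hh.isGood_cf hA) ?_
  rintro ψ ⟨j, R, α⟩ a ha
  rw [hasSum_sites ha j]
  congr 1
  · refine tsum_congr fun R' => Finset.sum_congr rfl fun β _ => ?_
    refine Eq.trans ?_ (congrArg (· * _) (fiberKer_same _ j R R' α β).symm)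
    simp only [smul_zero, zero_add]
    rfl
  · refine tsum_congr fun R' => Finset.sum_congr rfl fun β _ => ?_
    refine Eq.trans ?_ (congrArg (· * _) (fiberKer_ne _ (ne_other j) R R' α β).symm)
    simp only [smul_zero, zero_add, neg_smul, one_smul, ← sub_eq_add_neg]
    rfl

theorem piRp_eq_fiberOp (hA : ∀ j, (A j).det ≠ 0) {h : Hopping 𝒜} (hh : h.IsCfHerm A) :
    piRp A (h.dual A) = fiberOp (rpLat A) 1 ((h.dual A).data fun j => A (other j)) 0 := by
  refine siteOp_eq_fiberOp (det_rpLat hA) (one_pow 2) (hh.isGood_ms hA) ?_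
  rintro ψ ⟨j, R, α⟩ a ha
  rw [hasSum_sites ha j]
  congr 1
  · refine tsum_congr fun R' => Finset.sum_congr rfl fun β _ => ?_
    refine Eq.trans ?_ (congrArg (· * _) (fiberKer_same _ j R R' α β).symm)
    simp only [smul_zero, zero_add]
    rfl
  · refine tsum_congr fun R' => Finset.sum_congr rfl fun β _ => ?_
    refine Eq.trans ?_ (congrArg (· * _) (fiberKer_ne _ (ne_other j) R R' α β).symm)
    simp only [smul_zero, zero_add, one_smul]
    rfl

end

noncomputable section

variable {𝒜 : Fin 2 → Type u} {A B L : Fin 2 → Matrix (Fin 2) (Fin 2) ℝ} {s : ℝ}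

theorem diagEntry_eq_entry {O : SiteSpace L 𝒜 →L[ℂ] SiteSpace L 𝒜} (p : Sites L 𝒜) :
    diagEntry O p = entry O p p := by
  classical
  rw [entry_eq]
  unfold diagEntry
  congr!

variable [∀ j, Fintype (𝒜 j)]

/-! ### Contours -/

section Contours

variable {n : ℕ} {γ : Fin n → ℝ → ℂ} {g : (Fin n → ℂ) → ℂ}

theorem isContourData (hγ : ∀ k, ∃ K, LipschitzOnWith K (γ k) (Set.Icc 0 1))
    (hg : IsAnalyticInside γ g) : IsContourData γ g where
  lipschitz := hγ
  continuousOn := by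
    choose K hK using hγ
    refine hg.continuousOn.comp (f := fun (t : Fin n → ℝ) k => γ k (t k)) ?_ fun t ht k _ =>
      Or.inr ⟨t k, mem_Icc_apply ht k, rfl⟩
    refine continuousOn_pi.2 fun k => ?_
    exact (hK k).continuousOn.comp (continuous_apply k).continuousOn fun t ht => mem_Icc_apply ht k

theorem avoidsSpectra_of_isContourAround {𝔸 : Type*} [NormedRing 𝔸] [NormedAlgebra ℂ 𝔸]
    {a : Fin n → 𝔸} {ε : ℝ} (hε : 0 < ε)
    (h : ∀ k, IsContourAround (γ k) ε (spectrum ℂ (a k))) : AvoidsSpectra γ a := fun k t ht => by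
  by_contra hn
  have := (h k).dist_le t ht (γ k t) hn
  rw [dist_self] at this
  linarith

end Contours

/-! ### The trace of real space operators -/

/-- The product of the areas of the site cell and the torus cell is the same `c` for both layers.
Weights inverse to the former are thus proportional to the latter, which converts the site
normalization into the torus normalization. -/
theorem hasThermoTrace_of_average (hL : ∀ j, (L j).det ≠ 0) (hBd : ∀ j, (B j).det ≠ 0)
    {L' : Fin 2 → Matrix (Fin 2) (Fin 2) ℝ}
    {c : ℝ} (hc : ∀ j, cellArea (L j) * cellArea (B j) = c)
    {O : SiteSpace L 𝒜 →L[ℂ] SiteSpace L 𝒜}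
    {a : ∀ j, lattice (L' j) → Plane → Matrix (𝒜 j) (𝒜 j) ℂ}
    (hcont : ∀ j α, Continuous fun x => a j 0 x α α)
    (h : ∀ j α, Tendsto (latAvg (L j) fun R => diagEntry O ⟨j, (R, α)⟩) atTop
      (𝓝 (((cellArea (B j))⁻¹ : ℂ) * ∫ x in cell (B j), a j 0 x α α))) :
    HasThermoTrace O (hoppingTrace B a) := by
  have hpos := fun j => cellArea_pos (hL j)
  have hposB := fun j => cellArea_pos (hBd j)
  have hc0 : 0 < c := by
    rw [← hc 0]
    exact mul_pos (hpos 0) (hposB 0)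
  have h1 := hasThermoTrace_of_latAvg hL O _ h
  convert h1 using 1
  rw [hoppingTrace]
  have e1 : ∀ j, (Fintype.card (𝒜 j) : ℝ) / cellArea (L j) =
      c⁻¹ * ((Fintype.card (𝒜 j) : ℝ) * cellArea (B j)) := fun j => by
    have := (hpos j).ne'
    have := (hposB j).ne'
    rw [← hc j]
    field_simp
  have e2 : ∀ j, (∑ α, ((cellArea (B j))⁻¹ : ℂ) * ∫ x in cell (B j), a j 0 x α α) / cellArea (L j) =
      (c⁻¹ : ℂ) * ∫ x in cell (B j), (a j 0 x).trace := fun j => by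
    have h1 : ((cellArea (L j) : ℝ) : ℂ) ≠ 0 := by exact_mod_cast (hpos j).ne'
    have h2 : ((cellArea (B j) : ℝ) : ℂ) ≠ 0 := by exact_mod_cast (hposB j).ne'
    have h3 : ∫ x in cell (B j), (a j 0 x).trace = ∑ α, ∫ x in cell (B j), a j 0 x α α := by
      simp only [Matrix.trace, Matrix.diag_apply]
      exact integral_finsetSum _ fun α _ => integrableOn_cell (hcont j α)
    rw [h3, ← Finset.mul_sum, ← hc j]
    push_cast
    field_simp
  simp only [e1, e2]
  simp only [← Finset.mul_sum]
  push_cast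
  rw [mul_inv, inv_inv]
  have hc' : (c : ℂ) ≠ 0 := by exact_mod_cast hc0.ne'
  field_simp

section Observables

variable {n : ℕ} {γ : Fin n → ℝ → ℂ} {g : (Fin n → ℂ) → ℂ} {D : Fin n → HopData 𝒜}

/-- Covariance moves the site `R` to the origin and the configuration from 0 to a lattice vector:
real space samples the zeroth hopping function along the lattice. -/
theorem diagEntry_fiberObs (hL : ∀ j, (L j).det ≠ 0) (hs : s ^ 2 = 1) (hD : ∀ k, (D k).IsGood L)
    (hinc : lattice (recip (L 0)) ⊓ lattice (recip (L 1)) = ⊥) (hγ : IsContourData γ g)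
    (h0 : AvoidsSpectra γ fun k => fiberOp L s (D k) 0) (j : Fin 2) (R : lattice (L j)) (α : 𝒜 j) :
    diagEntry (fiberObs L s γ g D 0) ⟨j, (R, α)⟩ = obsHop L s γ g D j 0 R α α := by
  obtain ⟨R₀, h1, h2⟩ := exists_shift (L := L) hs j R.2 (zero_mem _)
  rw [add_zero] at h2
  have h3 : R₀ j = R := Subtype.ext h1
  have h4 := entry_fiberObs_shift hL hs hD hinc hγ h0 R₀ 0 ⟨j, (0, α)⟩ ⟨j, (0, α)⟩
  rw [zero_add, h2] at h4
  rw [diagEntry_eq_entry, obsHop, Matrix.of_apply, neg_zero, h4]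
  simp [shiftSites, h3]

theorem inf_other {P : Fin 2 → AddSubgroup Plane} (h : P 0 ⊓ P 1 = ⊥) (j : Fin 2) :
    P j ⊓ P (other j) = ⊥ := by
  fin_cases j
  · exact h
  · exact (inf_comm _ _).trans h

/-- Equidistribution of `lattice (L j)` modulo `lattice (B j)` turns the averages of these samples
into integral means. -/
theorem hasThermoTrace_fiberObs (hL : ∀ j, (L j).det ≠ 0) (hB : ∀ j, B j = L (other j))
    (hs : s ^ 2 = 1) (hD : ∀ k, (D k).IsGood L)
    (hinc : lattice (recip (L 0)) ⊓ lattice (recip (L 1)) = ⊥) (hγ : IsContourData γ g)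
    (h0 : AvoidsSpectra γ fun k => fiberOp L s (D k) 0) :
    HasThermoTrace (fiberObs L s γ g D 0) (hoppingTrace B (obsHop L s γ g D)) := by
  have hBd : ∀ j, (B j).det ≠ 0 := fun j => by rw [hB]; exact hL _
  refine hasThermoTrace_of_average hL hBd (c := cellArea (L 0) * cellArea (L 1)) (fun j => ?_)
    (fun j α => continuous_obsHop hL hs hD hinc hγ h0 j 0 α α) fun j α => ?_
  · rw [hB]
    fin_cases j
    · rfl
    · exact mul_comm _ _
  · simp only [diagEntry_fiberObs hL hs hD hinc hγ h0]
    refine tendsto_latAvg_periodic (hL j) (hBd j) ?_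
      (F := fun x => obsHop L s γ g D j 0 x α α) (fun K hK x => ?_)
      (continuous_obsHop hL hs hD hinc hγ h0 j 0 α α)
    · rw [hB]
      exact inf_other (P := fun j => lattice (recip (L j))) hinc j
    · rw [hB] at hK
      have := obsHop_periodic hL hs hD hinc hγ h0 j 0 K hK x
      simp only [this]

end Observables

/-! ### Plane waves -/

section Waves

variable {𝓃 : Type*} [Fintype 𝓃] {C : Matrix (Fin 2) (Fin 2) ℝ}

open Classical in
/-- The plane wave in the orbital `α`. -/
def waveBCF (K : Plane) (α : 𝓃) : Plane →ᵇ EuclideanSpace ℂ 𝓃 :=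
  BoundedContinuousFunction.ofNormedAddCommGroup
    (fun x => expI K x • EuclideanSpace.single α (1 : ℂ))
    ((continuous_expI K).smul continuous_const) 1 fun x => by
      rw [norm_smul, norm_expI, one_mul]
      simp

theorem norm_waveBCF_le (K : Plane) (α : 𝓃) : ‖waveBCF K α‖ ≤ 1 :=
  BoundedContinuousFunction.norm_ofNormedAddCommGroup_le _ zero_le_one _

theorem waveBCF_apply [inst : DecidableEq 𝓃] (K x : Plane) (α β : 𝓃) :
    waveBCF K α x β = if β = α then expI K x else 0 := by
  obtain rfl : inst = fun a b => Classical.propDecidable (a = b) := Subsingleton.elim _ _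
  classical
  change (expI K x • EuclideanSpace.single α (1 : ℂ)) β = _
  rw [PiLp.smul_apply, smul_eq_mul, PiLp.single_apply]
  split_ifs <;> simp

/-- The plane wave in the orbital `α`, as an element of `L²` of the cell. -/
def planeWave (C : Matrix (Fin 2) (Fin 2) ℝ) (K : Plane) (α : 𝓃) :
    Lp (EuclideanSpace ℂ 𝓃) 2 (volume.restrict (cell C)) :=
  BoundedContinuousFunction.toLp 2 (volume.restrict (cell C)) ℂ (waveBCF K α)

theorem planeWave_ae (C : Matrix (Fin 2) (Fin 2) ℝ) (K : Plane) (α : 𝓃) :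
    ∀ᵐ x ∂(volume.restrict (cell C)), planeWave C K α x = waveBCF K α x :=
  BoundedContinuousFunction.coeFn_toLp _ _ ℂ _

theorem perVal_planeWave [DecidableEq 𝓃] (hC : C.det ≠ 0) {K : Plane} (hK : K ∈ lattice (recip C))
    (α : 𝓃) : ∀ᵐ x : Plane, ∀ β,
      perVal C (planeWave C K α) x β = if β = α then expI K x else 0 := by
  filter_upwards [ae_reduce hC (planeWave_ae C K α)] with x hx β
  rw [perVal, hx, waveBCF_apply, LatPeriodic.reduce_eq hC (latPeriodic_expI hC hK)]

end Waves

/-! ### The trace of torus operators -/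

/-- The diagonal matrix element of an operator in the plane wave `G` of the orbital `α` of the
layer `j`. -/
def waveEntry (O : TorusSpace B 𝒜 →L[ℂ] TorusSpace B 𝒜) (j : Fin 2) (α : 𝒜 j) (G : Plane) : ℂ :=
  ∫ x in cell (B j), perVal (B j) ((O (PiLp.single 2 j (planeWave (B j) G α))) j) x α * expI (-G) x

/-- Translation by `R` acts on a plane wave as a phase, which leaves only the integral of the
coefficient `a R`. -/
theorem waveEntry_eq (hBd : ∀ j, (B j).det ≠ 0) {O : TorusSpace B 𝒜 →L[ℂ] TorusSpace B 𝒜}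
    {j : Fin 2} {a : lattice (L j) → Plane → Matrix (𝒜 j) (𝒜 j) ℂ} (ha : IsBlockHopping O L j a)
    (α : 𝒜 j) {G : Plane} (hG : G ∈ lattice (recip (B j))) :
    waveEntry O j α G = ∑' R : lattice (L j), (∫ x in cell (B j), a R x α α) * expI (-(R : Plane)) G := by
  classical
  obtain ⟨M, hM, hMa⟩ := ha.summable
  have h1 : ∀ᵐ x : Plane, perVal (B j) ((O (PiLp.single 2 j (planeWave (B j) G α))) j) x α *
      expI (-G) x = ∑' R : lattice (L j), a R x α α * expI (-(R : Plane)) G := by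
    have h2 : ∀ᵐ x : Plane, ∀ R : lattice (L j), ∀ β, perVal (B j) (planeWave (B j) G α) (x - R) β =
        if β = α then expI G (x - R) else 0 := ae_all_iff.2 fun R => by
      have := ae_smul_add (one_pow 2) (-(R : Plane)) (perVal_planeWave (hBd j) hG α)
      simpa only [one_smul, ← sub_eq_add_neg] using this
    filter_upwards [ha.repr (planeWave (B j) G α), h2] with x h3 h4
    rw [h3, ← tsum_mul_right]
    refine tsum_congr fun R => ?_
    simp only [h4, mul_ite, mul_zero, Finset.sum_ite_eq', Finset.mem_univ, if_true]
    have h5 : expI G (x - R) * expI (-G) x = expI (-(R : Plane)) G := by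
      rw [sub_eq_add_neg, expI_add_right, mul_right_comm, expI_mul_neg, one_mul, expI_comm]
    rw [mul_assoc, h5]
  have hbound : ∀ R : lattice (L j), ∀ x,
      ‖a R x α α * expI (-(R : Plane)) G‖ ≤ M R := fun R x => by
    rw [norm_mul, norm_expI, mul_one]
    exact hMa R x α α
  have hint : ∀ R : lattice (L j), Integrable (fun x => a R x α α * expI (-(R : Plane)) G)
      (volume.restrict (cell (B j))) := fun R =>
    integrableOn_cell ((ha.continuous R α α).mul continuous_const)
  rw [waveEntry, integral_congr_ae (ae_restrict_of_ae h1),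
    ← integral_tsum_of_summable_integral_norm hint]
  · exact tsum_congr fun R => integral_mul_const _ _
  · refine (hM.mul_right (cellArea (B j))).of_nonneg_of_le
      (fun R => integral_nonneg fun x => norm_nonneg _) fun R => ?_
    have := norm_setIntegral_le_of_norm_le_const (μ := volume)
      (f := fun x => ‖a R x α α * expI (-(R : Plane)) G‖) (volume_cell_lt_top (B j))
      fun x _ => by rw [norm_norm]; exact hbound R x
    exact (le_abs_self _).trans this

/-- Averaging the phases `exp (-i R·G)` over `G` annihilates every `R ≠ 0`, because such an `R` does
not lie in the opposite lattice. -/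
theorem tendsto_latAvg_waveEntry (hL : ∀ j, (L j).det ≠ 0) (hB : ∀ j, B j = L (other j))
    (hinc : lattice (L 0) ⊓ lattice (L 1) = ⊥) {O : TorusSpace B 𝒜 →L[ℂ] TorusSpace B 𝒜}
    {j : Fin 2} {a : lattice (L j) → Plane → Matrix (𝒜 j) (𝒜 j) ℂ} (ha : IsBlockHopping O L j a)
    (α : 𝒜 j) : Tendsto (latAvg (recip (B j)) fun G => waveEntry O j α G) atTop
      (𝓝 (∫ x in cell (B j), a 0 x α α)) := by
  classical
  have hBd : ∀ j, (B j).det ≠ 0 := fun j => by rw [hB]; exact hL _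
  obtain ⟨M, hM, hMa⟩ := ha.summable
  have h1 : ∀ G : lattice (recip (B j)), waveEntry O j α G = _ := fun G => waveEntry_eq hBd ha α G.2
  simp only [h1]
  have h2 := tendsto_latAvg_tsum (det_recip_ne_zero (hBd j))
    (a := fun R : lattice (L j) => ∫ x in cell (B j), a R x α α)
    (l := fun R => if R = 0 then 1 else 0)
    (u := fun R (G : lattice (recip (B j))) => expI (-(R : Plane)) G) ?_ (fun R G => (norm_expI _ _).le)
    fun R => ?_
  · convert h2 using 2
    simp
  · refine (hM.mul_right (cellArea (B j))).of_nonneg_of_le (fun R => norm_nonneg _) fun R => ?_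
    exact norm_setIntegral_le_of_norm_le_const (volume_cell_lt_top (B j)) fun x _ => hMa R x α α
  · split_ifs with hR
    · subst hR
      simp only [ZeroMemClass.coe_zero, neg_zero, expI_zero_left]
      exact tendsto_latAvg_one (det_recip_ne_zero (hBd j))
    · refine tendsto_latAvg_expI (det_recip_ne_zero (hBd j)) fun hmem => hR ?_
      -- The waves run over the reciprocal of the torus lattice, so the lattice to be avoided is its
      -- double reciprocal, the opposite lattice itself.
      rw [recip_recip (hBd j), hB j] at hmem
      have h3 : (R : Plane) ∈ lattice (L j) ⊓ lattice (L (other j)) :=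
        ⟨R.2, by simpa using neg_mem hmem⟩
      rw [inf_other (P := fun j => lattice (L j)) hinc j] at h3
      exact Subtype.ext h3

/-- The integral of the zeroth diagonal coefficient is the limit of averaged plane wave matrix
elements, and these involve only the operator. -/
theorem hoppingTrace_eq (hL : ∀ j, (L j).det ≠ 0) (hB : ∀ j, B j = L (other j))
    (hinc : lattice (L 0) ⊓ lattice (L 1) = ⊥) {O : TorusSpace B 𝒜 →L[ℂ] TorusSpace B 𝒜}
    {a a' : ∀ j, lattice (L j) → Plane → Matrix (𝒜 j) (𝒜 j) ℂ}
    (ha : ∀ j, IsBlockHopping O L j (a j)) (ha' : ∀ j, IsBlockHopping O L j (a' j)) :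
    hoppingTrace B a = hoppingTrace B a' := by
  rw [hoppingTrace, hoppingTrace]
  congr 1
  refine Finset.sum_congr rfl fun j _ => ?_
  have h1 : ∀ {a : ∀ j, lattice (L j) → Plane → Matrix (𝒜 j) (𝒜 j) ℂ},
      (∀ j, IsBlockHopping O L j (a j)) →
      ∫ x in cell (B j), (a j 0 x).trace = ∑ α, ∫ x in cell (B j), a j 0 x α α := fun ha => by
    simp only [Matrix.trace, Matrix.diag_apply]
    exact integral_finsetSum _ fun α _ => integrableOn_cell ((ha j).continuous 0 α α)
  rw [h1 ha, h1 ha']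
  exact Finset.sum_congr rfl fun α _ => tendsto_nhds_unique
    (tendsto_latAvg_waveEntry hL hB hinc (ha j) α) (tendsto_latAvg_waveEntry hL hB hinc (ha' j) α)

end

noncomputable section

/-! ### Fourier coefficients of the hopping functions -/

section Coefficients

variable {B B₁ B₂ : Matrix (Fin 2) (Fin 2) ℝ}

theorem SmoothPer.swap {f : Plane → Plane → ℂ} (hf : SmoothPer B₁ B₂ f) :
    SmoothPer B₂ B₁ fun b q => f q b where
  contDiff := hf.contDiff.comp (contDiff_snd.prodMk contDiff_fst)
  per₁ K hK x y := hf.per₂ K hK y x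
  per₂ K hK x y := hf.per₁ K hK y x

theorem SmoothPer.continuous_fcoef (h₁ : B₁.det ≠ 0) (h₂ : B₂.det ≠ 0) {f : Plane → Plane → ℂ}
    (hf : SmoothPer B₁ B₂ f) (K : Plane) : Continuous fun y => fcoef B₁ (fun x => f x y) K := by
  obtain ⟨C, hC0, hC⟩ := hf.fcoef_lipschitz h₁ h₂
  refine (LipschitzWith.of_dist_le_mul (K := ⟨C, hC0⟩) fun y y' => ?_).continuous
  rw [dist_eq_norm, dist_eq_norm]
  exact hC K y y'

theorem fcoef_star (F : Plane → ℂ) (K : Plane) :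
    fcoef B (fun x => star (F x)) K = star (fcoef B F (-K)) := by
  rw [fcoef, fcoef, star_mul', neg_neg]
  congr 1
  · simp
  · rw [Complex.star_def, ← integral_conj]
    congr 1
    funext x
    rw [map_mul, ← star_expI]
    rfl

theorem fcoef_translate (hB : B.det ≠ 0) {F : Plane → ℂ} (hF : LatPeriodic B F) {K : Plane}
    (hK : K ∈ lattice (recip B)) (v : Plane) :
    fcoef B (fun x => F (x - v)) K = expI (-K) v * fcoef B F K := by
  have h1 := setIntegral_cell_add hB (f := fun x => F (x - v) * expI (-K) x) (fun R hR x => by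
    rw [add_sub_right_comm, hF R hR, expI_add_lattice hB (neg_mem hK) hR]) v
  rw [fcoef, fcoef, ← h1]
  have h2 : ∀ x, F (x + v - v) * expI (-K) (x + v) = expI (-K) v * (F x * expI (-K) x) := fun x => by
    rw [add_sub_cancel_right, expI_add_right]
    ring
  simp only [h2]
  rw [integral_const_mul, mul_left_comm]

theorem fcoef_expI_mul (F : Plane → ℂ) (G K : Plane) :
    fcoef B (fun x => expI G x * F x) K = fcoef B F (K - G) := by
  rw [fcoef, fcoef]
  congr 2
  funext x
  have h1 : expI (-(K - G)) x = expI G x * expI (-K) x := by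
    rw [neg_sub, expI_sub_left]
  rw [h1]
  ring

theorem mode₂_apply {𝓂 𝓃 : Type u} (f : Plane → Plane → Matrix 𝓂 𝓃 ℂ) (L₁ L₂ : Plane) (α : 𝓂)
    (β : 𝓃) : mode₂ B₁ B₂ f L₁ L₂ α β =
      fcoef B₁ (fun ξ => fcoef B₂ (fun b => f ξ b α β) L₂) L₁ := by
  simp only [mode₂, fcoef, Matrix.of_apply]
  rw [mul_inv, mul_assoc, ← integral_const_mul]
  congr 2
  funext ξ
  rw [mul_assoc, ← integral_mul_const]
  congr 2
  funext b
  ring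

end Coefficients

variable {𝒜 : Fin 2 → Type u} {A : Fin 2 → Matrix (Fin 2) (Fin 2) ℝ}
  {h : Hopping 𝒜}

/-- The hermiticity of the intralayer functions, for the Fourier modes in the second variable. -/
theorem fcoef_intra (hA : ∀ j, (A j).det ≠ 0) (hh : h.IsCfHerm A) (l : Fin 2) {K : Plane}
    (hK : K ∈ lattice (recip (A (other l)))) (q : Plane) (α β : 𝒜 l) :
    fcoef (A (other l)) (fun b => h.intra l q b α β) K =
      fcoef (A (other l)) (fun b => star (h.intra l (q - K) b β α)) K := by
  have hR := det_recip_ne_zero (hA l)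
  have hsm := fun α β => ((hh.analytic l).smoothPer α β).swap
  have hper : ∀ α β K, LatPeriodic (recip (A l))
      fun q => fcoef (A (other l)) (fun b => h.intra l q b α β) K := fun α β K P hP q => by
    simp only [(hh.analytic l).periodic₁ P hP]
  have hcont : ∀ α β K, Continuous
      fun q => fcoef (A (other l)) (fun b => h.intra l q b α β) K := fun α β K =>
    (hsm α β).continuous_fcoef (hA _) hR K
  simp only [fcoef_star]
  -- Both sides are continuous and periodic in `q`, so their Fourier coefficients are compared.
  -- Translation by `K` produces precisely the phase of the hermiticity condition.
  refine eq_of_fcoef_eq hR (hper α β K)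
    (G := fun q => star (fcoef (A (other l)) (fun b => h.intra l (q - K) b β α) (-K)))
    (fun P hP q => ?_) (hcont α β K)
    (continuous_star.comp ((hcont β α (-K)).comp (continuous_id.sub continuous_const)))
    (fun R hRm => ?_) q
  · simp only [add_sub_right_comm, (hh.analytic l).periodic₁ P hP]
  · rw [fcoef_star, fcoef_translate hR (hper β α (-K)) (neg_mem hRm), ← mode₂_apply, ← mode₂_apply]
    rw [recip_recip (hA l)] at hRm
    rw [hh.herm_intra l R hRm K hK, neg_neg, star_mul', star_expI]
    simp only [Matrix.smul_apply, Matrix.conjTranspose_apply, smul_eq_mul]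
    rw [expI_neg_left, expI_neg_left, expI_comm]

theorem fiberKer_dual_same (l : Fin 2) (G G' : lattice (rpLat A l)) (α β : 𝒜 l) :
    fiberKer (rpLat A) 1 ((h.dual A).data fun j => A (other j)) 0 ⟨l, (G, α)⟩ ⟨l, (G', β)⟩ =
      fcoef (A (other l)) (fun b => star (h.intra l (-G) b β α)) (G - G') := by
  rw [fiberKer_same, smul_zero, zero_add]
  rfl

theorem fiberKer_dual_ne {i j : Fin 2} (hij : i ≠ j) (G : lattice (rpLat A i))
    (G' : lattice (rpLat A j)) (α : 𝒜 i) (β : 𝒜 j) :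
    fiberKer (rpLat A) 1 ((h.dual A).data fun j => A (other j)) 0 ⟨i, (G, α)⟩ ⟨j, (G', β)⟩ =
      ((√(cellArea (recip (A 0))) * √(cellArea (recip (A 1))) : ℝ) : ℂ) *
        fourierPlane (h.inter i j hij) (G + G') α β := by
  rw [fiberKer_ne _ hij, smul_zero, zero_add, one_smul]
  rfl

/-- The normalization of the plane waves. -/
def waveNorm (A : Fin 2 → Matrix (Fin 2) (Fin 2) ℝ) (j : Fin 2) : ℝ := (√(cellArea (cfTori A j)))⁻¹

/-- Follows from `|Γ*| |Γ| = (2π)²` in each layer. It reconciles the prefactor of the dual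
interlayer function with the normalizations of the plane waves and of the Fourier transform. -/
theorem waveNorm_identity (hA : ∀ j, (A j).det ≠ 0) (j : Fin 2) :
    waveNorm A j * (√(cellArea (recip (A 0))) * √(cellArea (recip (A 1)))) =
      (cellArea (A (other j)))⁻¹ * waveNorm A (other j) * (2 * Real.pi) ^ 2 := by
  have key : ∀ i, √(cellArea (recip (A i))) * √(cellArea (A i)) = 2 * Real.pi := fun i => by
    rw [← Real.sqrt_mul (cellArea_pos (det_recip_ne_zero (hA i))).le, cellArea_recip (hA i),
      Real.sqrt_sq (by positivity)]
  have h0 : ∀ i, √(cellArea (A i)) ≠ 0 := fun i => (Real.sqrt_pos.2 (cellArea_pos (hA i))).ne'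
  have h1 : √(cellArea (recip (A 0))) * √(cellArea (recip (A 1))) =
      √(cellArea (recip (A j))) * √(cellArea (recip (A (other j)))) := by
    fin_cases j
    · rfl
    · exact mul_comm _ _
  have h2 : cellArea (A (other j)) = √(cellArea (A (other j))) * √(cellArea (A (other j))) :=
    (Real.mul_self_sqrt (cellArea_pos (hA _)).le).symm
  have h3 : ∀ i, √(cellArea (recip (A i))) = 2 * Real.pi * (√(cellArea (A i)))⁻¹ := fun i => by
    rw [← key i, mul_inv_cancel_right₀ (h0 i)]
  rw [waveNorm, waveNorm, h1, h3, h3, cfTori, cfTori, other_other]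
  rw [h2]
  have := h0 j
  have := h0 (other j)
  simp only [Real.sqrt_mul_self (Real.sqrt_nonneg _)]
  field_simp

variable [∀ j, Fintype (𝒜 j)]

/-- The Fourier series of the intralayer part of `H` applied to a plane wave. -/
theorem hasSum_fiberKer_same (hA : ∀ j, (A j).det ≠ 0) (hh : h.IsCfHerm A) (l : Fin 2)
    (G' : lattice (rpLat A l)) (α β : 𝒜 l) (x : Plane) :
    HasSum (fun G : lattice (rpLat A l) =>
      fiberKer (rpLat A) 1 ((h.dual A).data fun j => A (other j)) 0 ⟨l, (G, α)⟩ ⟨l, (G', β)⟩ *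
        expI G x)
      (∑' R : lattice (A l), mode₁ (recip (A l)) (h.intra l) R x α β * expI G' (x - R)) := by
  have hsm := (hh.analytic l).smoothPer α β
  have hRl := det_recip_ne_zero (hA l)
  -- By hermiticity, the column `G'` of the dual matrix consists of the Fourier coefficients of the
  -- single function `x ↦ exp (i G'·x) h(-G', x)`.
  have hcoef : ∀ G : lattice (rpLat A l),
      fiberKer (rpLat A) 1 ((h.dual A).data fun j => A (other j)) 0 ⟨l, (G, α)⟩ ⟨l, (G', β)⟩ =
        fcoef (A (other l)) (fun x => expI G' x * h.intra l (-G') x α β) G := fun G => by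
    have hmem : (G : Plane) - G' ∈ lattice (recip (A (other l))) := sub_mem G.2 G'.2
    rw [fiberKer_dual_same, fcoef_expI_mul, fcoef_intra hA hh l hmem, neg_sub_left, sub_add_cancel]
  -- The sum over hops is the Fourier series of `h` in its first variable, evaluated at `-G'`, times
  -- the plane wave.
  have h1 : HasSum (fun R : lattice (A l) => mode₁ (recip (A l)) (h.intra l) R x α β *
      expI G' (x - R)) (expI G' x * h.intra l (-G') x α β) := by
    have h2 := hasSum_fourierSeries hRl (F := fun ξ => h.intra l ξ x α β)
      (fun P hP ξ => by simp only [(hh.analytic l).periodic₁ P hP])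
      (hsm.continuous_left x) (summable_fcoef hRl (hA _) hsm x) (-(G' : Plane))
    rw [recip_recip (hA l)] at h2
    suffices h3 : ∀ R : lattice (A l), mode₁ (recip (A l)) (h.intra l) R x α β * expI G' (x - R) =
        expI G' x * (fcoef (recip (A l)) (fun ξ => h.intra l ξ x α β) R * expI R (-(G' : Plane))) by
      simp only [h3]
      exact h2.mul_left _
    intro R
    rw [sub_eq_add_neg, expI_add_right, expI_neg_right, expI_neg_right, expI_comm (R : Plane)]
    change fcoef (recip (A l)) (fun ξ => h.intra l ξ x α β) R * _ = _
    ring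
  rw [h1.tsum_eq]
  -- The Schur bound on columns supplies the absolute summability needed for Fourier inversion.
  obtain ⟨C, hC⟩ := exists_schurBound_fiberKer (det_rpLat hA) (one_pow 2) (hh.isGood_ms hA) 0
  have hsum : Summable fun G : lattice (rpLat A l) =>
      ‖fcoef (A (other l)) (fun x => expI G' x * h.intra l (-G') x α β) G‖ := by
    have h3 : Function.Injective fun G : lattice (rpLat A l) =>
        (⟨l, (G, α)⟩ : Sites (rpLat A) 𝒜) := fun G G₂ h => by
      simpa using h
    refine ((hC.col_summable ⟨l, (G', β)⟩).comp_injective h3).congr fun G => ?_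
    exact congrArg norm (hcoef G)
  simp only [hcoef]
  refine hasSum_fourierSeries (hA (other l))
    (F := fun x => expI G' x * h.intra l (-(G' : Plane)) x α β) (fun P hP y => ?_)
    ((continuous_expI _).mul (hsm.continuous_right _)) hsum x
  change expI (G' : Plane) (y + P) * h.intra l (-(G' : Plane)) (y + P) α β = _
  rw [(hh.analytic l).periodic₂ P hP, expI_add_lattice (hA (other l)) G'.2 hP]

/-- The Fourier series of the interlayer part of `H` applied to a plane wave. -/
theorem hasSum_fiberKer_ne (hA : ∀ j, (A j).det ≠ 0) (hh : h.IsCfHerm A) (j : Fin 2)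
    (G' : lattice (rpLat A (other j))) (α : 𝒜 j) (β : 𝒜 (other j)) (x : Plane) :
    HasSum (fun G : lattice (rpLat A j) =>
      fiberKer (rpLat A) 1 ((h.dual A).data fun j => A (other j)) 0 ⟨j, (G, α)⟩ ⟨other j, (G', β)⟩ *
        (waveNorm A j * expI G x))
      (∑' R : lattice (A (other j)), h.inter j (other j) (ne_other j) (x - R) α β *
        (waveNorm A (other j) * expI G' (-x + R))) := by
  have hIn := hh.interlayer j (other j) (ne_other j)
  -- Since `-x + R = -(x - R)`, the reflected plane wave depends on `x - R` only, and the interlayer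
  -- sum is the periodization of `k`.
  set k : Plane → ℂ := fun y => h.inter j (other j) (ne_other j) y α β *
    (waveNorm A (other j) * expI (-(G' : Plane)) y) with hk
  have hkc : Continuous k := (hIn.continuous α β).mul (continuous_const.mul (continuous_expI _))
  obtain ⟨C₀, hC₀0, hC₀⟩ := hIn.decay.exists_le_dec 3
  have hkb : ∀ y, ‖k y‖ ≤ C₀ * ‖(waveNorm A (other j) : ℂ)‖ * dec 3 y := fun y => by
    rw [hk, norm_mul, norm_mul, norm_expI, mul_one, mul_right_comm]
    exact mul_le_mul_of_nonneg_right (hC₀ y α β) (norm_nonneg _)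
  have hsumk : ∀ x, (∑' R : lattice (A (other j)), h.inter j (other j) (ne_other j) (x - R) α β *
        (waveNorm A (other j) * expI G' (-x + R))) = ∑' R : lattice (A (other j)), k (x - R) :=
    fun x => tsum_congr fun R => by
      rw [hk]
      simp only
      rw [show (-x + R : Plane) = -(x - R) by abel, expI_neg_right, expI_neg_left]
  rw [hsumk]
  -- Poisson summation: the coefficients of the periodization are values of the Fourier transform,
  -- here at `G + G'`.
  have hcoef : ∀ G : lattice (rpLat A j),
      fiberKer (rpLat A) 1 ((h.dual A).data fun j => A (other j)) 0 ⟨j, (G, α)⟩ ⟨other j, (G', β)⟩ *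
        waveNorm A j = fcoef (A (other j)) (fun x => ∑' R : lattice (A (other j)), k (x - R)) G :=
    fun G => by
      have h1 := setIntegral_periodization (hA (other j)) (f := fun y => k y * expI (-(G : Plane)) y)
        (hkc.mul (continuous_expI _)) (C := C₀ * ‖(waveNorm A (other j) : ℂ)‖) fun y => by
          rw [norm_mul, norm_expI, mul_one]
          exact hkb y
      have h2 : ∀ x, (∑' R : lattice (A (other j)), k (x - R)) * expI (-(G : Plane)) x =
          ∑' R : lattice (A (other j)), k (x - R) * expI (-(G : Plane)) (x - R) := fun x => by
        rw [← tsum_mul_right]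
        refine tsum_congr fun R => ?_
        congr 1
        have := expI_add_lattice (hA (other j)) (neg_mem G.2) R.2 (x - R)
        rw [← this, sub_add_cancel]
      have h3 : ∀ y, k y * expI (-(G : Plane)) y = (waveNorm A (other j) : ℂ) *
          (h.inter j (other j) (ne_other j) y α β * expI (-y) ((G : Plane) + G')) := fun y => by
        rw [hk]
        simp only
        rw [expI_neg_left y, expI_comm y, ← expI_neg_left, neg_add, expI_add_left]
        ring
      rw [fcoef]
      simp only [h2]
      rw [h1]
      simp only [h3]
      rw [integral_const_mul, fiberKer_dual_ne (ne_other j), fourierPlane, Matrix.of_apply]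
      have h4 := congrArg (fun r : ℝ => (r : ℂ)) (waveNorm_identity hA j)
      simp only [Complex.ofReal_mul, Complex.ofReal_inv, Complex.ofReal_pow] at h4
      have h5 : ((2 * Real.pi : ℂ) ^ 2) ≠ 0 := by
        have : (Real.pi : ℂ) ≠ 0 := by exact_mod_cast Real.pi_ne_zero
        exact pow_ne_zero 2 (mul_ne_zero two_ne_zero this)
      push_cast at h4 ⊢
      linear_combination ((((2 * Real.pi : ℂ) ^ 2)⁻¹) *
        ∫ y, h.inter j (other j) (ne_other j) y α β * expI (-y) ((G : Plane) + G')) * h4 +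
        ((cellArea (A (other j)) : ℂ)⁻¹ * waveNorm A (other j) *
        ∫ y, h.inter j (other j) (ne_other j) y α β * expI (-y) ((G : Plane) + G')) *
          mul_inv_cancel₀ h5
  obtain ⟨C, hC⟩ := exists_schurBound_fiberKer (det_rpLat hA) (one_pow 2) (hh.isGood_ms hA) 0
  have hsum : Summable fun G : lattice (rpLat A j) =>
      ‖fcoef (A (other j)) (fun x => ∑' R : lattice (A (other j)), k (x - R)) G‖ := by
    have h3 : Function.Injective fun G : lattice (rpLat A j) =>
        (⟨j, (G, α)⟩ : Sites (rpLat A) 𝒜) := fun G G₂ h => by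
      simpa using h
    refine (((hC.col_summable ⟨other j, (G', β)⟩).comp_injective h3).mul_right
      ‖(waveNorm A j : ℂ)‖).congr fun G => ?_
    rw [← hcoef, norm_mul]
    rfl
  simp only [← mul_assoc, hcoef]
  exact hasSum_fourierSeries (hA (other j)) periodic_periodization
    (continuous_periodization (hA (other j)) hkc hkb) hsum x

end

/-! ### The Fourier isometry from reciprocal space to configuration space. -/

noncomputable section

section Waves

variable {𝓃 : Type*} [Fintype 𝓃] {C : Matrix (Fin 2) (Fin 2) ℝ}

theorem Lp_ext_of_perVal (hC : C.det ≠ 0)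
    {φ φ' : Lp (EuclideanSpace ℂ 𝓃) 2 (volume.restrict (cell C))}
    (h : ∀ᵐ x : Plane, ∀ α, perVal C φ x α = perVal C φ' x α) : φ = φ' := by
  refine Lp.ext ?_
  filter_upwards [ae_restrict_of_ae h, ae_restrict_mem (measurableSet_cell hC)] with x h1 h2
  ext α
  have := h1 α
  rwa [perVal, perVal, reduce_of_mem_cell hC h2] at this

theorem inner_planeWave (hC : C.det ≠ 0) (K : Plane) (α : 𝓃)
    (φ : Lp (EuclideanSpace ℂ 𝓃) 2 (volume.restrict (cell C))) :
    inner ℂ (planeWave C K α) φ = ∫ x in cell C, perVal C φ x α * expI (-K) x := by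
  classical
  rw [L2.inner_def]
  refine integral_congr_ae ?_
  filter_upwards [planeWave_ae C K α, ae_restrict_mem (measurableSet_cell hC)] with x h1 h2
  rw [h1, perVal, reduce_of_mem_cell hC h2, ← star_expI]
  change inner ℂ (expI K x • EuclideanSpace.single α (1 : ℂ)) (φ x) = _
  rw [inner_smul_left, EuclideanSpace.inner_single_left, map_one, one_mul, mul_comm]
  rfl

theorem inner_planeWave_planeWave [DecidableEq 𝓃] (hC : C.det ≠ 0) {K K' : Plane}
    (hK : K ∈ lattice (recip C)) (hK' : K' ∈ lattice (recip C)) (α β : 𝓃) :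
    inner ℂ (planeWave C K α) (planeWave C K' β) =
      if K = K' ∧ α = β then (cellArea C : ℂ) else 0 := by
  rw [inner_planeWave hC]
  have h1 : ∫ x in cell C, perVal C (planeWave C K' β) x α * expI (-K) x =
      ∫ x in cell C, (if α = β then 1 else 0) * expI (K' - K) x := by
    refine integral_congr_ae (ae_restrict_of_ae ?_)
    filter_upwards [perVal_planeWave hC hK' β] with x hx
    rw [hx, expI_sub_left]
    split_ifs <;> simp
  rw [h1, integral_const_mul]
  by_cases hKK : K = K'
  · subst hKK
    simp only [sub_self, expI_zero_left, true_and]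
    split_ifs
    · simp [cellArea, Measure.real]
    · simp
  · rw [setIntegral_expI hC (sub_mem hK' hK) (sub_ne_zero.2 (Ne.symm hKK))]
    simp [hKK]

end Waves

variable {𝒜 : Fin 2 → Type u} [∀ j, Fintype (𝒜 j)] {A : Fin 2 → Matrix (Fin 2) (Fin 2) ℝ}

/-- The normalized plane waves. -/
def waveVec (A : Fin 2 → Matrix (Fin 2) (Fin 2) ℝ) (p : Sites (rpLat A) 𝒜) :
    TorusSpace (cfTori A) 𝒜 :=
  (waveNorm A p.1 : ℂ) • PiLp.single 2 p.1 (planeWave (cfTori A p.1) (p.2.1 : Plane) p.2.2)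

theorem waveVec_same (l : Fin 2) (c : lattice (rpLat A l) × 𝒜 l) :
    (waveVec A ⟨l, c⟩) l = (waveNorm A l : ℂ) • planeWave (cfTori A l) (c.1 : Plane) c.2 := by
  rw [waveVec, PiLp.smul_apply]
  exact congrArg ((waveNorm A l : ℂ) • ·) (Pi.single_eq_same l _)

theorem waveVec_ne {j l : Fin 2} (hjl : j ≠ l) (c : lattice (rpLat A l) × 𝒜 l) :
    (waveVec A ⟨l, c⟩) j = 0 := by
  rw [waveVec, PiLp.smul_apply]
  exact (congrArg ((waveNorm A l : ℂ) • ·) (Pi.single_eq_of_ne hjl _)).trans (smul_zero _)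

theorem inner_waveVec (p : Sites (rpLat A) 𝒜) (ψ : TorusSpace (cfTori A) 𝒜) :
    inner ℂ (waveVec A p) ψ =
      waveNorm A p.1 * inner ℂ (planeWave (cfTori A p.1) (p.2.1 : Plane) p.2.2) (ψ p.1) := by
  rw [PiLp.inner_apply, Finset.sum_eq_single p.1]
  · rw [show p = ⟨p.1, p.2⟩ from rfl, waveVec_same, inner_smul_left, Complex.conj_ofReal]
  · intro j _ hj
    rw [show p = ⟨p.1, p.2⟩ from rfl, waveVec_ne hj, inner_zero_left]
  · simp

theorem det_cfTori (hA : ∀ j, (A j).det ≠ 0) (j : Fin 2) : (cfTori A j).det ≠ 0 := hA _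

theorem waveNorm_sq_mul (hA : ∀ j, (A j).det ≠ 0) (j : Fin 2) :
    (waveNorm A j : ℂ) * (waveNorm A j * cellArea (cfTori A j)) = 1 := by
  have h1 := cellArea_pos (det_cfTori hA j)
  have h2 : waveNorm A j * (waveNorm A j * cellArea (cfTori A j)) = 1 := by
    have h3 := Real.mul_self_sqrt h1.le
    have h4 := (Real.sqrt_pos.2 h1).ne'
    rw [waveNorm]
    field_simp
    nlinarith
  exact_mod_cast h2

theorem orthonormal_waveVec (hA : ∀ j, (A j).det ≠ 0) :
    Orthonormal ℂ (waveVec A : Sites (rpLat A) 𝒜 → TorusSpace (cfTori A) 𝒜) := by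
  classical
  rw [orthonormal_iff_ite]
  rintro ⟨j, G, α⟩ ⟨l, G', β⟩
  rw [inner_waveVec]
  by_cases hjl : j = l
  · subst hjl
    rw [waveVec_same, inner_smul_right,
      inner_planeWave_planeWave (det_cfTori hA j) G.2 G'.2]
    by_cases h : (G : Plane) = G' ∧ α = β
    · obtain ⟨h1, rfl⟩ := h
      obtain rfl := Subtype.ext h1
      simpa using waveNorm_sq_mul hA j
    · rw [if_neg h, if_neg fun h' => h ?_]
      · simp
      · simpa using h'
  · rw [waveVec_ne hjl, inner_zero_right, mul_zero, if_neg]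
    intro h'
    exact hjl (congrArg Sigma.fst h')

/-- The Fourier series, as an isometry. -/
def waveIso (hA : ∀ j, (A j).det ≠ 0) : SiteSpace (rpLat A) 𝒜 →ₗᵢ[ℂ] TorusSpace (cfTori A) 𝒜 :=
  (orthonormal_waveVec hA).orthogonalFamily.linearIsometry

theorem hasSum_waveIso (hA : ∀ j, (A j).det ≠ 0) (u : SiteSpace (rpLat A) 𝒜) :
    HasSum (fun p => u p • waveVec A p) (waveIso hA u) :=
  (orthonormal_waveVec hA).orthogonalFamily.hasSum_linearIsometry u

theorem hasSum_waveIso_apply (hA : ∀ j, (A j).det ≠ 0) (u : SiteSpace (rpLat A) 𝒜) (j : Fin 2) :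
    HasSum (fun c : lattice (rpLat A j) × 𝒜 j => u ⟨j, c⟩ • (waveVec A ⟨j, c⟩) j)
      ((waveIso hA u) j) := by
  set P := PiLp.proj (𝕜 := ℂ) 2
    (fun j => Lp (EuclideanSpace ℂ (𝒜 j)) 2 (volume.restrict (cell (cfTori A j)))) j with hP
  have h1 : HasSum (fun p => P (u p • waveVec A p)) (P (waveIso hA u)) := (hasSum_waveIso hA u).mapL P
  have h2 : ∀ p, P (u p • waveVec A p) = u p • P (waveVec A p) := fun p => map_smul P _ _
  simp only [h2] at h1
  have hinj : Function.Injective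
      fun c : lattice (rpLat A j) × 𝒜 j => (⟨j, c⟩ : Sites (rpLat A) 𝒜) := fun c c' h => by
    simpa using h
  refine (hinj.hasSum_iff (f := fun p : Sites (rpLat A) 𝒜 => u p • P (waveVec A p))
    fun p hp => ?_).2 h1
  obtain ⟨l, c⟩ := p
  have hjl : j ≠ l := fun h => hp (by subst h; exact ⟨c, rfl⟩)
  have h3 : P (waveVec A ⟨l, c⟩) = 0 := waveVec_ne hjl c
  rw [h3, smul_zero]

theorem waveIso_single [inst : DecidableEq (Sites (rpLat A) 𝒜)] (hA : ∀ j, (A j).det ≠ 0)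
    (p : Sites (rpLat A) 𝒜) :
    waveIso hA (lp.single (E := fun _ => ℂ) 2 p (1 : ℂ)) = waveVec A p := by
  have := (orthonormal_waveVec hA).orthogonalFamily.linearIsometry_apply_single (i := p) (1 : ℂ)
  refine this.trans ?_
  simp

/-- For absolutely summable coefficients the series converges uniformly, and its continuous sum
represents the `L²` limit. -/
theorem waveIso_ae (hA : ∀ j, (A j).det ≠ 0) {u : SiteSpace (rpLat A) 𝒜}
    (hu : Summable fun p => ‖u p‖) (j : Fin 2) : ∀ᵐ x : Plane, ∀ α,
      perVal (cfTori A j) ((waveIso hA u) j) x α =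
        ∑' G : lattice (rpLat A j), u ⟨j, (G, α)⟩ * (waveNorm A j * expI G x) := by
  classical
  have hC := det_cfTori hA j
  set F : lattice (rpLat A j) × 𝒜 j → (Plane →ᵇ EuclideanSpace ℂ (𝒜 j)) := fun c =>
    u ⟨j, c⟩ • (waveNorm A j : ℂ) • waveBCF (c.1 : Plane) c.2 with hF
  have hinj : Function.Injective
      fun c : lattice (rpLat A j) × 𝒜 j => (⟨j, c⟩ : Sites (rpLat A) 𝒜) := fun c c' h => by
    simpa using h
  have hFs : Summable F := by
    refine Summable.of_norm_bounded ((hu.comp_injective hinj).mul_right ‖(waveNorm A j : ℂ)‖)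
      fun c => ?_
    rw [hF, norm_smul, norm_smul, ← mul_assoc]
    exact mul_le_of_le_one_right (by positivity) (norm_waveBCF_le _ _)
  have h1 := hasSum_waveIso_apply hA u j
  have h3 : (waveIso hA u) j =
      BoundedContinuousFunction.toLp 2 (volume.restrict (cell (cfTori A j))) ℂ (∑' c, F c) := by
    refine h1.unique ?_
    have h4 := hFs.hasSum.mapL
      (BoundedContinuousFunction.toLp 2 (volume.restrict (cell (cfTori A j))) ℂ)
    suffices h5 : ∀ c, u ⟨j, c⟩ • (waveVec A ⟨j, c⟩) j =
        BoundedContinuousFunction.toLp 2 (volume.restrict (cell (cfTori A j))) ℂ (F c) by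
      simp only [h5]
      exact h4
    intro c
    rw [waveVec_same, hF, map_smul, map_smul]
    rfl
  have h6 : ∀ᵐ x ∂(volume.restrict (cell (cfTori A j))), ((waveIso hA u) j) x = (∑' c, F c) x := by
    rw [h3]
    exact BoundedContinuousFunction.coeFn_toLp _ _ ℂ _
  filter_upwards [ae_reduce hC h6] with x hx α
  rw [perVal, hx]
  have h7 := hFs.hasSum.mapL ((EuclideanSpace.proj α : EuclideanSpace ℂ (𝒜 j) →L[ℂ] ℂ) ∘L
    BoundedContinuousFunction.evalCLM ℂ (reduce (cfTori A j) x))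
  have hinj' : Function.Injective fun G : lattice (rpLat A j) => (G, α) := fun G G' h =>
    (Prod.ext_iff.1 h).1
  have h8 : ∀ c, ((EuclideanSpace.proj α : EuclideanSpace ℂ (𝒜 j) →L[ℂ] ℂ) ∘L
      BoundedContinuousFunction.evalCLM ℂ (reduce (cfTori A j) x)) (F c) =
      u ⟨j, c⟩ * (waveNorm A j * waveBCF (c.1 : Plane) c.2 (reduce (cfTori A j) x) α) := fun c => rfl
  simp only [h8] at h7
  rw [← hinj'.hasSum_iff fun c hc => ?_] at h7
  · refine (h7.tsum_eq.symm.trans (tsum_congr fun G => ?_))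
    simp only [Function.comp_apply]
    rw [waveBCF_apply, if_pos rfl, LatPeriodic.reduce_eq hC (latPeriodic_expI hC G.2)]
  · have hne : α ≠ c.2 := fun h => hc ⟨c.1, by rw [h]⟩
    rw [waveBCF_apply, if_neg hne, mul_zero, mul_zero]

theorem perVal_waveVec_same [∀ j, DecidableEq (𝒜 j)] (hA : ∀ j, (A j).det ≠ 0) (l : Fin 2)
    (G : lattice (rpLat A l)) (β : 𝒜 l) : ∀ᵐ x : Plane, ∀ α,
      perVal (cfTori A l) ((waveVec A ⟨l, (G, β)⟩) l) x α =
        if α = β then waveNorm A l * expI G x else 0 := by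
  rw [waveVec_same]
  filter_upwards [ae_perVal_smul (det_cfTori hA l) (waveNorm A l : ℂ)
    (planeWave (cfTori A l) (G : Plane) β), perVal_planeWave (det_cfTori hA l) G.2 β] with x h1 h2 α
  rw [h1, h2]
  split_ifs <;> simp

theorem perVal_waveVec_ne (hA : ∀ j, (A j).det ≠ 0) {j l : Fin 2} (hjl : j ≠ l)
    (c : lattice (rpLat A l) × 𝒜 l) : ∀ᵐ x : Plane, ∀ α,
      perVal (cfTori A j) ((waveVec A ⟨l, c⟩) j) x α = 0 := by
  rw [waveVec_ne hjl]
  filter_upwards [ae_reduce (det_cfTori hA j)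
    (Lp.coeFn_zero (EuclideanSpace ℂ (𝒜 j)) 2 (volume.restrict (cell (cfTori A j))))] with x hx α
  rw [perVal, hx]
  rfl

theorem ae_sub_lattice (C : Matrix (Fin 2) (Fin 2) ℝ) {P : Plane → Prop} (h : ∀ᵐ x : Plane, P x) :
    ∀ᵐ x : Plane, ∀ R : lattice C, P (x - R) ∧ P (-x + R) := ae_all_iff.2 fun R => by
  have h1 := ae_smul_add (one_pow 2) (-(R : Plane)) h
  have h2 := ae_smul_add neg_one_sq' (R : Plane) h
  simp only [one_smul, neg_smul, ← sub_eq_add_neg] at h1 h2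
  exact h1.and h2

variable {h : Hopping 𝒜}

/-- The heart of the intertwining relation: column `q` of the reciprocal space matrix lists the
Fourier coefficients of the configuration space Hamiltonian applied to the plane wave `q`. -/
theorem cfForm_waveVec_ae (hA : ∀ j, (A j).det ≠ 0) (hh : h.IsCfHerm A)
    (q : Sites (rpLat A) 𝒜) (j : Fin 2) : ∀ᵐ x : Plane, ∀ α,
      HasSum (fun G : lattice (rpLat A j) =>
        fiberKer (rpLat A) 1 ((h.dual A).data fun j => A (other j)) 0 ⟨j, (G, α)⟩ q *
          (waveNorm A j * expI G x)) (cfForm A h (waveVec A q) j x α) := by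
  classical
  obtain ⟨l, G', β⟩ := q
  by_cases hjl : j = l
  · subst hjl
    filter_upwards [ae_sub_lattice (A j) (perVal_waveVec_same hA j G' β),
      ae_sub_lattice (A (other j)) (perVal_waveVec_ne hA (ne_other j).symm (G', β))] with x h1 h2 α
    have h3 := (hasSum_fiberKer_same hA hh j G' α β x).mul_left (waveNorm A j : ℂ)
    have h4 : cfForm A h (waveVec A ⟨j, (G', β)⟩) j x α = waveNorm A j *
        ∑' R : lattice (A j), mode₁ (recip (A j)) (h.intra j) R x α β * expI G' (x - R) := by
      rw [cfForm]
      simp only [(h1 _).1, (h2 _).2, mul_zero, Finset.sum_const_zero, tsum_zero, add_zero, mul_ite,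
        Finset.sum_ite_eq', Finset.mem_univ, if_true]
      rw [← tsum_mul_left]
      exact tsum_congr fun R => mul_left_comm _ _ _
    rw [h4]
    simp only [mul_left_comm (waveNorm A j : ℂ)] at h3
    exact h3
  · have hl : l = other j := by
      revert hjl
      fin_cases j <;> fin_cases l <;> simp [other]
    subst hl
    filter_upwards [ae_sub_lattice (A j) (perVal_waveVec_ne hA (ne_other j) (G', β)),
      ae_sub_lattice (A (other j)) (perVal_waveVec_same hA (other j) G' β)] with x h1 h2 α
    have h3 := hasSum_fiberKer_ne hA hh j G' α β x
    have h4 : cfForm A h (waveVec A ⟨other j, (G', β)⟩) j x α =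
        ∑' R : lattice (A (other j)), h.inter j (other j) (ne_other j) (x - R) α β *
          (waveNorm A (other j) * expI G' (-x + R)) := by
      rw [cfForm]
      simp only [(h1 _).1, (h2 _).2, mul_zero, Finset.sum_const_zero, tsum_zero, zero_add, mul_ite,
        Finset.sum_ite_eq', Finset.mem_univ, if_true]
    rw [h4]
    exact h3

/-- The Fourier series intertwines the Hamiltonians of reciprocal space and of configuration
space. -/
theorem waveIso_comp_piRp (hA : ∀ j, (A j).det ≠ 0) (hh : h.IsCfHerm A) :
    (waveIso hA).toContinuousLinearMap ∘L piRp A (h.dual A) =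
      piCf A h ∘L (waveIso hA).toContinuousLinearMap := by
  classical
  -- It suffices to compare unit vectors. Their images are columns of the matrix, absolutely
  -- summable by the Schur bound, so both sides can be compared pointwise.
  refine lp.ext_continuousLinearMap (by simp) fun q => ContinuousLinearMap.ext_ring ?_
  change waveIso hA (piRp A (h.dual A) (lp.single (E := fun _ => ℂ) 2 q (1 : ℂ))) =
    piCf A h (waveIso hA (lp.single (E := fun _ => ℂ) 2 q (1 : ℂ)))
  rw [waveIso_single, piRp_eq_fiberOp hA hh]
  obtain ⟨C, hC⟩ := exists_schurBound_fiberKer (det_rpLat hA) (one_pow 2) (hh.isGood_ms hA) 0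
  set u := fiberOp (rpLat A) 1 ((h.dual A).data fun j => A (other j)) 0
    (lp.single (E := fun _ => ℂ) 2 q (1 : ℂ)) with hu
  have hup : ∀ p, u p =
      fiberKer (rpLat A) 1 ((h.dual A).data fun j => A (other j)) 0 p q := fun p => by
    rw [← hC.kerOp_single p q, entry_eq]
    rfl
  have hus : Summable fun p => ‖u p‖ := by
    simp only [hup]
    exact hC.col_summable q
  refine PiLp.ext fun j => Lp_ext_of_perVal (det_cfTori hA j) ?_
  filter_upwards [waveIso_ae hA hus j, piCf_ae hA hh (waveVec A q) j,
    cfForm_waveVec_ae hA hh q j] with x h1 h2 h3 α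
  rw [h1, h2, ← (h3 α).tsum_eq]
  simp only [hup]

section Observables

variable {n : ℕ} {γ : Fin n → ℝ → ℂ} {g : (Fin n → ℂ) → ℂ} {h : Fin n → Hopping 𝒜}

/-- The isometry preserves inner products and intertwines the observables. Surjectivity is not
needed, as only matrix elements between plane waves enter. -/
theorem diagEntry_obs_piRp (hA : ∀ j, (A j).det ≠ 0) (hh : ∀ k, (h k).IsCfHerm A)
    (hγ : IsContourData γ g) (hrp : AvoidsSpectra γ fun k => piRp A ((h k).dual A))
    (hcf : AvoidsSpectra γ fun k => piCf A (h k)) (j : Fin 2) (G : lattice (rpLat A j)) (α : 𝒜 j) :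
    diagEntry (obs γ g fun k => piRp A ((h k).dual A)) ⟨j, (G, α)⟩ =
      ((cellArea (cfTori A j))⁻¹ : ℂ) * waveEntry (obs γ g fun k => piCf A (h k)) j α G := by
  classical
  set p : Sites (rpLat A) 𝒜 := ⟨j, (G, α)⟩ with hp
  have h1 := comp_obs hγ hrp hcf (J := (waveIso hA).toContinuousLinearMap)
    fun k => waveIso_comp_piRp hA (hh k)
  have h2 := congrArg (fun T => T (lp.single (E := fun _ => ℂ) 2 p (1 : ℂ))) h1
  change waveIso hA (obs γ g (fun k => piRp A ((h k).dual A)) (lp.single (E := fun _ => ℂ) 2 p 1)) =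
    obs γ g (fun k => piCf A (h k)) (waveIso hA (lp.single (E := fun _ => ℂ) 2 p 1)) at h2
  rw [waveIso_single] at h2
  set v := obs γ g (fun k => piRp A ((h k).dual A)) (lp.single (E := fun _ => ℂ) 2 p 1) with hv
  have h3 : diagEntry (obs γ g fun k => piRp A ((h k).dual A)) p = v p := by
    rw [diagEntry_eq_entry, entry_eq]
  have h4 : v p = inner ℂ (lp.single (E := fun _ => ℂ) 2 p (1 : ℂ)) v := by
    rw [lp.inner_single_left]
    simp
  rw [h3, h4, ← (waveIso hA).inner_map_map, waveIso_single, h2, inner_waveVec,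
    inner_planeWave (det_cfTori hA _), waveVec, map_smul, PiLp.smul_apply]
  have h5 : ∫ x in cell (cfTori A j), perVal (cfTori A j) ((waveNorm A j : ℂ) •
      (obs γ g (fun k => piCf A (h k)) (PiLp.single 2 j (planeWave (cfTori A j) (G : Plane) α))) j) x α *
        expI (-(G : Plane)) x =
      waveNorm A j * waveEntry (obs γ g fun k => piCf A (h k)) j α G := by
    rw [waveEntry, ← integral_const_mul]
    refine integral_congr_ae (ae_restrict_of_ae ?_)
    filter_upwards [ae_perVal_smul (det_cfTori hA j) (waveNorm A j : ℂ) ((obs γ g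
      (fun k => piCf A (h k)) (PiLp.single 2 j (planeWave (cfTori A j) (G : Plane) α))) j)] with x hx
    rw [hx, mul_assoc]
  refine (congrArg ((waveNorm A j : ℂ) * ·) h5).trans ?_
  have h6 := waveNorm_sq_mul hA j
  have h7 : (cellArea (cfTori A j) : ℂ) ≠ 0 := by
    exact_mod_cast (cellArea_pos (det_cfTori hA j)).ne'
  field_simp
  linear_combination waveEntry (obs γ g fun k => piCf A (h k)) j α G * h6

theorem hasThermoTrace_obs_piRp (hA : ∀ j, (A j).det ≠ 0)
    (hinc : lattice (A 0) ⊓ lattice (A 1) = ⊥) (hh : ∀ k, (h k).IsCfHerm A)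
    (hγ : IsContourData γ g) (hrp : AvoidsSpectra γ fun k => piRp A ((h k).dual A))
    (hcf : AvoidsSpectra γ fun k => piCf A (h k))
    {a : ∀ j, lattice (rlLat A j) → Plane → Matrix (𝒜 j) (𝒜 j) ℂ}
    (ha : ∀ j, IsBlockHopping (obs γ g fun k => piCf A (h k)) (rlLat A) j (a j)) :
    HasThermoTrace (obs γ g fun k => piRp A ((h k).dual A)) (hoppingTrace (cfTori A) a) := by
  refine hasThermoTrace_of_average (det_rpLat hA) (det_cfTori hA) (c := (2 * Real.pi) ^ 2)
    (fun j => cellArea_recip (det_cfTori hA j)) (fun j α => (ha j).continuous 0 α α) fun j α => ?_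
  have h1 : (fun G : lattice (rpLat A j) =>
      diagEntry (obs γ g fun k => piRp A ((h k).dual A)) ⟨j, (G, α)⟩) = fun G : lattice (rpLat A j) =>
      ((cellArea (cfTori A j))⁻¹ : ℂ) * waveEntry (obs γ g fun k => piCf A (h k)) j α G :=
    funext fun G => diagEntry_obs_piRp hA hh hγ hrp hcf j G α
  have h2 := (tendsto_latAvg_waveEntry (L := rlLat A) (B := cfTori A) (det_rlLat hA) cfTori_eq hinc
    (ha j) α).const_mul ((cellArea (cfTori A j))⁻¹ : ℂ)
  refine h2.congr fun r => ?_
  rw [h1]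
  exact (latAvg_const_mul (det_rpLat hA j) _ _ r).symm

end Observables

end

end Bilayer

/-! ### Equality of the four traces. -/

theorem theorem2p4 {𝒜 : Fin 2 → Type*} [∀ j, Fintype (𝒜 j)]
    (A : Fin 2 → Matrix (Fin 2) (Fin 2) ℝ) (hA : ∀ j, (A j).det ≠ 0)
    (hinc : Bilayer.Incommensurate A)
    {n : ℕ} (hn : 0 < n)
    (h : Fin n → Bilayer.Hopping 𝒜) (hh : ∀ k, (h k).IsCfHerm A)
    (ε : ℝ) (hε : 0 < ε) (γ : Fin n → ℝ → ℂ)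
    (hγ_rp : ∀ k, Bilayer.IsContourAround (γ k) ε
      (spectrum ℂ (Bilayer.piRp A ((h k).dual A))))
    (hγ_ms : ∀ k, Bilayer.IsContourAround (γ k) ε
      (spectrum ℂ (Bilayer.piMs A ((h k).dual A))))
    (hγ_rl : ∀ k, Bilayer.IsContourAround (γ k) ε (spectrum ℂ (Bilayer.piRl A (h k))))
    (hγ_cf : ∀ k, Bilayer.IsContourAround (γ k) ε (spectrum ℂ (Bilayer.piCf A (h k))))
    (g : (Fin n → ℂ) → ℂ) (hg : Bilayer.IsAnalyticInside γ g) :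
    ∃ τ : ℂ,
      Bilayer.HasThermoTrace
        (Bilayer.observable γ g fun k => Bilayer.piRp A ((h k).dual A)) τ ∧
      Bilayer.HasTorusTrace
        (Bilayer.observable γ g fun k => Bilayer.piMs A ((h k).dual A)) (Bilayer.rpLat A) τ ∧
      Bilayer.HasThermoTrace
        (Bilayer.observable γ g fun k => Bilayer.piRl A (h k)) τ ∧
      Bilayer.HasTorusTrace
        (Bilayer.observable γ g fun k => Bilayer.piCf A (h k)) (Bilayer.rlLat A) τ := by
  open Bilayer in
  have hγ : IsContourData γ g := isContourData (fun k => (hγ_cf k).lipschitz) hg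
  have a_rp := avoidsSpectra_of_isContourAround hε hγ_rp
  have a_ms := avoidsSpectra_of_isContourAround hε hγ_ms
  have a_rl := avoidsSpectra_of_isContourAround hε hγ_rl
  have a_cf := avoidsSpectra_of_isContourAround hε hγ_cf
  have e_rl : (fun k => piRl A (h k)) =
      fun k => fiberOp (rlLat A) (-1) ((h k).data fun j => recip (A j)) 0 :=
    funext fun k => piRl_eq_fiberOp hA (hh k)
  have e_rp : (fun k => piRp A ((h k).dual A)) =
      fun k => fiberOp (rpLat A) 1 (((h k).dual A).data fun j => A (other j)) 0 :=
    funext fun k => piRp_eq_fiberOp hA (hh k)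
  -- The two incommensurability conditions exchange roles on the dual side, because the reciprocal
  -- of the reciprocal lattice is the original one.
  have inc_rp : lattice (recip (rpLat A 0)) ⊓ lattice (recip (rpLat A 1)) = ⊥ := by
    simp only [rpLat, recip_recip (hA _)]
    rw [inf_comm]
    exact hinc.1
  have inc_ms : lattice (rpLat A 0) ⊓ lattice (rpLat A 1) = ⊥ := by
    rw [inf_comm]
    exact hinc.2
  have b_cf := isBlockHopping_obsHop (det_rlLat hA) cfTori_eq neg_one_sq'
    (fun k => (hh k).isGood_cf hA) hinc.2 hγ (by rw [← e_rl]; exact a_rl)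
    (fun k => isFibred_piCf hA (hh k)) a_cf
  have b_ms := isBlockHopping_obsHop (det_rpLat hA) msTori_eq (one_pow 2)
    (fun k => (hh k).isGood_ms hA) inc_rp hγ (by rw [← e_rp]; exact a_rp)
    (fun k => isFibred_piMs hA (hh k)) a_ms
  have t_rl := hasThermoTrace_fiberObs (det_rlLat hA) cfTori_eq neg_one_sq'
    (fun k => (hh k).isGood_cf hA) hinc.2 hγ (by rw [← e_rl]; exact a_rl)
  have t_rp := hasThermoTrace_fiberObs (det_rpLat hA) msTori_eq (one_pow 2)
    (fun k => (hh k).isGood_ms hA) inc_rp hγ (by rw [← e_rp]; exact a_rp)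
  have t_rp' := hasThermoTrace_obs_piRp hA hinc.1 hh hγ a_rp a_cf b_cf
  rw [fiberObs, ← e_rl] at t_rl
  rw [fiberObs, ← e_rp] at t_rp
  -- The reciprocal space limit has been computed twice, from the momentum space hopping functions
  -- and from those of configuration space. Uniqueness of limits joins the two pairs.
  have e := tendsto_nhds_unique t_rp t_rp'
  refine ⟨_, t_rp', ⟨⟨_, b_ms⟩, fun a ha => ?_⟩, t_rl, ⟨_, b_cf⟩, fun a ha => ?_⟩
  · rw [← e]
    exact hoppingTrace_eq (det_rpLat hA) msTori_eq inc_ms ha b_ms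
  · exact hoppingTrace_eq (det_rlLat hA) cfTori_eq hinc.1 ha b_cf
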